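/- **Setup.** Let $G$ be a complex reductive (for instance semisimple) linear Lie group: a closed subgroup of the unit group of a finite-dimensional unital associative complex algebra $\mathbb A$ (for instance $G\subset GL_N(\mathbb C)\subset M_N(\mathbb C)$) whose Lie algebra $\mathcal G\subset\mathbb A$ is a complex subspace in which every ideal has a complementary ideal. Let $\sigma,\tau$ be commuting involutions of $G$, $\sigma$ with complex linear and $\tau$ with conjugate linear differential. Let $U=\{g\in G:\tau(g)=g\}$, $U_0=\{g\in U:\sigma(g)=g\}$, with Lie algebras $\mathcal U$, $\mathcal U_0$, and let $\mathcal U=\mathcal U_0+\mathcal U_1$ be the decomposition into the $\pm1$-eigenspaces of $d\sigma_e$. Assume that $U/U_0$ is a Riemannian symmetric space: $\mathrm{Ad}(U_0)$ acting on $\mathcal U$ is compact, and $(\ ,\ )$ is a non-degenerate symmetric bilinear form on $\mathcal U$, invariant under $\mathrm{Ad}(U)$ and $d\sigma_e$, and positive definite on $\mathcal U_1$. Let $\mathcal A$ be a maximal abelian linear subspace of $\mathcal U_1$ and $a_1,\dots,a_n$ an orthonormal basis of $\mathcal A$ (so $n$ is the rank). The group $U$ acts on itself by $g*x=g\,x\,\sigma(g)^{-1}$,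 and $U/U_0$ is identified, by the Cartan embedding, with the orbit $\{g\sigma(g)^{-1}: g\in U\}\subset U$ of $e$, with the metric induced from the bi-invariant (pseudo-Riemannian) metric of $U$ given by $(\ ,\ )$. The *flats* of $U/U_0$ are the subsets $\{g*\exp\xi:\xi\in\mathcal A'\}$, where $g\in U$ and $\mathcal A'\subset\mathcal U_1$ is maximal abelian. A point of $U/U_0$ is *regular* if its $U_0$-orbit is principal, i.e. if its isotropy group in $U_0$ is conjugate in $U_0$ to a subgroup of the isotropy group of every nearby point of $U/U_0$. For $\Omega\subset\mathbb R^n$ open, a *curved flat* $f:\Omega\to U/U_0$ is a smooth immersion whose induced metric is flat (locally the pull-back of the Euclidean metric of $\mathbb R^n$ under a smooth coordinate map) and whose tangent plane at every point is the tangent plane at that point of some flat of $U/U_0$. A solution on $\Omega$ of the *$U/U_0$-system* is a smooth map $v:\Omega\to\mathcal U_1\cap\mathcal A^\perp$ with $$[a_i,v_{x_j}]-[a_j,v_{x_i}]=[[a_i,v],[a_j,v]],\qquad i\neq j.$$ If $0\in\Omega$, a *frame* of its Lax $n$-tuple is a family of maps $E(\cdot,\lambda):\Omega\to G$, $\lambda\in\mathbb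 C$, smooth in $x$, with $$E^{-1}dE=\sum_{i=1}^n(a_i\lambda+[a_i,v])\,dx_i,\qquad E(0,\lambda)=e .$$ **Theorem.** (1) Let $\Omega\subset\mathbb R^n$ be open and connected with $0\in\Omega$ (for instance $\Omega=\mathbb R^n$), $v$ a solution of the $U/U_0$-system on $\Omega$, and $E$ the frame of its Lax $n$-tuple. Then $$\psi(x)=E(x,1)\,E(x,-1)^{-1}$$ is a curved flat $\psi:\Omega\to U/U_0$: an immersed flat submanifold of $U/U_0$ that is tangent to a flat of $U/U_0$ at every point. (2) Conversely, let $O\subset\mathbb R^n$ be open and let $f:O\to U/U_0$ be a curved flat all of whose points are regular points of $U/U_0$. Then locally $f$ arises in this way, up to reparametrization and the isometric action of $U$ on $U/U_0$: for every $p\in O$ there are an open ball $D$ about $0$ in $\mathbb R^n$, a solution $v$ of the $U/U_0$-system on $D$ with frame $E$, a smooth diffeomorphism $\varphi$ of $D$ onto an open subset of $O$ with $\varphi(0)=p$, and $h\in U$ such that $$f(\varphi(x))=h*\psi(x)=h\,E(x,1)E(x,-1)^{-1}\sigma(h)^{-1}\qquad\text{for all }x\in D.$$ -/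

import Mathlib

open scoped ContDiff Topology

attribute [local instance 100] LieRing.ofAssociativeRing

noncomputable section

namespace CurvedFlats

/-- A complex reductive (for instance semisimple) linear Lie group `G`, a closed group of units of a
finite-dimensional unital associative complex algebra `𝔸` (for instance `M_N(ℂ)`, so that
`G ⊆ GL_N(ℂ)`), together with two commuting involutions `σ`, `τ` of `G`, where `σ` is holomorphic
(complex linear differential) and `τ` is antiholomorphic (conjugate linear differential). -/
structure SymmetricPair (𝔸 : Type*) [NormedRing 𝔸] [NormedAlgebra ℂ 𝔸] where
  G : Subgroup 𝔸ˣ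
  isClosed_G : IsClosed (G : Set 𝔸ˣ)
  /-- the Lie algebra of `G`, required to be a complex subspace of `𝔸` -/
  𝔤 : LieSubalgebra ℂ 𝔸
  mem_𝔤 : ∀ X : 𝔸, X ∈ 𝔤 ↔ ∀ t : ℝ, ∃ g ∈ G, (g : 𝔸) = NormedSpace.exp (t • X)
  /-- reductivity: every ideal of `𝔤` has a complementary ideal -/
  reductive : ComplementedLattice (LieIdeal ℂ 𝔤)
  σ : G →* G
  τ : G →* G
  σ_σ : ∀ g, σ (σ g) = g
  τ_τ : ∀ g, τ (τ g) = g
  σ_τ : ∀ g, σ (τ g) = τ (σ g)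
  /-- the differential of `σ` at the identity -/
  dσ : 𝔤 →ₗ[ℂ] 𝔤
  /-- the differential of `τ` at the identity -/
  dτ : 𝔤 →ₛₗ[starRingEnd ℂ] 𝔤
  σ_exp : ∀ (X : 𝔤) (g : G), ((g : 𝔸ˣ) : 𝔸) = NormedSpace.exp (X : 𝔸) →
    ((σ g : 𝔸ˣ) : 𝔸) = NormedSpace.exp (dσ X : 𝔸)
  τ_exp : ∀ (X : 𝔤) (g : G), ((g : 𝔸ˣ) : 𝔸) = NormedSpace.exp (X : 𝔸) →
    ((τ g : 𝔸ˣ) : 𝔸) = NormedSpace.exp (dτ X : 𝔸)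

variable {𝔸 : Type*} [NormedRing 𝔸] [NormedAlgebra ℂ 𝔸]

namespace SymmetricPair

variable (S : SymmetricPair 𝔸)

/-- The inclusion `G ⊆ 𝔸`. -/
def val (g : S.G) : 𝔸 := ((g : 𝔸ˣ) : 𝔸)

/-- The adjoint action `Ad(g) X = g X g⁻¹`. -/
def Ad (g : S.G) (X : 𝔸) : 𝔸 := S.val g * X * S.val g⁻¹

/-- The real form `U` of `G`, the fixed point group of `τ`. -/
def U : Subgroup S.G where
  carrier := {g | S.τ g = g}
  mul_mem' := by
    intro a b ha hb
    simp only [Set.mem_ofPred_eq] at *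
    rw [map_mul, ha, hb]
  one_mem' := map_one _
  inv_mem' := by
    intro a ha
    simp only [Set.mem_ofPred_eq] at *
    rw [map_inv, ha]

/-- The isotropy group `U₀`, the subgroup of `U` fixed by `σ`. -/
def U₀ : Subgroup S.G where
  carrier := {g | g ∈ S.U ∧ S.σ g = g}
  mul_mem' := by
    rintro a b ⟨ha, ha'⟩ ⟨hb, hb'⟩
    exact ⟨S.U.mul_mem ha hb, by rw [map_mul, ha', hb']⟩
  one_mem' := ⟨S.U.one_mem, map_one _⟩
  inv_mem' := by
    rintro a ⟨ha, ha'⟩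
    exact ⟨S.U.inv_mem ha, by rw [map_inv, ha']⟩

/-- The Lie algebra `𝔲` of `U`, the fixed point set of `dτ` in `𝔤`. -/
def 𝔲 : Submodule ℝ 𝔸 where
  carrier := {X | ∃ h : X ∈ S.𝔤, S.dτ ⟨X, h⟩ = ⟨X, h⟩}
  add_mem' := by
    rintro X Y ⟨hX, hX'⟩ ⟨hY, hY'⟩
    refine ⟨S.𝔤.add_mem hX hY, ?_⟩
    have : (⟨X + Y, S.𝔤.add_mem hX hY⟩ : S.𝔤) = ⟨X, hX⟩ + ⟨Y, hY⟩ := rfl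
    rw [this, map_add, hX', hY']
  zero_mem' := ⟨S.𝔤.zero_mem, map_zero S.dτ⟩
  smul_mem' := by
    rintro c X ⟨hX, hX'⟩
    have h : c • X = (c : ℂ) • X := (Complex.coe_smul c X).symm
    have hm : c • X ∈ S.𝔤 := h ▸ S.𝔤.smul_mem (c : ℂ) hX
    refine ⟨hm, ?_⟩
    have : (⟨c • X, hm⟩ : S.𝔤) = (c : ℂ) • ⟨X, hX⟩ := Subtype.ext h
    rw [this, map_smulₛₗ, hX', Complex.conj_ofReal]

/-- The `ε`-eigenspace of `dσ` on `𝔲`. -/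
def eig (ε : ℝ) : Submodule ℝ 𝔸 where
  carrier := {X | X ∈ S.𝔲 ∧ ∃ h : X ∈ S.𝔤, (S.dσ ⟨X, h⟩ : 𝔸) = ε • X}
  add_mem' := by
    rintro X Y ⟨hX, hX₁, hX₂⟩ ⟨hY, hY₁, hY₂⟩
    refine ⟨S.𝔲.add_mem hX hY, S.𝔤.add_mem hX₁ hY₁, ?_⟩
    have : (⟨X + Y, S.𝔤.add_mem hX₁ hY₁⟩ : S.𝔤) = ⟨X, hX₁⟩ + ⟨Y, hY₁⟩ := rfl
    rw [this, map_add, smul_add, ← hX₂, ← hY₂]; rfl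
  zero_mem' := by
    refine ⟨S.𝔲.zero_mem, S.𝔤.zero_mem, ?_⟩
    have : (⟨0, S.𝔤.zero_mem⟩ : S.𝔤) = 0 := rfl
    rw [this, map_zero, smul_zero]; rfl
  smul_mem' := by
    rintro c X ⟨hX, hX₁, hX₂⟩
    have h : c • X = (c : ℂ) • X := (Complex.coe_smul c X).symm
    have hm : c • X ∈ S.𝔤 := h ▸ S.𝔤.smul_mem (c : ℂ) hX₁
    refine ⟨S.𝔲.smul_mem c hX, hm, ?_⟩
    have : (⟨c • X, hm⟩ : S.𝔤) = (c : ℂ) • ⟨X, hX₁⟩ := Subtype.ext h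
    rw [this, map_smul, smul_comm, ← hX₂, ← Complex.coe_smul]; rfl

/-- The Lie algebra `𝔲₀` of `U₀`, the `+1`-eigenspace of `dσ` on `𝔲`. -/
def 𝔲₀ : Submodule ℝ 𝔸 := S.eig 1

/-- The `-1`-eigenspace `𝔲₁` of `dσ` on `𝔲`; thus `𝔲 = 𝔲₀ + 𝔲₁`. -/
def 𝔲₁ : Submodule ℝ 𝔸 := S.eig (-1)

/-- `U/U₀` is a Riemannian symmetric space with the metric given by `B`: the group `Ad(U₀)` of
transformations of `𝔲` is compact, and `B` restricts to a non-degenerate symmetric bilinear form on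
`𝔲` that is invariant under `Ad(U)` and `dσ`, and positive definite on `𝔲₁`. (Only the values of `B`
on `𝔲` matter.) -/
structure IsRiemannian (B : LinearMap.BilinForm ℝ 𝔸) : Prop where
  isCompact_Ad : IsCompact {L : S.𝔲 →L[ℝ] 𝔸 | ∃ k ∈ S.U₀, ∀ X : S.𝔲, L X = S.Ad k X}
  symm : ∀ X ∈ S.𝔲, ∀ Y ∈ S.𝔲, B X Y = B Y X
  nondegenerate : ∀ X ∈ S.𝔲, (∀ Y ∈ S.𝔲, B X Y = 0) → X = 0
  Ad_invariant : ∀ g ∈ S.U, ∀ X ∈ S.𝔲, ∀ Y ∈ S.𝔲, B (S.Ad g X) (S.Ad g Y) = B X Y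
  σ_invariant : ∀ X Y : S.𝔤, (X : 𝔸) ∈ S.𝔲 → (Y : 𝔸) ∈ S.𝔲 → B (S.dσ X) (S.dσ Y) = B X Y
  pos : ∀ X ∈ S.𝔲₁, X ≠ 0 → 0 < B X X

/-- `A` is a maximal abelian linear subspace of `𝔲₁`. -/
structure IsMaxAbelian (A : Submodule ℝ 𝔸) : Prop where
  le : A ≤ S.𝔲₁
  abelian : ∀ X ∈ A, ∀ Y ∈ A, ⁅X, Y⁆ = 0
  maximal : ∀ A' : Submodule ℝ 𝔸, A' ≤ S.𝔲₁ → (∀ X ∈ A', ∀ Y ∈ A', ⁅X, Y⁆ = 0) → A ≤ A' → A' = A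

/-- The action `g ∗ x = g x σ(g)⁻¹`. -/
def act (g x : S.G) : S.G := g * x * (S.σ g)⁻¹

/-- The symmetric space `U/U₀ = {g σ(g)⁻¹ | g ∈ U}`, Cartan embedded in `U` as the orbit of the
identity under the action `∗` of `U`. -/
def symmSpace : Set S.G := {p | ∃ g ∈ S.U, p = S.act g 1}

/-- `x` is a regular point of `U/U₀`: its orbit under `U₀` is principal, that is, the isotropy group
of `x` in `U₀` is conjugate in `U₀` to a subgroup of the isotropy group of every point near `x`. -/
def IsRegularPoint (x : S.G) : Prop :=
  x ∈ S.symmSpace ∧ ∀ᶠ y in 𝓝 x, y ∈ S.symmSpace →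
    ∃ k ∈ S.U₀, ∀ s ∈ S.U₀, S.act s x = x → S.act (k * s * k⁻¹) y = y

/-- The flat `{g ∗ exp ξ | ξ ∈ A'}` of `U/U₀` attached to `g ∈ U` and a maximal abelian subspace `A'`
of `𝔲₁` is the image of `A'` under this map. -/
def flatMap (g : S.G) (ξ : 𝔸) : 𝔸 := S.val g * NormedSpace.exp ξ * S.val (S.σ g)⁻¹

variable {n : ℕ}

/-- The coordinate derivative `∂w/∂x_i` at `x`. -/
def pd (i : Fin n) (w : EuclideanSpace ℝ (Fin n) → 𝔸) (x : EuclideanSpace ℝ (Fin n)) : 𝔸 :=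
  fderiv ℝ w x (EuclideanSpace.single i 1)

/-- The metric induced on the parameter domain by `f`, where `U/U₀ ⊆ U` carries the metric
induced from the bi-invariant one on `U`: `(u, w) ↦ B (f⁻¹ df(u)) (f⁻¹ df(w))`. -/
def inducedMetric (B : LinearMap.BilinForm ℝ 𝔸) (f : EuclideanSpace ℝ (Fin n) → S.G)
    (x u w : EuclideanSpace ℝ (Fin n)) : ℝ :=
  B (S.val (f x)⁻¹ * fderiv ℝ (fun y => S.val (f y)) x u)
    (S.val (f x)⁻¹ * fderiv ℝ (fun y => S.val (f y)) x w)

/-- `f` is tangent at `x` to a flat of `U/U₀`: some flat passes through `f x`, at the parameter value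
`ξ₀`, and its tangent plane there is the tangent plane of `f` at `x`. -/
def TangentToFlat (f : EuclideanSpace ℝ (Fin n) → S.G) (x : EuclideanSpace ℝ (Fin n)) : Prop :=
  ∃ g ∈ S.U, ∃ A' : Submodule ℝ 𝔸, S.IsMaxAbelian A' ∧ ∃ ξ₀ ∈ A',
    S.val (f x) = S.flatMap g ξ₀ ∧
    LinearMap.range (fderiv ℝ (fun y => S.val (f y)) x).toLinearMap =
      A'.map (fderiv ℝ (S.flatMap g) ξ₀).toLinearMap

/-- `f : Ω → U/U₀` is a curved flat: an immersed submanifold of `U/U₀` that is flat (near every point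
the induced metric is the pull-back of the Euclidean metric of `ℝⁿ` under a coordinate map) and
tangent to a flat of `U/U₀` at every point. -/
structure IsCurvedFlat (B : LinearMap.BilinForm ℝ 𝔸) (Ω : Set (EuclideanSpace ℝ (Fin n)))
    (f : EuclideanSpace ℝ (Fin n) → S.G) : Prop where
  mem : ∀ x ∈ Ω, f x ∈ S.symmSpace
  smooth : ContDiffOn ℝ ∞ (fun x => S.val (f x)) Ω
  immersion : ∀ x ∈ Ω, Function.Injective (fderiv ℝ (fun y => S.val (f y)) x)
  flat : ∀ x ∈ Ω, ∃ O ⊆ Ω, IsOpen O ∧ x ∈ O ∧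
    ∃ y : EuclideanSpace ℝ (Fin n) → EuclideanSpace ℝ (Fin n), ContDiffOn ℝ ∞ y O ∧
      ∀ z ∈ O, ∀ u w, S.inducedMetric B f z u w = inner ℝ (fderiv ℝ y z u) (fderiv ℝ y z w)
  tangent : ∀ x ∈ Ω, S.TangentToFlat f x

/-- `v : Ω → 𝔲₁ ∩ A^⊥` is a (smooth) solution of the `U/U₀`-system
`[a_i, v_{x_j}] - [a_j, v_{x_i}] = [[a_i, v], [a_j, v]]`, where `a` is a basis of `A`. -/
structure IsSolution (B : LinearMap.BilinForm ℝ 𝔸) (A : Submodule ℝ 𝔸) (a : Fin n → 𝔸)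
    (Ω : Set (EuclideanSpace ℝ (Fin n))) (v : EuclideanSpace ℝ (Fin n) → 𝔸) : Prop where
  smooth : ContDiffOn ℝ ∞ v Ω
  mem : ∀ x ∈ Ω, v x ∈ S.𝔲₁
  perp : ∀ x ∈ Ω, ∀ b ∈ A, B (v x) b = 0
  eqn : ∀ x ∈ Ω, ∀ i j, i ≠ j →
    ⁅a i, pd j v x⁆ - ⁅a j, pd i v x⁆ = ⁅⁅a i, v x⁆, ⁅a j, v x⁆⁆

/-- `E(x, λ) ∈ G` is the frame of the Lax `n`-tuple `θ_λ = ∑ i, (a_i λ + [a_i, v]) dx_i`: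
`E⁻¹ dE = θ_λ` and `E(0, λ) = e` for all `λ ∈ ℂ`. -/
structure IsFrame (a : Fin n → 𝔸) (Ω : Set (EuclideanSpace ℝ (Fin n)))
    (v : EuclideanSpace ℝ (Fin n) → 𝔸) (E : EuclideanSpace ℝ (Fin n) → ℂ → S.G) : Prop where
  init : ∀ l, E 0 l = 1
  smooth : ∀ l, ContDiffOn ℝ ∞ (fun x => S.val (E x l)) Ω
  eqn : ∀ l, ∀ x ∈ Ω, ∀ i,
    pd i (fun y => S.val (E y l)) x = S.val (E x l) * (l • a i + ⁅a i, v x⁆)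

/-- `ψ(x) = E(x, 1) E(x, -1)⁻¹`. -/
def psi (E : EuclideanSpace ℝ (Fin n) → ℂ → S.G) (x : EuclideanSpace ℝ (Fin n)) : S.G :=
  E x 1 * (E x (-1))⁻¹

end SymmetricPair

end CurvedFlats

end

/-!
Write `θ_λ = ∑ i, (λ a_i + [a_i, v]) dx_i`. The equations of the `U/U₀`-system say that `θ_λ` is
flat for every `λ`, so that frames exist, and `Dσ θ_λ = θ_{-λ}`, `Dτ θ_λ = θ_λ` for real `λ` give
`σ(E(x, 1)) = E(x, -1)` and `E(x, 1) ∈ U`. Hence `ψ = E(x, 1) σ(E(x, 1))⁻¹` is the point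
`E(x, 1) ∗ e`, and its differential comes from the `𝔲₁`-part `∑ i, a_i dx_i` of `θ_1`. Therefore
the induced metric is `4 ∑ i, dx_i²`, and `ψ` is tangent at `x` to the flat `E(x, 1) ∗ exp A`
(`isCurvedFlat_psi`).

For the converse, lift `f` near `p` to a map `g` into `U` with `f = g σ(g)⁻¹`: the map `f` is
locally a translate of `exp X` with `X ∈ 𝔲₁`, and `exp (X / 2)` is a lift (`exists_isLift`).
Tangency to flats means that the `𝔲₁`-part of `g⁻¹ dg` has a maximal abelian range at each point
(`TangentToFlat.isMaxAbelian_range`). These ranges are rotated into `A` by a map into `U₀`. At `p`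
this is the conjugacy of maximal abelian subspaces (`IsMaxAbelian.exists_map_AdL_eq`). Near `p` it
suffices to rotate one vector field of the range whose value at `p` is a regular element of `A`,
because a regular element determines its maximal abelian subspace; the implicit function theorem
does this smoothly (`exists_polar`). No regularity of the points of `f` is used. Now the
`𝔲₁`-part is `∑ i, a_i dy_i`: the structure equation makes its components closed, and their
primitives `y_i` are coordinates because `f` is an immersion.

In these coordinates `g⁻¹ ∂_i g = a_i + u_i` with `u_i ∈ 𝔲₀`, and the structure equation gives
`[a_i, u_j] = [a_j, u_i]`. As `(ad H)²` is invertible on `𝔲₁ ∩ A^⊥` for regular `H ∈ A`, it follows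
that `u_i = m_i + [a_i, v]` with `v ∈ 𝔲₁ ∩ A^⊥` and `m_i` in the centralizer of `A`. The invariant
form separates the remaining equations (`IsRiemannian.decouple`): `∑ i, m_i dx_i` is flat, and the
gauge transformation `q` with `q⁻¹ dq = ∑ i, m_i dx_i` turns `v` into a solution `Ad(q) v` and
`g q⁻¹` into a translate of its frame at `λ = 1` (`exists_solution_of_lift`).

Regular elements exist because `ad H` is semisimple for `H ∈ 𝔲₁`. The form `B` may be indefinite on
`𝔲₀`, so this is derived from the compactness of `Ad(U₀)` and the reductivity of `𝔤`: if
`[H, [H, X]] = 0`, then `Z = [H, X]` commutes with `H`, hence is nilpotent in `𝔸`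
(`isNilpotent_of_lie_eq`); `ad Z` is then nilpotent, but also semisimple on `𝔲` because `Ad(U₀)`
is bounded, so that `Z` is central in `𝔤` and a commutator, hence zero.

The Lie theory is done by hand for the closed group `G` of units of `𝔸`: the closed subgroup theorem
(`eventually_expLog_mem`), the differentials of `σ` and `τ` along maps into `G`
(`IsDifferential.hasLogDerivAt`), and the integration of flat forms on balls along rays
(`exists_integral_of_flat`).
-/

section

open NormedSpace (exp)

set_option linter.unusedSectionVars false

-- The structure `AddCommGroup 𝔸` is to come from the norm, not from the commutator bracket, which
-- the instance `LieRing.ofAssociativeRing` would otherwise bring in first.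
attribute [local instance 10] LieRing.toAddCommGroup

namespace CurvedFlats

/-! ### The exponential map and the logarithm -/

section BanachAlgebra

variable {𝔸 : Type*} [NormedRing 𝔸] [NormedAlgebra ℂ 𝔸] [CompleteSpace 𝔸]

lemma contDiff_exp : ContDiff ℝ ω (exp : 𝔸 → 𝔸) := by
  rw [contDiff_iff_contDiffAt]
  intro x
  exact (NormedSpace.exp_analytic (𝕂 := ℝ) x).contDiffAt

lemma exp_mul_exp_neg (X : 𝔸) : exp X * exp (-X) = 1 := by
  let _ : NormedAlgebra ℚ 𝔸 := NormedAlgebra.restrictScalars ℚ ℝ 𝔸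
  rw [← NormedSpace.exp_add_of_commute (Commute.neg_right (Commute.refl X)), add_neg_cancel,
    NormedSpace.exp_zero]

lemma exp_neg_mul_exp (X : 𝔸) : exp (-X) * exp X = 1 := by
  simpa using exp_mul_exp_neg (-X)

lemma hasDerivAt_exp_conj (Z Y : 𝔸) (t : ℝ) :
    HasDerivAt (fun t : ℝ => exp (t • Z) * Y * exp (-(t • Z)))
      (exp (t • Z) * ⁅Z, Y⁆ * exp (-(t • Z))) t := by
  have h1 := hasDerivAt_exp_smul_const (𝕂 := ℝ) Z t
  have h2 := hasDerivAt_exp_smul_const' (𝕂 := ℝ) (-Z) t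
  simp only [smul_neg] at h2
  refine ((h1.mul_const Y).mul h2).congr_deriv ?_
  rw [Ring.lie_def]
  noncomm_ring

lemma exp_conj_eq_of_lie_lie_eq_zero {Z Y : 𝔸} (h : ⁅Z, ⁅Z, Y⁆⁆ = 0) (t : ℝ) :
    exp (t • Z) * Y * exp (-(t • Z)) = Y + t • ⁅Z, Y⁆ := by
  have hc : ∀ t : ℝ, exp (t • Z) * ⁅Z, Y⁆ * exp (-(t • Z)) = ⁅Z, Y⁆ := by
    intro t
    have := is_const_of_deriv_eq_zero (f := fun t : ℝ => exp (t • Z) * ⁅Z, Y⁆ * exp (-(t • Z)))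
      (fun t => (hasDerivAt_exp_conj Z ⁅Z, Y⁆ t).differentiableAt)
      (fun t => by rw [(hasDerivAt_exp_conj Z ⁅Z, Y⁆ t).deriv, h]; simp) t 0
    simpa using this
  have hd : ∀ t : ℝ, HasDerivAt
      (fun t : ℝ => exp (t • Z) * Y * exp (-(t • Z)) - t • ⁅Z, Y⁆) 0 t := by
    intro t
    refine ((hasDerivAt_exp_conj Z Y t).sub
      ((hasDerivAt_id t).smul_const ⁅Z, Y⁆)).congr_deriv ?_
    rw [hc t]; simp
  have := is_const_of_deriv_eq_zero (fun t => (hd t).differentiableAt) (fun t => (hd t).deriv) t 0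
  rw [← sub_eq_iff_eq_add]
  simpa using this

/-- One-parameter groups determine their generator. -/
lemma eq_of_forall_exp_smul_eq {X Y : 𝔸} (h : ∀ t : ℝ, exp (t • X) = exp (t • Y)) : X = Y := by
  have h1 := hasDerivAt_exp_smul_const (𝕂 := ℝ) X 0
  have h2 := hasDerivAt_exp_smul_const (𝕂 := ℝ) Y 0
  rw [show (fun t : ℝ => exp (t • X)) = fun t : ℝ => exp (t • Y) from funext h] at h1
  simpa using h1.unique h2

lemma fderiv_exp_apply_of_commute {ξ η : 𝔸} (h : Commute ξ η) :
    fderiv ℝ (exp : 𝔸 → 𝔸) ξ η = exp ξ * η := by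
  let _ : NormedAlgebra ℚ 𝔸 := NormedAlgebra.restrictScalars ℚ ℝ 𝔸
  have h0 : DifferentiableAt ℝ (exp : 𝔸 → 𝔸) ξ :=
    (contDiff_exp (𝔸 := 𝔸)).differentiable (by simp) ξ
  have h1 : HasDerivAt (fun t : ℝ => ξ + t • η) η 0 := by
    simpa using ((hasDerivAt_id (0 : ℝ)).smul_const η).const_add ξ
  have h2 : HasDerivAt (fun t : ℝ => exp (ξ + t • η)) (fderiv ℝ (exp : 𝔸 → 𝔸) ξ η) 0 := by
    have h0' : HasFDerivAt (exp : 𝔸 → 𝔸) (fderiv ℝ (exp : 𝔸 → 𝔸) ξ) (ξ + (0 : ℝ) • η) := by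
      simpa using h0.hasFDerivAt
    exact h0'.comp_hasDerivAt (0 : ℝ) h1
  have h3 : (fun t : ℝ => exp (ξ + t • η)) = fun t : ℝ => exp ξ * exp (t • η) := by
    funext t
    exact NormedSpace.exp_add_of_commute (h.smul_right t)
  rw [h3] at h2
  have h4 := (hasDerivAt_exp_smul_const (𝕂 := ℝ) η 0).const_mul (exp ξ)
  simpa using h2.unique h4

/-- In an associative algebra, a commutator `Z = [H, X]` that commutes with `H` is nilpotent: `X`
and `X + t Z` are conjugate for every `t`, so that `det (μ - ε X - Z) = det (μ - ε X)` for the left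
multiplications, and `ε → 0` shows that the characteristic polynomial of `Z` is a power of the
variable. -/
lemma isNilpotent_of_lie_eq [FiniteDimensional ℂ 𝔸] {H X Z : 𝔸} (hZ : ⁅H, X⁆ = Z)
    (hH : ⁅H, Z⁆ = 0) : IsNilpotent Z := by
  let L : 𝔸 → (𝔸 →L[ℂ] 𝔸) := fun Y => ContinuousLinearMap.mul ℂ 𝔸 Y
  have hLmul : ∀ Y W, L (Y * W) = L Y * L W := by
    intro Y W; ext T; simp [L, mul_assoc]
  let N : 𝔸 → ℂ := fun Y => (L Y).det
  have hNmul : ∀ Y W, N (Y * W) = N Y * N W := by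
    intro Y W
    simp only [N, hLmul]
    exact map_mul LinearMap.det ((L Y : 𝔸 →L[ℂ] 𝔸) : 𝔸 →ₗ[ℂ] 𝔸) (L W : 𝔸 →ₗ[ℂ] 𝔸)
  have hNc : Continuous N := by
    exact ContinuousLinearMap.continuous_det.comp (ContinuousLinearMap.mul ℂ 𝔸).continuous
  have hN1 : N 1 = 1 := by
    have : L 1 = 1 := by ext T; simp [L]
    simp only [N, this]
    exact map_one LinearMap.det
  have hconj : ∀ (t : ℝ) (Y : 𝔸), N (exp (t • H) * Y * exp (-(t • H))) = N Y := by
    intro t Y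
    rw [hNmul, hNmul, mul_comm, ← mul_assoc, ← hNmul, exp_neg_mul_exp, hN1, one_mul]
  have key : ∀ (μ : ℂ) (ε : ℝ), 0 < ε → N (μ • 1 - ε • X - Z) = N (μ • 1 - ε • X) := by
    intro μ ε hε
    have h1 := exp_conj_eq_of_lie_lie_eq_zero (Z := H) (Y := X) (by rw [hZ, hH]) ε⁻¹
    rw [← hconj ε⁻¹ (μ • 1 - ε • X)]
    congr 1
    rw [mul_sub, sub_mul, mul_smul_comm, smul_mul_assoc, mul_one, exp_mul_exp_neg,
      mul_smul_comm, smul_mul_assoc, h1, hZ, smul_add, smul_smul, mul_inv_cancel₀ hε.ne', one_smul]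
    abel
  have hdet : ∀ μ : ℂ, N (μ • 1 - Z) = N (μ • 1) := by
    intro μ
    have c1 : Continuous fun ε : ℝ => N (μ • 1 - ε • X - Z) := by fun_prop
    have c2 : Continuous fun ε : ℝ => N (μ • 1 - ε • X) := by fun_prop
    have l1 := (c1.tendsto 0).mono_left (nhdsWithin_le_nhds (s := Set.Ioi 0))
    have l2 := (c2.tendsto 0).mono_left (nhdsWithin_le_nhds (s := Set.Ioi 0))
    have := tendsto_nhds_unique (l1.congr' (by
      filter_upwards [self_mem_nhdsWithin] with ε hε using key μ ε hε)) l2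
    simpa using this
  let f : 𝔸 →ₗ[ℂ] 𝔸 := (L Z : 𝔸 →ₗ[ℂ] 𝔸)
  have hchar : f.charpoly = Polynomial.X ^ Module.finrank ℂ 𝔸 := by
    rw [← LinearMap.charpoly_zero]
    refine Polynomial.funext fun μ => ?_
    rw [LinearMap.eval_charpoly, LinearMap.eval_charpoly]
    have e1 : algebraMap ℂ (Module.End ℂ 𝔸) μ - f = (L (μ • 1 - Z) : 𝔸 →ₗ[ℂ] 𝔸) := by
      ext T; simp [L, f]
    have e2 : algebraMap ℂ (Module.End ℂ 𝔸) μ - 0 = (L (μ • 1) : 𝔸 →ₗ[ℂ] 𝔸) := by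
      ext T; simp [L]
    rw [e1, e2]
    exact hdet μ
  have hCH := LinearMap.aeval_self_charpoly f
  rw [hchar, map_pow, Polynomial.aeval_X] at hCH
  refine ⟨Module.finrank ℂ 𝔸, ?_⟩
  have hpow : ∀ k : ℕ, (f ^ k) 1 = Z ^ k := by
    intro k
    induction k with
    | zero => simp
    | succ k ih => rw [pow_succ', Module.End.mul_apply, ih, pow_succ']; rfl
  rw [← hpow, hCH]; rfl

variable (𝔸) in
/-- The logarithm near `1`, as the local inverse of the exponential map at `0`. -/
noncomputable def expLog : 𝔸 → 𝔸 :=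
  (contDiff_exp (𝔸 := 𝔸)).contDiffAt.localInverse (a := 0)
    (f' := ContinuousLinearEquiv.refl ℝ 𝔸) (hasFDerivAt_exp_zero (𝕂 := ℝ)) (by simp)

lemma eventually_exp_expLog : ∀ᶠ a in 𝓝 (1 : 𝔸), exp (expLog 𝔸 a) = a := by
  have h : HasStrictFDerivAt (exp : 𝔸 → 𝔸)
      (ContinuousLinearEquiv.refl ℝ 𝔸 : 𝔸 →L[ℝ] 𝔸) 0 := hasStrictFDerivAt_exp_zero (𝕂 := ℝ)
  have := h.eventually_right_inverse
  rwa [NormedSpace.exp_zero] at this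

lemma eventually_expLog_exp : ∀ᶠ X in 𝓝 (0 : 𝔸), expLog 𝔸 (exp X) = X := by
  have h : HasStrictFDerivAt (exp : 𝔸 → 𝔸)
      (ContinuousLinearEquiv.refl ℝ 𝔸 : 𝔸 →L[ℝ] 𝔸) 0 := hasStrictFDerivAt_exp_zero (𝕂 := ℝ)
  exact h.eventually_left_inverse

lemma expLog_one : expLog 𝔸 1 = 0 := by
  simpa using (eventually_expLog_exp (𝔸 := 𝔸)).self_of_nhds

lemma contDiffAt_expLog_one : ContDiffAt ℝ ω (expLog 𝔸) 1 := by
  have := (contDiff_exp (𝔸 := 𝔸)).contDiffAt.to_localInverse (a := 0)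
    (f' := ContinuousLinearEquiv.refl ℝ 𝔸) (hasFDerivAt_exp_zero (𝕂 := ℝ)) (by simp)
  rwa [NormedSpace.exp_zero] at this

lemma eventually_contDiffAt_expLog : ∀ᶠ a in 𝓝 (1 : 𝔸), ContDiffAt ℝ ∞ (expLog 𝔸) a := by
  filter_upwards [contDiffAt_expLog_one.eventually (by simp)] with a ha using ha.of_le le_top

lemma tendsto_expLog : Filter.Tendsto (expLog 𝔸) (𝓝 1) (𝓝 0) := by
  have := (contDiffAt_expLog_one (𝔸 := 𝔸)).continuousAt
  rwa [ContinuousAt, expLog_one] at this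

lemma hasFDerivAt_expLog : HasFDerivAt (expLog 𝔸) (ContinuousLinearMap.id ℝ 𝔸) 1 := by
  have h : HasStrictFDerivAt (exp : 𝔸 → 𝔸)
      (ContinuousLinearEquiv.refl ℝ 𝔸 : 𝔸 →L[ℝ] 𝔸) 0 := hasStrictFDerivAt_exp_zero (𝕂 := ℝ)
  have := h.to_localInverse.hasFDerivAt
  rw [NormedSpace.exp_zero] at this
  exact this

end BanachAlgebra

/-! ### Linear differential equations in closed matrix groups -/

section LinearODE

open MeasureTheory intervalIntegral

/-- The terms of the Picard series of the linear equation `y' = T y`, `y 0 = y₀`. -/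
noncomputable def picardTerm {F : Type*} [NormedAddCommGroup F] [NormedSpace ℝ F]
    (T : ℝ → F →L[ℝ] F) (y₀ : F) : ℕ → ℝ → F
  | 0 => fun _ => y₀
  | m + 1 => fun t => ∫ s in (0 : ℝ)..t, T s (picardTerm T y₀ m s)

variable {F : Type*} [NormedAddCommGroup F] [NormedSpace ℝ F] [CompleteSpace F]

/-- Linear ordinary differential equations have global solutions. -/
lemma exists_hasDerivAt_linear {T : ℝ → F →L[ℝ] F} (hT : Continuous T) (y₀ : F) :
    ∃ y : ℝ → F, y 0 = y₀ ∧ ∀ t ∈ Set.Icc (0 : ℝ) 1, HasDerivAt y (T t (y t)) t := by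
  obtain ⟨K, hK⟩ := (isCompact_Icc (a := (-2 : ℝ)) (b := 2)).exists_bound_of_continuousOn
    hT.continuousOn
  have hK0 : 0 ≤ K := (norm_nonneg _).trans (hK 0 (by norm_num))
  have hder : ∀ m t, Continuous (picardTerm T y₀ m) ∧
      HasDerivAt (picardTerm T y₀ (m + 1)) (T t (picardTerm T y₀ m t)) t := by
    have step : ∀ m, Continuous (picardTerm T y₀ m) → ∀ t,
        HasDerivAt (picardTerm T y₀ (m + 1)) (T t (picardTerm T y₀ m t)) t := by
      intro m hm t
      have hc : Continuous fun s => T s (picardTerm T y₀ m s) := hT.clm_apply hm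
      exact (hc.integral_hasStrictDerivAt 0 t).hasDerivAt
    have hcont : ∀ m, Continuous (picardTerm T y₀ m) := by
      intro m
      induction m with
      | zero => exact continuous_const
      | succ m ih =>
        exact continuous_iff_continuousAt.2 fun t => (step m ih t).continuousAt
    exact fun m t => ⟨hcont m, step m (hcont m) t⟩
  have hbound : ∀ m : ℕ, ∀ t ∈ Set.Icc (-2 : ℝ) 2,
      ‖picardTerm T y₀ m t‖ ≤ (K * |t|) ^ m / m.factorial * ‖y₀‖ := by
    intro m
    induction m with
    | zero => intro t _; simp [picardTerm]
    | succ m ih =>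
      intro t ht
      have hc : Continuous fun s => T s (picardTerm T y₀ m s) :=
        hT.clm_apply (hder m 0).1
      calc ‖picardTerm T y₀ (m + 1) t‖ ≤ ∫ s in Set.uIoc 0 t, ‖T s (picardTerm T y₀ m s)‖ :=
            norm_integral_le_integral_norm_uIoc
        _ ≤ ∫ s in Set.uIoc 0 t, K ^ (m + 1) / m.factorial * ‖y₀‖ * |s - 0| ^ m := by
            refine setIntegral_mono_on (hc.norm.integrableOn_uIoc)
              (Continuous.integrableOn_uIoc (by fun_prop)) measurableSet_uIoc fun s hs => ?_
            have hs' : s ∈ Set.Icc (-2 : ℝ) 2 :=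
              Set.uIcc_subset_Icc (by norm_num) ht (Set.uIoc_subset_uIcc hs)
            calc ‖T s (picardTerm T y₀ m s)‖ ≤ K * ((K * |s|) ^ m / m.factorial * ‖y₀‖) :=
                  (T s).le_of_opNorm_le_of_le (hK s hs') (ih s hs')
              _ = _ := by rw [sub_zero, mul_pow]; ring
        _ = _ := by
            rw [MeasureTheory.integral_const_mul, integral_pow_abs_sub_uIoc, sub_zero,
              Nat.factorial_succ, mul_pow]
            push_cast
            field_simp
  let u : ℕ → ℝ := fun m => K * ((K * 2) ^ m / m.factorial * ‖y₀‖)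
  have hu : Summable u := ((Real.summable_pow_div_factorial (K * 2)).mul_right _).mul_left _
  have hmem : ∀ t ∈ Set.Ioo (-2 : ℝ) 2, t ∈ Set.Icc (-2 : ℝ) 2 := fun t ht => ⟨ht.1.le, ht.2.le⟩
  have hb' : ∀ m : ℕ, ∀ t ∈ Set.Ioo (-2 : ℝ) 2,
      ‖picardTerm T y₀ m t‖ ≤ (K * 2) ^ m / m.factorial * ‖y₀‖ := by
    intro m t ht
    refine (hbound m t (hmem t ht)).trans ?_
    have : |t| ≤ 2 := abs_le.2 ⟨ht.1.le, ht.2.le⟩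
    gcongr
  have hsum : ∀ t ∈ Set.Ioo (-2 : ℝ) 2, Summable fun m => picardTerm T y₀ m t := fun t ht =>
    .of_norm_bounded ((Real.summable_pow_div_factorial (K * 2)).mul_right ‖y₀‖)
      fun m => hb' m t ht
  have h0 : (0 : ℝ) ∈ Set.Ioo (-2 : ℝ) 2 := by norm_num
  have hzero : ∀ m, picardTerm T y₀ (m + 1) 0 = 0 := fun m => by simp [picardTerm]
  refine ⟨fun t => y₀ + ∑' m, picardTerm T y₀ (m + 1) t, by simp [hzero], fun t ht => ?_⟩
  have ht' : t ∈ Set.Ioo (-2 : ℝ) 2 := ⟨by linarith [ht.1], by linarith [ht.2]⟩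
  have hd := hasDerivAt_tsum_of_isPreconnected hu isOpen_Ioo isPreconnected_Ioo
    (g := fun m => picardTerm T y₀ (m + 1)) (g' := fun m t => T t (picardTerm T y₀ m t))
    (fun m t _ => (hder m t).2)
    (fun m t ht => (T t).le_of_opNorm_le_of_le (hK t (hmem t ht)) (hb' m t ht)) h0
    (by simp [hzero]) ht'
  refine (hd.const_add y₀).congr_deriv ?_
  rw [← (T t).map_tsum (hsum t ht'), (hsum t ht').tsum_eq_zero_add]
  rfl

end LinearODE

section Subgroup

variable {𝔸 : Type*} [NormedRing 𝔸] [NormedAlgebra ℂ 𝔸] [FiniteDimensional ℂ 𝔸] [CompleteSpace 𝔸]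

/-- A solution of `γ' = γ A` starting at `1` is invertible. -/
lemma isUnit_of_hasDerivAt_mul {A : ℝ → 𝔸} (hA : Continuous A) {γ : ℝ → 𝔸} (h0 : γ 0 = 1)
    (hγ : ∀ t ∈ Set.Icc (0 : ℝ) 1, HasDerivAt γ (γ t * A t) t) :
    ∀ t ∈ Set.Icc (0 : ℝ) 1, IsUnit (γ t) := by
  intro t ht
  obtain ⟨η, hη0, hη⟩ := exists_hasDerivAt_linear
    (T := fun t => ContinuousLinearMap.mul ℝ 𝔸 (-A t)) (by fun_prop) 1
  have hmul : ∀ s ∈ Set.Icc (0 : ℝ) 1, γ s * η s = 1 := by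
    intro s hs
    have := constant_of_has_deriv_right_zero (f := fun s => γ s * η s) (a := 0) (b := 1)
      (fun s hs => ((hγ s hs).mul (hη s hs)).continuousAt.continuousWithinAt)
      (fun s hs => by
        have hs' : s ∈ Set.Icc (0 : ℝ) 1 := ⟨hs.1, hs.2.le⟩
        refine (((hγ s hs').mul (hη s hs')).congr_deriv ?_).hasDerivWithinAt
        simp [mul_assoc]) s hs
    simpa [h0, hη0] using this
  have : IsNoetherian ℂ 𝔸 := inferInstance
  have : IsNoetherianRing 𝔸 := isNoetherian_of_tower ℂ this
  exact IsUnit.of_mul_eq_one _ (hmul t ht)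

/-- A solution of `γ' = γ A` starting at `1` stays in a closed subgroup if the values of `A` are
tangent to it: the distance to the subgroup satisfies a Grönwall inequality. -/
lemma exists_mem_of_hasDerivAt_mul {G : Subgroup 𝔸ˣ} (hG : IsClosed (G : Set 𝔸ˣ)) {A : ℝ → 𝔸}
    (hA : Continuous A) (hAG : ∀ t ∈ Set.Icc (0 : ℝ) 1, ∀ h : ℝ, ∃ g ∈ G, (g : 𝔸) = exp (h • A t))
    {γ : ℝ → 𝔸} (h0 : γ 0 = 1) (hγ : ∀ t ∈ Set.Icc (0 : ℝ) 1, HasDerivAt γ (γ t * A t) t) :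
    ∀ t ∈ Set.Icc (0 : ℝ) 1, ∃ g ∈ G, (g : 𝔸) = γ t := by
  obtain ⟨K, hK⟩ := (isCompact_Icc (a := (0 : ℝ)) (b := 1)).exists_bound_of_continuousOn
    hA.continuousOn
  set M : Set 𝔸 := Units.val '' (G : Set 𝔸ˣ) with hM
  have hMne : M.Nonempty := ⟨1, 1, G.one_mem, rfl⟩
  set D : ℝ → ℝ := fun t => Metric.infDist (γ t) M with hD
  have hDc : ContinuousOn D (Set.Icc 0 1) := fun t ht =>
    ((Metric.continuous_infDist_pt M).continuousAt.comp
      (hγ t ht).continuousAt).continuousWithinAt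
  have hslope : ∀ x ∈ Set.Ico (0 : ℝ) 1, ∀ r, K * D x < r →
      ∃ᶠ z in 𝓝[>] x, (z - x)⁻¹ * (D z - D x) < r := by
    intro x hx r hr
    have hx' : x ∈ Set.Icc (0 : ℝ) 1 := ⟨hx.1, hx.2.le⟩
    have hsub : HasDerivAt (fun z : ℝ => z - x) 1 x := (hasDerivAt_id x).sub_const x
    have he : HasDerivAt (fun z : ℝ => exp ((z - x) • A x)) (A x) x := by
      have h1 := hasDerivAt_exp_smul_const (𝕂 := ℝ) (A x) (x - x)
      exact (HasDerivAt.scomp (h := fun z : ℝ => z - x) x h1 hsub).congr_deriv (by simp)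
    have hF : HasDerivAt (fun z : ℝ => γ z - γ x * exp ((z - x) • A x)) 0 x := by
      exact ((hγ x hx').sub (he.const_mul (γ x))).congr_deriv (sub_self _)
    have hE : HasDerivAt (fun z : ℝ => exp ((z - x) • A x) - 1) (A x) x := he.sub_const 1
    have hmono : 𝓝[>] x ≤ 𝓝[≠] x := nhdsWithin_mono x fun z hz => ne_of_gt hz
    have t1 := (hF.tendsto_slope.mono_left hmono).norm
    have t2 := ((hE.tendsto_slope.mono_left hmono).norm).const_mul (D x)
    have t3 := t1.add t2
    have hlt : ‖(0 : 𝔸)‖ + D x * ‖A x‖ < r := by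
      rw [norm_zero, zero_add, mul_comm]
      exact (mul_le_mul_of_nonneg_right (hK x hx') Metric.infDist_nonneg).trans_lt hr
    refine Filter.Eventually.frequently ?_
    filter_upwards [t3.eventually_lt_const hlt, self_mem_nhdsWithin] with z hz hzx
    refine lt_of_le_of_lt ?_ hz
    have hpos : 0 < z - x := sub_pos.2 hzx
    have key : D z ≤ ‖γ z - γ x * exp ((z - x) • A x)‖ + D x * (1 + ‖exp ((z - x) • A x) - 1‖) := by
      rw [← sub_le_iff_le_add', ← div_le_iff₀ (by positivity)]
      refine (Metric.le_infDist hMne).2 ?_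
      rintro _ ⟨g, hg, rfl⟩
      rw [div_le_iff₀ (by positivity), sub_le_iff_le_add']
      obtain ⟨e, he, hee⟩ := hAG x hx' (z - x)
      have hmem : (g : 𝔸) * exp ((z - x) • A x) ∈ M := ⟨g * e, G.mul_mem hg he, by simp [hee]⟩
      refine (Metric.infDist_le_dist_of_mem hmem).trans ?_
      rw [dist_eq_norm, dist_eq_norm]
      calc ‖γ z - g * exp ((z - x) • A x)‖
          = ‖(γ z - γ x * exp ((z - x) • A x)) +
              ((γ x - g) + (γ x - g) * (exp ((z - x) • A x) - 1))‖ := by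
            congr 1; noncomm_ring
        _ ≤ _ := by
            refine (norm_add_le _ _).trans (add_le_add_right ?_ _)
            refine (norm_add_le _ _).trans ?_
            rw [mul_add, mul_one]
            exact add_le_add_right (norm_mul_le _ _) _
    simp only [slope, vsub_eq_sub, sub_self, zero_smul, NormedSpace.exp_zero, mul_one, sub_zero,
      norm_smul, norm_inv, Real.norm_eq_abs, abs_of_pos hpos]
    calc (z - x)⁻¹ * (D z - D x)
        ≤ (z - x)⁻¹ * (‖γ z - γ x * exp ((z - x) • A x)‖ + D x * ‖exp ((z - x) • A x) - 1‖) := by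
          gcongr
          linarith
      _ = _ := by ring
  intro t ht
  have hle := le_gronwallBound_of_liminf_deriv_right_le (f' := fun x => K * D x) (δ := 0)
    (K := K) (ε := 0) hDc hslope (by
      have h1 : (1 : 𝔸) ∈ M := ⟨1, G.one_mem, rfl⟩
      simp only [hD, h0]; exact (Metric.infDist_zero_of_mem h1).le)
    (fun x _ => by simp) t ht
  rw [gronwallBound_ε0_δ0] at hle
  have hcl : γ t ∈ closure M :=
    (Metric.mem_closure_iff_infDist_zero hMne).2 (le_antisymm hle Metric.infDist_nonneg)
  obtain ⟨w, hw⟩ := isUnit_of_hasDerivAt_mul hA h0 hγ t ht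
  refine ⟨w, ?_, hw⟩
  rw [← hw] at hcl
  have := Units.isOpenEmbedding_val.isInducing.closure_eq_preimage_closure_image (G : Set 𝔸ˣ)
  rw [hG.closure_eq] at this
  rw [← SetLike.mem_coe, this]
  exact hcl

end Subgroup

/-! ### Integration of flat forms -/

section Integration

variable {𝔸 : Type*} [NormedRing 𝔸] [NormedAlgebra ℂ 𝔸]
variable {E : Type*} [NormedAddCommGroup E] [NormedSpace ℝ E]

/-- Uniform first order expansion of `w ↦ θ (t (x + w)) (x + w)` for `t` in the unit interval. -/
lemma eventually_radial_expansion {F : Type*} [NormedAddCommGroup F] [NormedSpace ℝ F]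
    {θ : E → E →L[ℝ] F} {x : E}
    (hθ : ∀ t ∈ Set.Icc (0 : ℝ) 1, ContDiffAt ℝ 1 θ (t • x)) {ε : ℝ} (hε : 0 < ε) :
    ∀ᶠ w in 𝓝 (0 : E), ∀ t ∈ Set.Icc (0 : ℝ) 1,
      ‖θ (t • (x + w)) - θ (t • x)‖ ≤ ε ∧
      ‖θ (t • (x + w)) (x + w) - θ (t • x) x‖ ≤ ε ∧
      ‖θ (t • (x + w)) (x + w) - θ (t • x) x
        - (θ (t • x) w + t • fderiv ℝ θ (t • x) w x)‖ ≤ ε * ‖w‖ := by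
  refine isCompact_Icc.eventually_forall_of_forall_eventually fun t₀ ht₀ => ?_
  obtain ⟨e, he, he'⟩ : ∃ e > 0, e * (4 * ‖x‖ + 1) = ε :=
    ⟨ε / (4 * ‖x‖ + 1), by positivity, by field_simp⟩
  have hs := (hθ t₀ ht₀).hasStrictFDerivAt (by simp)
  have hc := hs.continuousAt
  have hc' : ContinuousAt (fderiv ℝ θ) (t₀ • x) := (hθ t₀ ht₀).continuousAt_fderiv (by simp)
  have l1 : Filter.Tendsto (fun z : E × ℝ => z.2 • (x + z.1)) (𝓝 (0, t₀)) (𝓝 (t₀ • x)) := by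
    have : Continuous fun z : E × ℝ => z.2 • (x + z.1) := by fun_prop
    simpa using this.tendsto (0, t₀)
  have l2 : Filter.Tendsto (fun z : E × ℝ => z.2 • x) (𝓝 (0, t₀)) (𝓝 (t₀ • x)) := by
    have : Continuous fun z : E × ℝ => z.2 • x := by fun_prop
    simpa using this.tendsto (0, t₀)
  have l3 : Filter.Tendsto (fun z : E × ℝ => z.2) (𝓝 (0, t₀)) (𝓝 t₀) :=
    continuous_snd.tendsto (0, t₀)
  have l4 : Filter.Tendsto (fun z : E × ℝ => x + z.1) (𝓝 (0, t₀)) (𝓝 x) := by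
    have : Continuous fun z : E × ℝ => x + z.1 := by fun_prop
    simpa using this.tendsto (0, t₀)
  have e1 := (hs.isLittleO.comp_tendsto (l1.prodMk_nhds l2)).def he
  have d2 : Filter.Tendsto (fun z : E × ℝ => ‖θ (z.2 • (x + z.1)) - θ (z.2 • x)‖) (𝓝 (0, t₀))
      (𝓝 0) := by
    simpa using ((hc.tendsto.comp l1).sub (hc.tendsto.comp l2)).norm
  have d3 : Filter.Tendsto (fun z : E × ℝ => ‖θ (z.2 • (x + z.1)) (x + z.1) - θ (z.2 • x) x‖)
      (𝓝 (0, t₀)) (𝓝 0) := by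
    have hb := isBoundedBilinearMap_apply (𝕜 := ℝ) (E := E) (F := F)
    have m1 : Filter.Tendsto (fun z : E × ℝ => θ (z.2 • (x + z.1)) (x + z.1)) (𝓝 (0, t₀))
      (𝓝 (θ (t₀ • x) x)) :=
      (hb.continuous.tendsto (θ (t₀ • x), x)).comp ((hc.tendsto.comp l1).prodMk_nhds l4)
    have m2 : Filter.Tendsto (fun z : E × ℝ => θ (z.2 • x) x) (𝓝 (0, t₀))
      (𝓝 (θ (t₀ • x) x)) :=
      (hb.continuous.tendsto (θ (t₀ • x), x)).comp
        ((hc.tendsto.comp l2).prodMk_nhds tendsto_const_nhds)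
    simpa using (m1.sub m2).norm
  have d4 : Filter.Tendsto (fun z : E × ℝ => ‖fderiv ℝ θ (z.2 • x) - fderiv ℝ θ (t₀ • x)‖)
      (𝓝 (0, t₀)) (𝓝 0) := by
    have m2 : Filter.Tendsto (fun z : E × ℝ => fderiv ℝ θ (z.2 • x)) (𝓝 (0, t₀))
      (𝓝 (fderiv ℝ θ (t₀ • x))) := hc'.tendsto.comp l2
    exact (tendsto_iff_norm_sub_tendsto_zero (E := E →L[ℝ] E →L[ℝ] F)).1 m2
  have hee : e ≤ ε := by
    rw [← he']; exact le_mul_of_one_le_right he.le (by linarith [norm_nonneg x])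
  have d5 : ∀ᶠ z : E × ℝ in 𝓝 (0, t₀), |z.2| < 2 :=
    l3.abs.eventually_lt_const (by rw [abs_of_nonneg ht₀.1]; linarith [ht₀.2])
  filter_upwards [e1, d2.eventually_le_const he, d3.eventually_le_const hε,
    d4.eventually_le_const he, d5] with z h1 h2 h3 h4 h5
  obtain ⟨w, t⟩ := z
  simp only [Function.comp_apply] at h1 h2 h3 h4 h5 ⊢
  refine ⟨h2.trans hee, h3, ?_⟩
  have hsub : t • (x + w) - t • x = t • w := by rw [smul_add]; abel
  rw [hsub] at h1
  set P := θ (t • (x + w)) with hP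
  set Q := θ (t • x) with hQ
  set D := fderiv ℝ θ (t • x) with hD
  set D₀ := fderiv ℝ θ (t₀ • x) with hD₀
  have heq : P (x + w) - Q x - (Q w + t • D w x)
      = (P - Q - D₀ (t • w)) x - (D - D₀) (t • w) x + (P - Q) w := by
    simp only [map_add, map_smul, sub_apply, smul_apply,
      smul_sub]
    abel
  have htw : ‖t • w‖ ≤ 2 * ‖w‖ := by
    rw [norm_smul]; exact mul_le_mul_of_nonneg_right h5.le (norm_nonneg _)
  have b1 : ‖(P - Q - D₀ (t • w)) x‖ ≤ e * (2 * ‖w‖) * ‖x‖ :=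
    (ContinuousLinearMap.le_opNorm _ _).trans (by gcongr; exact h1.trans (by gcongr))
  have b2 : ‖(D - D₀) (t • w) x‖ ≤ e * (2 * ‖w‖) * ‖x‖ :=
    (ContinuousLinearMap.le_opNorm _ _).trans (by
      gcongr; exact (ContinuousLinearMap.le_opNorm _ _).trans (by gcongr))
  have b3 : ‖(P - Q) w‖ ≤ e * ‖w‖ :=
    (ContinuousLinearMap.le_opNorm _ _).trans (by gcongr)
  calc ‖P (x + w) - Q x - (Q w + t • D w x)‖ ≤ e * (2 * ‖w‖) * ‖x‖ + e * (2 * ‖w‖) * ‖x‖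
        + e * ‖w‖ := by rw [heq]; exact norm_add_le_of_le (norm_sub_le_of_le b1 b2) b3
    _ = e * (4 * ‖x‖ + 1) * ‖w‖ := by ring
    _ = ε * ‖w‖ := by rw [he']

/-- The radial part `θ (t x) x` of a form, with `t` clamped to the unit interval. -/
noncomputable def radialForm (θ : E → E →L[ℝ] 𝔸) (x : E) (t : ℝ) : 𝔸 :=
  θ ((Set.projIcc (0 : ℝ) 1 zero_le_one t : ℝ) • x) x

lemma radialForm_of_mem (θ : E → E →L[ℝ] 𝔸) (x : E) {t : ℝ} (ht : t ∈ Set.Icc (0 : ℝ) 1) :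
    radialForm θ x t = θ (t • x) x := by
  rw [radialForm, Set.projIcc_of_mem _ ht]

lemma smul_mem_ball_of_mem_Icc {x : E} {r : ℝ} (hx : x ∈ Metric.ball (0 : E) r) {t : ℝ}
    (ht : t ∈ Set.Icc (0 : ℝ) 1) : t • x ∈ Metric.ball (0 : E) r := by
  rw [mem_ball_zero_iff, norm_smul, Real.norm_eq_abs, abs_of_nonneg ht.1] at *
  exact (mul_le_of_le_one_left (norm_nonneg _) ht.2).trans_lt hx

lemma continuous_radialForm {θ : E → E →L[ℝ] 𝔸} {r : ℝ}
    (hθ : ContinuousOn θ (Metric.ball 0 r)) {x : E} (hx : x ∈ Metric.ball (0 : E) r) :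
    Continuous (radialForm θ x) := by
  have h1 : Continuous fun t : ℝ => (Set.projIcc (0 : ℝ) 1 zero_le_one t : ℝ) • x := by fun_prop
  have h2 : Continuous fun t : ℝ => θ ((Set.projIcc (0 : ℝ) 1 zero_le_one t : ℝ) • x) :=
    hθ.comp_continuous h1 fun t => smul_mem_ball_of_mem_Icc hx (Set.projIcc _ _ _ t).2
  exact h2.clm_apply continuous_const

/-- The radial solutions of `γ' = γ θ(t x) x` of a flat form `θ` assemble, at time `1`, to a map
with logarithmic derivative `θ`: flatness makes `γ_x(t) (1 + t θ(t x) w)` a solution of the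
equation of `γ_{x + w}` up to an error `o(w)`. -/
lemma hasFDerivAt_of_radial {θ : E → E →L[ℝ] 𝔸} {r : ℝ}
    (hθ : ContDiffOn ℝ ∞ θ (Metric.ball 0 r))
    (hflat : ∀ x ∈ Metric.ball (0 : E) r, ∀ u w,
      fderiv ℝ θ x u w - fderiv ℝ θ x w u = θ x w * θ x u - θ x u * θ x w)
    {γ : E → ℝ → 𝔸} (h0 : ∀ x ∈ Metric.ball (0 : E) r, γ x 0 = 1)
    (hγ : ∀ x ∈ Metric.ball (0 : E) r, ∀ t ∈ Set.Icc (0 : ℝ) 1,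
      HasDerivAt (γ x) (γ x t * radialForm θ x t) t) {x : E} (hx : x ∈ Metric.ball (0 : E) r) :
    HasFDerivAt (fun y => γ y 1) ((ContinuousLinearMap.mul ℝ 𝔸 (γ x 1)).comp (θ x)) x := by
  have hcd : ∀ t ∈ Set.Icc (0 : ℝ) 1, ContDiffAt ℝ 1 θ (t • x) := fun t ht =>
    ((hθ _ (smul_mem_ball_of_mem_Icc hx ht)).contDiffAt
      (Metric.isOpen_ball.mem_nhds (smul_mem_ball_of_mem_Icc hx ht))).of_le (by simp)
  have hγc : ContinuousOn (γ x) (Set.Icc 0 1) := fun t ht =>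
    (hγ x hx t ht).continuousAt.continuousWithinAt
  obtain ⟨C, hC⟩ := isCompact_Icc.exists_bound_of_continuousOn hγc
  have hC0 : 0 ≤ C := (norm_nonneg _).trans (hC 0 (by simp))
  have hθc : ContinuousOn (fun t : ℝ => θ (t • x)) (Set.Icc 0 1) := fun t ht => by
    have h1 : ContinuousAt θ (t • x) := (hcd t ht).continuousAt
    have h2 : ContinuousAt (fun t : ℝ => t • x) t := by fun_prop
    exact (ContinuousAt.comp (f := fun t : ℝ => t • x) h1 h2).continuousWithinAt
  obtain ⟨K₀, hK₀⟩ := isCompact_Icc.exists_bound_of_continuousOn hθc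
  have hK₀0 : 0 ≤ K₀ := (norm_nonneg _).trans (hK₀ 0 (by simp))
  obtain ⟨K, hK⟩ : ∃ K : NNReal, (K : ℝ) = (K₀ + 1) * (‖x‖ + 1) :=
    ⟨⟨(K₀ + 1) * (‖x‖ + 1), by positivity⟩, rfl⟩
  have hKpos : (0 : ℝ) < K := by rw [hK]; positivity
  rw [hasFDerivAt_iff_isLittleO_nhds_zero, Asymptotics.isLittleO_iff]
  intro c hc
  set Λ : ℝ := C * (1 + K₀) * ((Real.exp K - 1) / K) with hΛ
  have hexp : 0 ≤ Real.exp K - 1 := by linarith [Real.add_one_le_exp (K : ℝ)]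
  have hΛ0 : 0 ≤ Λ := by positivity
  set ε : ℝ := c / (Λ + 1) with hε
  have hεpos : 0 < ε := by positivity
  have hball : ∀ᶠ w in 𝓝 (0 : E), x + w ∈ Metric.ball (0 : E) r := by
    have : Filter.Tendsto (fun w : E => x + w) (𝓝 0) (𝓝 x) := by
      have hc : Continuous fun w : E => x + w := by fun_prop
      simpa using hc.tendsto 0
    exact this.eventually (Metric.isOpen_ball.mem_nhds hx)
  have hw1 : ∀ᶠ w in 𝓝 (0 : E), ‖w‖ < 1 := by
    have := (continuous_norm (E := E)).tendsto 0
    rw [norm_zero] at this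
    exact this.eventually_lt_const one_pos
  filter_upwards [hball, hw1, eventually_radial_expansion hcd hεpos,
    eventually_radial_expansion hcd one_pos] with w hwb hw1 hexpn hexp1
  -- the approximate solution for `x + w`
  set β : ℝ → 𝔸 := fun t => γ x t * (1 + t • θ (t • x) w) with hβ
  have hβd : ∀ t ∈ Set.Icc (0 : ℝ) 1, HasDerivAt β (γ x t * (θ (t • x) x * (1 + t • θ (t • x) w)
      + (θ (t • x) w + t • fderiv ℝ θ (t • x) x w))) t := by
    intro t ht
    have h1 : HasDerivAt (fun t : ℝ => t • x) x t := by
      simpa using (hasDerivAt_id t).smul_const x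
    have h2 : HasDerivAt (fun t : ℝ => θ (t • x)) (fderiv ℝ θ (t • x) x) t :=
      ((hcd t ht).differentiableAt (by simp)).hasFDerivAt.comp_hasDerivAt t h1
    have h3 : HasDerivAt (fun t : ℝ => θ (t • x) w) (fderiv ℝ θ (t • x) x w) t := by
      refine (h2.clm_apply (hasDerivAt_const t w)).congr_deriv ?_
      simp
    have h4 : HasDerivAt (fun t : ℝ => 1 + t • θ (t • x) w)
        (t • fderiv ℝ θ (t • x) x w + (1 : ℝ) • θ (t • x) w) t :=
      ((hasDerivAt_id t).smul h3).const_add (1 : 𝔸)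
    refine ((hγ x hx t ht).mul h4).congr_deriv ?_
    rw [radialForm_of_mem θ x ht]
    rw [one_smul]
    noncomm_ring
  have hbd : ∀ t ∈ Set.Ico (0 : ℝ) 1,
      dist (γ x t * (θ (t • x) x * (1 + t • θ (t • x) w)
        + (θ (t • x) w + t • fderiv ℝ θ (t • x) x w))) (β t * radialForm θ (x + w) t)
        ≤ C * (1 + K₀) * (ε * ‖w‖) := by
    intro t ht
    have ht' : t ∈ Set.Icc (0 : ℝ) 1 := ⟨ht.1, ht.2.le⟩
    obtain ⟨-, e2, e3⟩ := hexpn t ht'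
    rw [radialForm_of_mem θ _ ht', dist_eq_norm]
    have hfl := hflat _ (smul_mem_ball_of_mem_Icc hx ht') x w
    rw [sub_eq_iff_eq_add] at hfl
    rw [hfl]
    set Ay := θ (t • (x + w)) (x + w)
    set P := θ (t • x) x
    set Q := θ (t • x) w
    set R := fderiv ℝ θ (t • x) w x
    have heq : γ x t * (P * (1 + t • Q) + (Q + t • (Q * P - P * Q + R))) - β t * Ay
        = -(γ x t * ((Ay - P - (Q + t • R)) + t • (Q * (Ay - P)))) := by
      simp only [hβ, smul_add, smul_sub, mul_add, add_mul, mul_sub, mul_one,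
        smul_mul_assoc, mul_smul_comm, mul_assoc]
      abel
    rw [heq, norm_neg]
    have hQ : ‖Q‖ ≤ K₀ * ‖w‖ := (θ (t • x)).le_of_opNorm_le (hK₀ t ht') w
    have h6 : ‖t • (Q * (Ay - P))‖ ≤ K₀ * ‖w‖ * ε := by
      rw [norm_smul, Real.norm_eq_abs, abs_of_nonneg ht.1]
      refine (mul_le_of_le_one_left (norm_nonneg _) ht.2.le).trans ((norm_mul_le _ _).trans ?_)
      gcongr
    calc _ ≤ C * (ε * ‖w‖ + K₀ * ‖w‖ * ε) := by
          refine (norm_mul_le _ _).trans ?_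
          gcongr
          · exact hC t ht'
          · exact norm_add_le_of_le e3 h6
      _ = _ := by ring
  have hLip : ∀ t, LipschitzWith K fun g : 𝔸 => g * radialForm θ (x + w) t := by
    intro t
    refine LipschitzWith.of_dist_le_mul fun g g' => ?_
    rw [dist_eq_norm, dist_eq_norm, ← sub_mul, mul_comm (K : ℝ)]
    refine (norm_mul_le _ _).trans ?_
    gcongr
    obtain ⟨e1, -, -⟩ := hexp1 _ (Set.projIcc (0 : ℝ) 1 zero_le_one t).2
    rw [hK]
    refine (ContinuousLinearMap.le_opNorm _ _).trans ?_
    gcongr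
    · have := norm_le_norm_add_norm_sub' (θ ((Set.projIcc (0 : ℝ) 1 zero_le_one t : ℝ) • (x + w)))
        (θ ((Set.projIcc (0 : ℝ) 1 zero_le_one t : ℝ) • x))
      exact this.trans (add_le_add (hK₀ _ (Set.projIcc (0 : ℝ) 1 zero_le_one t).2) e1)
    · exact norm_add_le_of_le le_rfl hw1.le
  have h01 : (1 : ℝ) ∈ Set.Icc (0 : ℝ) 1 := by simp
  have hfin := dist_le_of_approx_trajectories_ODE (δ := 0) (εg := 0) (a := 0) (b := 1) hLip
    (fun t ht => (hβd t ht).continuousAt.continuousWithinAt)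
    (fun t ht => (hβd t ⟨ht.1, ht.2.le⟩).hasDerivWithinAt) hbd
    (fun t ht => (hγ _ hwb t ht).continuousAt.continuousWithinAt)
    (fun t ht => (hγ _ hwb t ⟨ht.1, ht.2.le⟩).hasDerivWithinAt)
    (fun t ht => by simp)
    (by simp [hβ, h0 x hx, h0 _ hwb]) 1 h01
  rw [dist_comm, dist_eq_norm, gronwallBound_of_K_ne_0 hKpos.ne'] at hfin
  have hlhs : γ (x + w) 1 - γ x 1 - ((ContinuousLinearMap.mul ℝ 𝔸 (γ x 1)).comp (θ x)) w
      = γ (x + w) 1 - β 1 := by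
    simp [hβ, mul_add, sub_sub]
  rw [hlhs]
  refine hfin.trans ?_
  calc _ = Λ * ε * ‖w‖ := by simp only [hΛ, add_zero, sub_zero, mul_one, zero_mul, zero_add]; ring
    _ ≤ c * ‖w‖ := by
      gcongr
      rw [hε, mul_div_assoc', div_le_iff₀ (by positivity)]
      nlinarith

/-- A map with smooth logarithmic derivative is smooth. -/
lemma contDiffOn_of_hasFDerivAt_mul {s : Set E} (hs : IsOpen s) {θ : E → E →L[ℝ] 𝔸}
    (hθ : ContDiffOn ℝ ∞ θ s) {F : E → 𝔸}
    (hF : ∀ x ∈ s, HasFDerivAt F ((ContinuousLinearMap.mul ℝ 𝔸 (F x)).comp (θ x)) x) :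
    ContDiffOn ℝ ∞ F s := by
  rw [contDiffOn_infty]
  intro m
  induction m with
  | zero =>
    exact contDiffOn_zero.2 fun x hx => (hF x hx).continuousAt.continuousWithinAt
  | succ m ih =>
    refine (contDiffOn_succ_iff_fderiv_of_isOpen (n := m) hs).2
      ⟨fun x hx => (hF x hx).differentiableAt.differentiableWithinAt, by simp, ?_⟩
    have h1 : ContDiffOn ℝ m (fun x => (ContinuousLinearMap.mul ℝ 𝔸 (F x)).comp (θ x)) s :=
      ((ContinuousLinearMap.mul ℝ 𝔸).contDiff.comp_contDiffOn ih).clm_comp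
        (hθ.of_le (by exact_mod_cast le_top))
    exact h1.congr fun x hx => (hF x hx).fderiv

/-- **Integration of flat forms**: on a ball, a smooth `1`-form `θ` with `dθ + θ ∧ θ = 0` whose
values are tangent to the closed subgroup `G` is the logarithmic derivative of a map into `G`. -/
theorem exists_integral_of_flat [FiniteDimensional ℂ 𝔸] [CompleteSpace 𝔸] {G : Subgroup 𝔸ˣ}
    (hG : IsClosed (G : Set 𝔸ˣ)) {θ : E → E →L[ℝ] 𝔸} {r : ℝ}
    (hr : 0 < r)
    (hθ : ContDiffOn ℝ ∞ θ (Metric.ball 0 r))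
    (hθG : ∀ x ∈ Metric.ball (0 : E) r, ∀ w, ∀ h : ℝ, ∃ g ∈ G, (g : 𝔸) = exp (h • θ x w))
    (hflat : ∀ x ∈ Metric.ball (0 : E) r, ∀ u w,
      fderiv ℝ θ x u w - fderiv ℝ θ x w u = θ x w * θ x u - θ x u * θ x w) :
    ∃ F : E → 𝔸, F 0 = 1 ∧ ContDiffOn ℝ ∞ F (Metric.ball 0 r) ∧
      ∀ x ∈ Metric.ball (0 : E) r, (∃ g ∈ G, (g : 𝔸) = F x) ∧
        HasFDerivAt F ((ContinuousLinearMap.mul ℝ 𝔸 (F x)).comp (θ x)) x := by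
  have hrad : ∀ x, x ∈ Metric.ball (0 : E) r → Continuous (radialForm θ x) := fun x hx =>
    continuous_radialForm hθ.continuousOn hx
  have hex : ∀ x, ∃ γ : ℝ → 𝔸, γ 0 = 1 ∧ (x ∈ Metric.ball (0 : E) r →
      ∀ t ∈ Set.Icc (0 : ℝ) 1, HasDerivAt γ (γ t * radialForm θ x t) t) := by
    intro x
    by_cases hx : x ∈ Metric.ball (0 : E) r
    · obtain ⟨γ, h0, hγ⟩ := exists_hasDerivAt_linear
        (T := fun t => (ContinuousLinearMap.mul ℝ 𝔸).flip (radialForm θ x t))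
        ((ContinuousLinearMap.continuous _).comp (hrad x hx)) 1
      exact ⟨γ, h0, fun _ => hγ⟩
    · exact ⟨fun _ => 1, rfl, fun h => absurd h hx⟩
  choose γ h0 hγ using hex
  have hF : ∀ x ∈ Metric.ball (0 : E) r, HasFDerivAt (fun y => γ y 1)
      ((ContinuousLinearMap.mul ℝ 𝔸 (γ x 1)).comp (θ x)) x := fun x hx =>
    hasFDerivAt_of_radial hθ hflat (fun x _ => h0 x) hγ hx
  refine ⟨fun x => γ x 1, ?_, contDiffOn_of_hasFDerivAt_mul Metric.isOpen_ball hθ hF,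
    fun x hx => ⟨?_, hF x hx⟩⟩
  · have hr0 : (0 : E) ∈ Metric.ball (0 : E) r := Metric.mem_ball_self hr
    have := constant_of_has_deriv_right_zero (f := γ 0) (a := 0) (b := 1)
      (fun s hs => (hγ 0 hr0 s hs).continuousAt.continuousWithinAt)
      (fun s hs => by
        refine ((hγ 0 hr0 s ⟨hs.1, hs.2.le⟩).congr_deriv ?_).hasDerivWithinAt
        simp [radialForm]) 1 (by simp)
    exact this.trans (h0 0)
  · refine exists_mem_of_hasDerivAt_mul hG (hrad x hx) (fun t ht h => ?_) (h0 x) (hγ x hx) 1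
      (by simp)
    rw [radialForm_of_mem θ x ht]
    exact hθG _ (smul_mem_ball_of_mem_Icc hx ht) _ _

end Integration

/-! ### The group `G`, its adjoint action, and the closed subgroup theorem -/

namespace SymmetricPair

variable {𝔸 : Type*} [NormedRing 𝔸] [NormedAlgebra ℂ 𝔸] (S : SymmetricPair 𝔸)

@[simp] lemma val_mul (g h : S.G) : S.val (g * h) = S.val g * S.val h := rfl

@[simp] lemma val_one : S.val 1 = 1 := rfl

@[simp] lemma val_inv_mul_val (g : S.G) : S.val g⁻¹ * S.val g = 1 := by
  rw [← val_mul, inv_mul_cancel, val_one]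

@[simp] lemma val_mul_val_inv (g : S.G) : S.val g * S.val g⁻¹ = 1 := by
  rw [← val_mul, mul_inv_cancel, val_one]

@[simp] lemma val_inv_mul_cancel_left (g : S.G) (X : 𝔸) : S.val g⁻¹ * (S.val g * X) = X := by
  rw [← mul_assoc, val_inv_mul_val, one_mul]

@[simp] lemma val_mul_inv_cancel_left (g : S.G) (X : 𝔸) : S.val g * (S.val g⁻¹ * X) = X := by
  rw [← mul_assoc, val_mul_val_inv, one_mul]

lemma val_injective : Function.Injective S.val := fun _ _ h => Subtype.ext (Units.ext h)

lemma val_inv_eq_inverse (g : S.G) : S.val g⁻¹ = Ring.inverse (S.val g) :=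
  (Ring.inverse_unit (g : 𝔸ˣ)).symm

lemma isUnit_val (g : S.G) : IsUnit (S.val g) := (g : 𝔸ˣ).isUnit

lemma val_inv_eq_of_mul_eq_one {g : S.G} {a : 𝔸} (h : S.val g * a = 1) : S.val g⁻¹ = a := by
  rw [← mul_one (S.val g⁻¹), ← h, val_inv_mul_cancel_left]

lemma mem_𝔤_iff (X : 𝔸) : X ∈ S.𝔤 ↔ ∀ t : ℝ, ∃ g : S.G, S.val g = exp (t • X) := by
  rw [S.mem_𝔤]
  exact forall_congr' fun t => ⟨fun ⟨g, hg, h⟩ => ⟨⟨g, hg⟩, h⟩, fun ⟨g, h⟩ => ⟨g, g.2, h⟩⟩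

lemma exists_val_eq_exp {X : 𝔸} (hX : X ∈ S.𝔤) : ∃ g : S.G, S.val g = exp X := by
  simpa using (S.mem_𝔤_iff X).1 hX 1

lemma smul_mem_𝔤 {X : 𝔸} (hX : X ∈ S.𝔤) (t : ℝ) : t • X ∈ S.𝔤 := by
  rw [← Complex.coe_smul]
  exact S.𝔤.smul_mem _ hX

/-- `𝔤` as a real subspace of `𝔸`. -/
def 𝔤ℝ : Submodule ℝ 𝔸 where
  carrier := S.𝔤
  add_mem' := S.𝔤.add_mem
  zero_mem' := S.𝔤.zero_mem
  smul_mem' t _ hX := S.smul_mem_𝔤 hX t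

lemma lie_mem_𝔤 {X Y : 𝔸} (hX : X ∈ S.𝔤) (hY : Y ∈ S.𝔤) : ⁅X, Y⁆ ∈ S.𝔤 := S.𝔤.lie_mem hX hY

/-- `Ad(g)` as a continuous real linear map of `𝔸`. -/
noncomputable def AdL (g : S.G) : 𝔸 →L[ℝ] 𝔸 :=
  (ContinuousLinearMap.mul ℝ 𝔸 (S.val g)).comp ((ContinuousLinearMap.mul ℝ 𝔸).flip (S.val g⁻¹))

lemma AdL_apply (g : S.G) (X : 𝔸) : S.AdL g X = S.val g * X * S.val g⁻¹ := by
  simp [AdL, mul_assoc]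

lemma Ad_eq (g : S.G) (X : 𝔸) : S.Ad g X = S.AdL g X := (S.AdL_apply g X).symm

lemma AdL_mul_apply (g h : S.G) (X : 𝔸) : S.AdL (g * h) X = S.AdL g (S.AdL h X) := by
  simp [AdL_apply, mul_assoc]

@[simp] lemma AdL_one (X : 𝔸) : S.AdL 1 X = X := by simp [AdL_apply]

@[simp] lemma AdL_inv_apply_AdL (g : S.G) (X : 𝔸) : S.AdL g⁻¹ (S.AdL g X) = X := by
  rw [← AdL_mul_apply, inv_mul_cancel, AdL_one]

@[simp] lemma AdL_apply_AdL_inv (g : S.G) (X : 𝔸) : S.AdL g (S.AdL g⁻¹ X) = X := by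
  rw [← AdL_mul_apply, mul_inv_cancel, AdL_one]

lemma AdL_lie (g : S.G) (X Y : 𝔸) : S.AdL g ⁅X, Y⁆ = ⁅S.AdL g X, S.AdL g Y⁆ := by
  simp only [AdL_apply, Ring.lie_def, mul_sub, sub_mul]
  simp [mul_assoc]

section Complete

variable [CompleteSpace 𝔸]

lemma val_inv_eq_exp_neg {g : S.G} {X : 𝔸} (h : S.val g = exp X) : S.val g⁻¹ = exp (-X) :=
  S.val_inv_eq_of_mul_eq_one (by rw [h, exp_mul_exp_neg])

lemma AdL_mem_𝔤 (g : S.G) {X : 𝔸} (hX : X ∈ S.𝔤) : S.AdL g X ∈ S.𝔤 := by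
  let _ : NormedAlgebra ℚ 𝔸 := NormedAlgebra.restrictScalars ℚ ℝ 𝔸
  rw [mem_𝔤_iff] at *
  intro t
  obtain ⟨h, hh⟩ := hX t
  refine ⟨g * h * g⁻¹, ?_⟩
  rw [val_mul, val_mul, hh, ← map_smul, AdL_apply]
  exact (NormedSpace.exp_units_conj (g : 𝔸ˣ) (t • X)).symm

/-- A limit of elements of `G` that is invertible belongs to `G`. -/
lemma exists_val_eq_of_tendsto {g : ℕ → S.G} {a : 𝔸} (ha : IsUnit a)
    (h : Filter.Tendsto (fun m => S.val (g m)) Filter.atTop (𝓝 a)) : ∃ g : S.G, S.val g = a := by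
  obtain ⟨w, rfl⟩ := ha
  have : Filter.Tendsto (fun m => ((g m : S.G) : 𝔸ˣ)) Filter.atTop (𝓝 w) :=
    (Units.isOpenEmbedding_val.isInducing.tendsto_nhds_iff).2 h
  exact ⟨⟨w, S.isClosed_G.mem_of_tendsto this (Filter.Eventually.of_forall fun m => (g m).2)⟩, rfl⟩

lemma val_zpow_eq_exp {g : S.G} {Y : 𝔸} (h : S.val g = exp Y) (m : ℤ) :
    S.val (g ^ m) = exp ((m : ℝ) • Y) := by
  let _ : NormedAlgebra ℚ 𝔸 := NormedAlgebra.restrictScalars ℚ ℝ 𝔸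
  have hn : ∀ k : ℕ, S.val (g ^ k) = exp ((k : ℝ) • Y) := by
    intro k
    rw [Nat.cast_smul_eq_nsmul, NormedSpace.exp_nsmul, ← h]
    rfl
  obtain ⟨k, rfl | rfl⟩ := m.eq_nat_or_neg
  · simpa using hn k
  · rw [zpow_neg, zpow_natCast, S.val_inv_eq_exp_neg (hn k)]
    simp

/-- Elements of `G` close to `1` are not exponentials of small nonzero elements of a complement of
`𝔤` (the kernel of `p`): otherwise a limit direction would be tangent to `G`. -/
lemma eventually_eq_zero_of_exp_mem [FiniteDimensional ℂ 𝔸] {p : 𝔸 →L[ℝ] 𝔸}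
    (hp : ∀ X ∈ S.𝔤, p X = X) :
    ∀ᶠ Y in 𝓝 (0 : 𝔸), p Y = 0 → (∃ g : S.G, S.val g = exp Y) → Y = 0 := by
  have : ProperSpace 𝔸 := FiniteDimensional.proper ℂ 𝔸
  by_contra hcon
  obtain ⟨Y, hY0, hY⟩ := Filter.exists_seq_forall_of_frequently (Filter.not_eventually.1 hcon)
  push Not at hY
  choose hpY hg hYne using hY
  choose g hg using hg
  have hpos : ∀ k, 0 < ‖Y k‖ := fun k => norm_pos_iff.2 (hYne k)
  have hsph : ∀ k, (‖Y k‖⁻¹ • Y k) ∈ Metric.sphere (0 : 𝔸) 1 := fun k => by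
    rw [mem_sphere_zero_iff_norm, norm_smul, norm_inv, norm_norm, inv_mul_cancel₀ (hpos k).ne']
  obtain ⟨u, hu, φ, hφ, hlim⟩ := (isCompact_sphere (0 : 𝔸) 1).tendsto_subseq hsph
  have hYφ : Filter.Tendsto (fun k => Y (φ k)) Filter.atTop (𝓝 0) := hY0.comp hφ.tendsto_atTop
  have hu𝔤 : u ∈ S.𝔤 := by
    rw [mem_𝔤_iff]
    intro t
    let m : ℕ → ℤ := fun k => ⌊t / ‖Y (φ k)‖⌋
    have hm : Filter.Tendsto (fun k => (m k : ℝ) * ‖Y (φ k)‖) Filter.atTop (𝓝 t) := by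
      rw [tendsto_iff_norm_sub_tendsto_zero]
      refine squeeze_zero (fun _ => norm_nonneg _) (fun k => ?_)
        (by simpa using hYφ.norm)
      have h1 := Int.floor_le (t / ‖Y (φ k)‖)
      have h2 := Int.lt_floor_add_one (t / ‖Y (φ k)‖)
      rw [le_div_iff₀ (hpos _)] at h1
      rw [div_lt_iff₀ (hpos _)] at h2
      rw [Real.norm_eq_abs, abs_le]
      constructor <;> simp only [m] <;> linarith
    have h2 : Filter.Tendsto (fun k => exp ((m k : ℝ) • Y (φ k))) Filter.atTop
        (𝓝 (exp (t • u))) := by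
      have h3 := ((contDiff_exp (𝔸 := 𝔸)).continuous.tendsto (t • u)).comp (hm.smul hlim)
      refine h3.congr fun k => ?_
      simp only [Function.comp_apply, smul_smul]
      rw [mul_assoc, mul_inv_cancel₀ (hpos _).ne', mul_one]
    refine S.exists_val_eq_of_tendsto (g := fun k => g (φ k) ^ m k) ?_ ?_
    · exact ⟨⟨_, _, exp_mul_exp_neg _, exp_neg_mul_exp _⟩, rfl⟩
    · exact h2.congr fun k => (S.val_zpow_eq_exp (hg (φ k)) (m k)).symm
  have hpu : p u = 0 := by
    have h1 := (p.continuous.tendsto u).comp hlim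
    refine tendsto_nhds_unique h1 (tendsto_const_nhds.congr fun k => ?_)
    simp [hpY]
  rw [hp u hu𝔤] at hpu
  simp [hpu] at hu

/-- **Closed subgroup theorem**: near the identity, `G` lies in the image of `𝔤` under the
exponential map. -/
lemma eventually_expLog_mem [FiniteDimensional ℂ 𝔸] :
    ∀ᶠ a in 𝓝 (1 : 𝔸), ∀ g : S.G, S.val g = a → expLog 𝔸 a ∈ S.𝔤 := by
  obtain ⟨π, hπ⟩ := LinearMap.exists_leftInverse_of_injective S.𝔤ℝ.subtype
    (LinearMap.ker_eq_bot.2 S.𝔤ℝ.subtype_injective)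
  let p : 𝔸 →L[ℝ] 𝔸 := LinearMap.toContinuousLinearMap (S.𝔤ℝ.subtype ∘ₗ π)
  have hp𝔤 : ∀ X, p X ∈ S.𝔤 := fun X => (π X).2
  have hp : ∀ X ∈ S.𝔤, p X = X := fun X hX =>
    congrArg Subtype.val (LinearMap.congr_fun hπ ⟨X, hX⟩)
  let Φ : 𝔸 → 𝔸 := fun X => exp (p X) * exp (X - p X)
  have hexp0 : HasStrictFDerivAt (exp : 𝔸 → 𝔸) (1 : 𝔸 →L[ℝ] 𝔸) 0 :=
    hasStrictFDerivAt_exp_zero (𝕂 := ℝ)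
  have hΦ : HasStrictFDerivAt Φ (ContinuousLinearEquiv.refl ℝ 𝔸 : 𝔸 →L[ℝ] 𝔸) 0 := by
    have h1 : HasStrictFDerivAt (fun X => exp (p X)) ((1 : 𝔸 →L[ℝ] 𝔸).comp p) 0 := by
      refine HasStrictFDerivAt.comp (0 : 𝔸) ?_ p.hasStrictFDerivAt
      simpa using hexp0
    have h2 : HasStrictFDerivAt (fun X => exp (X - p X))
        ((1 : 𝔸 →L[ℝ] 𝔸).comp (ContinuousLinearMap.id ℝ 𝔸 - p)) 0 := by
      refine HasStrictFDerivAt.comp (0 : 𝔸) (g := exp) ?_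
        (ContinuousLinearMap.id ℝ 𝔸 - p).hasStrictFDerivAt
      simpa using hexp0
    refine (h1.mul' h2).congr_fderiv ?_
    ext X
    simp
  have hΦ0 : Φ 0 = 1 := by simp [Φ]
  have hinv := hΦ.eventually_right_inverse
  have htend : Filter.Tendsto (hΦ.localInverse Φ _ 0) (𝓝 1) (𝓝 0) := by
    simpa [hΦ0] using hΦ.localInverse_tendsto
  rw [hΦ0] at hinv
  have hq : Filter.Tendsto (fun a => hΦ.localInverse Φ _ 0 a - p (hΦ.localInverse Φ _ 0 a))
      (𝓝 1) (𝓝 0) := by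
    simpa using htend.sub ((p.continuous.tendsto 0).comp htend)
  have hp' : Filter.Tendsto (fun a => p (hΦ.localInverse Φ _ 0 a)) (𝓝 1) (𝓝 0) := by
    simpa [Function.comp_def] using (p.continuous.tendsto 0).comp htend
  filter_upwards [hinv, hq.eventually (S.eventually_eq_zero_of_exp_mem hp),
    hp'.eventually eventually_expLog_exp] with a h1 h2 h3 g hg
  set X := hΦ.localInverse Φ _ 0 a
  obtain ⟨k, hk⟩ := S.exists_val_eq_exp (hp𝔤 X)
  have hXp : X - p X = 0 := by
    refine h2 (by rw [map_sub, hp _ (hp𝔤 X), sub_self]) ⟨k⁻¹ * g, ?_⟩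
    rw [val_mul, hg, ← h1, ← mul_one (exp (X - p X)), ← one_mul (exp (X - p X) * 1), mul_one,
      ← S.val_inv_mul_val k, hk, mul_assoc]
  have : a = exp (p X) := by
    rw [← h1]; simp only [Φ, hXp, NormedSpace.exp_zero, mul_one]
  rw [this, h3]
  exact hp𝔤 X

end Complete

end SymmetricPair

/-! ### Logarithmic derivatives of maps into `G` -/

namespace SymmetricPair

variable {𝔸 : Type*} [NormedRing 𝔸] [NormedAlgebra ℂ 𝔸] (S : SymmetricPair 𝔸)
variable {E : Type*} [NormedAddCommGroup E] [NormedSpace ℝ E]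

/-- `f` has logarithmic derivative `f⁻¹ df = α` at `x`. -/
def HasLogDerivAt (f : E → S.G) (α : E →L[ℝ] 𝔸) (x : E) : Prop :=
  HasFDerivAt (fun y => S.val (f y)) ((ContinuousLinearMap.mul ℝ 𝔸 (S.val (f x))).comp α) x

variable {S}

lemma HasLogDerivAt.hasFDerivAt {f : E → S.G} {α : E →L[ℝ] 𝔸} {x : E}
    (h : S.HasLogDerivAt f α x) : HasFDerivAt (fun y => S.val (f y))
      ((ContinuousLinearMap.mul ℝ 𝔸 (S.val (f x))).comp α) x := h

lemma HasLogDerivAt.of_hasFDerivAt {f : E → S.G} {f' α : E →L[ℝ] 𝔸} {x : E}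
    (h : HasFDerivAt (fun y => S.val (f y)) f' x) (h' : ∀ w, f' w = S.val (f x) * α w) :
    S.HasLogDerivAt f α x :=
  h.congr_fderiv (by ext w; simp [h'])

lemma HasLogDerivAt.fderiv_apply {f : E → S.G} {α : E →L[ℝ] 𝔸} {x : E}
    (h : S.HasLogDerivAt f α x) (w : E) :
    fderiv ℝ (fun y => S.val (f y)) x w = S.val (f x) * α w := by
  rw [h.hasFDerivAt.fderiv]; rfl

lemma HasLogDerivAt.continuousAt {f : E → S.G} {α : E →L[ℝ] 𝔸} {x : E}
    (h : S.HasLogDerivAt f α x) : ContinuousAt (fun y => S.val (f y)) x :=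
  h.hasFDerivAt.continuousAt

lemma HasLogDerivAt.unique {f : E → S.G} {α α' : E →L[ℝ] 𝔸} {x : E}
    (h : S.HasLogDerivAt f α x) (h' : S.HasLogDerivAt f α' x) : α = α' := by
  ext w
  have := h.fderiv_apply w
  rw [h'.fderiv_apply w] at this
  simpa using (congrArg (S.val (f x)⁻¹ * ·) this).symm

lemma HasLogDerivAt.congr {f g : E → S.G} {α : E →L[ℝ] 𝔸} {x : E}
    (h : S.HasLogDerivAt f α x) (hfg : g =ᶠ[𝓝 x] f) : S.HasLogDerivAt g α x := by
  have h1 : (fun y => S.val (g y)) =ᶠ[𝓝 x] fun y => S.val (f y) := hfg.fun_comp S.val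
  refine .of_hasFDerivAt (h.hasFDerivAt.congr_of_eventuallyEq h1) fun w => ?_
  rw [hfg.eq_of_nhds]; rfl

lemma hasLogDerivAt_const (g : S.G) (x : E) : S.HasLogDerivAt (fun _ => g) 0 x :=
  .of_hasFDerivAt (hasFDerivAt_const _ _) fun w => by simp

lemma exists_hasLogDerivAt {f : E → S.G} {x : E}
    (h : DifferentiableAt ℝ (fun y => S.val (f y)) x) : ∃ α, S.HasLogDerivAt f α x :=
  ⟨(ContinuousLinearMap.mul ℝ 𝔸 (S.val (f x)⁻¹)).comp (fderiv ℝ (fun y => S.val (f y)) x),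
    .of_hasFDerivAt h.hasFDerivAt fun w => by simp⟩

lemma HasLogDerivAt.mul {f g : E → S.G} {α η : E →L[ℝ] 𝔸} {x : E}
    (hf : S.HasLogDerivAt f α x) (hg : S.HasLogDerivAt g η x) :
    S.HasLogDerivAt (fun y => f y * g y) ((S.AdL (g x)⁻¹).comp α + η) x :=
  .of_hasFDerivAt (hf.hasFDerivAt.mul' hg.hasFDerivAt) fun w => by
    simp only [add_apply, ContinuousLinearMap.comp_apply, AdL_apply, mul_add, mul_assoc,
      ContinuousLinearMap.mul_apply', val_mul, inv_inv, smul_apply, smul_eq_mul, add_comm,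
      val_mul_inv_cancel_left, MulOpposite.smul_eq_mul_unop, MulOpposite.unop_op]
    rfl

lemma HasLogDerivAt.mul_const {g : E → S.G} {η : E →L[ℝ] 𝔸} {x : E}
    (hg : S.HasLogDerivAt g η x) (h : S.G) :
    S.HasLogDerivAt (fun y => g y * h) ((S.AdL h⁻¹).comp η) x := by
  simpa using hg.mul (hasLogDerivAt_const h x)

lemma HasLogDerivAt.comp {F : Type*} [NormedAddCommGroup F] [NormedSpace ℝ F] {f : E → S.G}
    {φ : F → E} {φ' : F →L[ℝ] E} {x : F} {α : E →L[ℝ] 𝔸} (hf : S.HasLogDerivAt f α (φ x))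
    (hφ : HasFDerivAt φ φ' x) : S.HasLogDerivAt (fun y => f (φ y)) (α.comp φ') x :=
  .of_hasFDerivAt (hf.hasFDerivAt.comp x hφ) fun w => by simp

section Complete

variable [CompleteSpace 𝔸]

lemma HasLogDerivAt.inv {f : E → S.G} {α : E →L[ℝ] 𝔸} {x : E} (hf : S.HasLogDerivAt f α x) :
    S.HasLogDerivAt (fun y => (f y)⁻¹) (-((S.AdL (f x)).comp α)) x := by
  have h1 := hasFDerivAt_ringInverse (𝕜 := ℝ) (f x : 𝔸ˣ)
  have h2 : HasFDerivAt (fun y => Ring.inverse (S.val (f y))) _ x :=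
    HasFDerivAt.comp x (f := fun y => S.val (f y)) h1 hf.hasFDerivAt
  refine .of_hasFDerivAt (f' := (-(ContinuousLinearMap.mulLeftRight ℝ 𝔸 (S.val (f x)⁻¹)
    (S.val (f x)⁻¹))).comp ((ContinuousLinearMap.mul ℝ 𝔸 (S.val (f x))).comp α)) ?_ ?_
  · have h3 : (fun y => S.val (f y)⁻¹) = fun y => Ring.inverse (S.val (f y)) :=
      funext fun y => S.val_inv_eq_inverse (f y)
    rw [h3]
    exact h2
  · intro w
    simp [AdL_apply, mul_assoc]

lemma contDiffAt_val_inv {f : E → S.G} {x : E} {m : WithTop ℕ∞}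
    (h : ContDiffAt ℝ m (fun y => S.val (f y)) x) :
    ContDiffAt ℝ m (fun y => S.val (f y)⁻¹) x := by
  simp only [val_inv_eq_inverse]
  exact ContDiffAt.comp x (contDiffAt_ringInverse ℝ (f x : 𝔸ˣ)) h

lemma contDiffOn_val_inv {f : E → S.G} {s : Set E} {m : WithTop ℕ∞}
    (h : ContDiffOn ℝ m (fun y => S.val (f y)) s) :
    ContDiffOn ℝ m (fun y => S.val (f y)⁻¹) s := by
  intro x hx
  simp only [val_inv_eq_inverse]
  exact ContDiffAt.comp_contDiffWithinAt x (contDiffAt_ringInverse ℝ (f x : 𝔸ˣ)) (h x hx)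

/-- Maps with the same logarithmic derivative on a connected set differ by a left translation. -/
lemma eqOn_of_hasLogDerivAt {s : Set E} (hs : IsOpen s) (hs' : IsPreconnected s) {x₀ : E}
    (hx₀ : x₀ ∈ s) {f g : E → S.G} {θ : E → E →L[ℝ] 𝔸} (hf : ∀ x ∈ s, S.HasLogDerivAt f (θ x) x)
    (hg : ∀ x ∈ s, S.HasLogDerivAt g (θ x) x) :
    ∀ x ∈ s, f x = f x₀ * (g x₀)⁻¹ * g x := by
  intro x hx
  have hd : ∀ y ∈ s, S.HasLogDerivAt (fun y => f y * (g y)⁻¹) 0 y := by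
    intro y hy
    have h := (hf y hy).mul (hg y hy).inv
    rwa [inv_inv, add_neg_cancel] at h
  have hd' : ∀ y ∈ s, HasFDerivAt (fun y => S.val (f y * (g y)⁻¹)) (0 : E →L[ℝ] 𝔸) y :=
    fun y hy => (hd y hy).hasFDerivAt.congr_fderiv (by simp)
  have := hs.is_const_of_fderiv_eq_zero hs'
    (fun y hy => (hd' y hy).differentiableAt.differentiableWithinAt)
    (fun y hy => (hd' y hy).fderiv) hx hx₀
  have h2 := S.val_injective this
  rw [← h2]; group

/-- The Maurer–Cartan equation. -/
lemma HasLogDerivAt.maurerCartan {s : Set E} (hs : IsOpen s) {f : E → S.G} {θ : E → E →L[ℝ] 𝔸}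
    (hf : ∀ x ∈ s, S.HasLogDerivAt f (θ x) x) {x : E} (hx : x ∈ s) (hθ : DifferentiableAt ℝ θ x)
    (u w : E) : fderiv ℝ θ x u w - fderiv ℝ θ x w u = θ x w * θ x u - θ x u * θ x w := by
  have h0 : HasFDerivAt (fun y => ContinuousLinearMap.mul ℝ 𝔸 (S.val (f y))) _ x :=
    (ContinuousLinearMap.mul ℝ 𝔸).hasFDerivAt.comp x (hf x hx).hasFDerivAt
  have h1 := h0.clm_comp hθ.hasFDerivAt
  have hsym := second_derivative_symmetric_of_eventually (f := fun y => S.val (f y))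
    (Filter.eventually_of_mem (hs.mem_nhds hx) fun y hy => (hf y hy).hasFDerivAt) h1 u w
  simp only [ContinuousLinearMap.compL_apply, ContinuousLinearMap.mul_apply', add_apply,
    ContinuousLinearMap.flip_apply, ContinuousLinearMap.comp_apply] at hsym
  have h3 := congrArg (S.val (f x)⁻¹ * ·) hsym
  simp only [mul_add, mul_assoc, val_inv_mul_cancel_left] at h3
  rw [sub_eq_sub_iff_add_eq_add, h3]
  exact add_comm _ _

/-- `D` is the differential of the endomorphism `ρ` of `G`, extended to a real linear map of the
whole algebra. -/
def IsDifferential (S : SymmetricPair 𝔸) (ρ : S.G →* S.G) (D : 𝔸 →L[ℝ] 𝔸) : Prop :=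
  ∀ X ∈ S.𝔤, D X ∈ S.𝔤 ∧ ∀ g, S.val g = exp X → S.val (ρ g) = exp (D X)

lemma IsDifferential.apply_AdL {ρ : S.G →* S.G} {D : 𝔸 →L[ℝ] 𝔸} (hD : S.IsDifferential ρ D)
    (g : S.G) {X : 𝔸} (hX : X ∈ S.𝔤) : D (S.AdL g X) = S.AdL (ρ g) (D X) := by
  let _ : NormedAlgebra ℚ 𝔸 := NormedAlgebra.restrictScalars ℚ ℝ 𝔸
  refine eq_of_forall_exp_smul_eq fun t => ?_
  obtain ⟨h, hh⟩ := S.exists_val_eq_exp (S.smul_mem_𝔤 hX t)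
  have h1 : S.val (g * h * g⁻¹) = exp (t • S.AdL g X) := by
    rw [val_mul, val_mul, hh, ← map_smul, AdL_apply]
    exact (NormedSpace.exp_units_conj (g : 𝔸ˣ) (t • X)).symm
  rw [← map_smul, ← (hD _ (S.smul_mem_𝔤 (S.AdL_mem_𝔤 g hX) t)).2 _ h1, map_mul, map_mul, map_inv,
    val_mul, val_mul, (hD _ (S.smul_mem_𝔤 hX t)).2 h hh, map_smul, ← map_smul (S.AdL _), AdL_apply]
  exact (NormedSpace.exp_units_conj (ρ g : 𝔸ˣ) (t • D X)).symm

lemma AdL_apply_of_val_eq_exp {g : S.G} {X : 𝔸} (hg : S.val g = exp X) (Y : 𝔸) :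
    S.AdL g Y = exp X * Y * exp (-X) := by
  rw [AdL_apply, hg, S.val_inv_eq_exp_neg hg]

/-- Differentials of endomorphisms of `G` are Lie algebra endomorphisms. -/
lemma IsDifferential.apply_lie {ρ : S.G →* S.G} {D : 𝔸 →L[ℝ] 𝔸} (hD : S.IsDifferential ρ D)
    {X Y : 𝔸} (hX : X ∈ S.𝔤) (hY : Y ∈ S.𝔤) : D ⁅X, Y⁆ = ⁅D X, D Y⁆ := by
  have h1 := (D.hasFDerivAt.comp_hasDerivAt (0 : ℝ) (hasDerivAt_exp_conj X Y 0))
  have h2 := hasDerivAt_exp_conj (D X) (D Y) 0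
  have h3 : (D ∘ fun t : ℝ => exp (t • X) * Y * exp (-(t • X)))
      = fun t : ℝ => exp (t • D X) * D Y * exp (-(t • D X)) := by
    funext t
    obtain ⟨g, hg⟩ := S.exists_val_eq_exp (S.smul_mem_𝔤 hX t)
    rw [Function.comp_apply, ← AdL_apply_of_val_eq_exp hg, hD.apply_AdL g hY,
      AdL_apply_of_val_eq_exp ((hD _ (S.smul_mem_𝔤 hX t)).2 g hg), map_smul]
  rw [h3] at h1
  simpa using h1.unique h2

section FiniteDimensional

variable [FiniteDimensional ℂ 𝔸]

lemma tendsto_val_inv_mul {f : E → S.G} {x : E} (hf : ContinuousAt (fun y => S.val (f y)) x) :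
    Filter.Tendsto (fun y => S.val (f x)⁻¹ * S.val (f y)) (𝓝 x) (𝓝 1) := by
  simpa using (tendsto_const_nhds (x := S.val (f x)⁻¹)).mul hf.tendsto

lemma eventually_expLog_mem_of_continuousAt {f : E → S.G} {x : E}
    (hf : ContinuousAt (fun y => S.val (f y)) x) :
    ∀ᶠ y in 𝓝 x, expLog 𝔸 (S.val (f x)⁻¹ * S.val (f y)) ∈ S.𝔤 := by
  filter_upwards [(tendsto_val_inv_mul hf).eventually S.eventually_expLog_mem] with y hy
  exact hy ((f x)⁻¹ * f y) rfl

lemma HasLogDerivAt.hasFDerivAt_expLog {f : E → S.G} {α : E →L[ℝ] 𝔸} {x : E}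
    (hf : S.HasLogDerivAt f α x) :
    HasFDerivAt (fun y => expLog 𝔸 (S.val (f x)⁻¹ * S.val (f y))) α x := by
  have h1 : HasFDerivAt (fun y => S.val (f x)⁻¹ * S.val (f y)) _ x :=
    hf.hasFDerivAt.const_mul (S.val (f x)⁻¹)
  have h2 : HasFDerivAt (expLog 𝔸) (ContinuousLinearMap.id ℝ 𝔸) (S.val (f x)⁻¹ * S.val (f x)) := by
    simpa using CurvedFlats.hasFDerivAt_expLog (𝔸 := 𝔸)
  refine (h2.comp x h1).congr_fderiv ?_
  ext w
  simp

/-- Logarithmic derivatives of maps into `G` take values in `𝔤`. -/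
lemma HasLogDerivAt.mem_𝔤 {f : E → S.G} {α : E →L[ℝ] 𝔸} {x : E}
    (hf : S.HasLogDerivAt f α x) (w : E) : α w ∈ S.𝔤 := by
  have hcl : IsClosed (S.𝔤ℝ : Set 𝔸) := S.𝔤ℝ.closed_of_finiteDimensional
  have h1 : HasDerivAt (fun t : ℝ => x + t • w) w 0 := by
    simpa using ((hasDerivAt_id (0 : ℝ)).smul_const w).const_add x
  have hd : HasFDerivAt (fun y => expLog 𝔸 (S.val (f x)⁻¹ * S.val (f y))) α (x + (0 : ℝ) • w) := by
    simpa using hf.hasFDerivAt_expLog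
  have h2 := (hd.comp_hasDerivAt (0 : ℝ) h1).tendsto_slope
  have hc : Filter.Tendsto (fun t : ℝ => x + t • w) (𝓝[≠] 0) (𝓝 x) := by
    have := h1.continuousAt.tendsto
    simp only [zero_smul, add_zero] at this
    exact this.mono_left nhdsWithin_le_nhds
  refine hcl.mem_of_tendsto h2 ?_
  filter_upwards [hc.eventually (eventually_expLog_mem_of_continuousAt hf.continuousAt)] with t ht
  simp only [slope, vsub_eq_sub, Function.comp_apply, zero_smul, add_zero, val_inv_mul_val,
    expLog_one, sub_zero]
  exact S.𝔤ℝ.smul_mem _ ht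

lemma IsDifferential.eventually_val_eq {ρ : S.G →* S.G} {D : 𝔸 →L[ℝ] 𝔸}
    (hD : S.IsDifferential ρ D) {f : E → S.G} {x : E}
    (hf : ContinuousAt (fun y => S.val (f y)) x) :
    ∀ᶠ y in 𝓝 x, S.val (ρ (f y))
      = S.val (ρ (f x)) * exp (D (expLog 𝔸 (S.val (f x)⁻¹ * S.val (f y)))) := by
  filter_upwards [eventually_expLog_mem_of_continuousAt hf,
    (tendsto_val_inv_mul hf).eventually eventually_exp_expLog] with y h1 h2
  rw [← (hD _ h1).2 ((f x)⁻¹ * f y) h2.symm, ← val_mul, ← map_mul, mul_inv_cancel_left]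

lemma IsDifferential.hasLogDerivAt {ρ : S.G →* S.G} {D : 𝔸 →L[ℝ] 𝔸} (hD : S.IsDifferential ρ D)
    {f : E → S.G} {x : E} {α : E →L[ℝ] 𝔸} (hf : S.HasLogDerivAt f α x) :
    S.HasLogDerivAt (fun y => ρ (f y)) (D.comp α) x := by
  have h3 : HasFDerivAt (fun y => D (expLog 𝔸 (S.val (f x)⁻¹ * S.val (f y)))) (D.comp α) x :=
    D.hasFDerivAt.comp x hf.hasFDerivAt_expLog
  have h4 : HasFDerivAt (exp : 𝔸 → 𝔸) (1 : 𝔸 →L[ℝ] 𝔸)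
      (D (expLog 𝔸 (S.val (f x)⁻¹ * S.val (f x)))) := by
    simpa [expLog_one] using hasFDerivAt_exp_zero (𝕂 := ℝ) (𝔸 := 𝔸)
  have h5 : HasFDerivAt (fun y => S.val (ρ (f x)) *
      exp (D (expLog 𝔸 (S.val (f x)⁻¹ * S.val (f y))))) _ x :=
    (HasFDerivAt.comp x (f := fun y => D (expLog 𝔸 (S.val (f x)⁻¹ * S.val (f y)))) h4
      h3).const_mul (S.val (ρ (f x)))
  exact .of_hasFDerivAt (h5.congr_of_eventuallyEq (hD.eventually_val_eq hf.continuousAt))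
    fun w => by simp

end FiniteDimensional

end Complete

end SymmetricPair

/-! ### The decomposition `𝔲 = 𝔲₀ + 𝔲₁` -/

namespace SymmetricPair

variable {𝔸 : Type*} [NormedRing 𝔸] [NormedAlgebra ℂ 𝔸] [FiniteDimensional ℂ 𝔸]
variable (S : SymmetricPair 𝔸)

/-- A real linear map `𝔤 → 𝔤` extends to a continuous real linear map of the whole algebra. -/
lemma exists_extension (d : S.𝔤 → S.𝔤) (hadd : ∀ X Y, d (X + Y) = d X + d Y)
    (hsmul : ∀ (c : ℝ) X, d ((c : ℂ) • X) = (c : ℂ) • d X) :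
    ∃ D : 𝔸 →L[ℝ] 𝔸, ∀ X : S.𝔤, D X = d X := by
  let d' : S.𝔤ℝ →ₗ[ℝ] 𝔸 :=
    { toFun := fun X => (d ⟨X, X.2⟩ : 𝔸)
      map_add' := fun X Y => congrArg Subtype.val (hadd ⟨X, X.2⟩ ⟨Y, Y.2⟩)
      map_smul' := fun c X => by
        have h1 : (⟨(c • X : S.𝔤ℝ), (c • X).2⟩ : S.𝔤) = (c : ℂ) • (⟨X, X.2⟩ : S.𝔤) :=
          Subtype.ext (Complex.coe_smul c (X : 𝔸)).symm
        rw [h1, hsmul]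
        exact Complex.coe_smul c _ }
  obtain ⟨D, hD⟩ := LinearMap.exists_extend d'
  exact ⟨LinearMap.toContinuousLinearMap D, fun X => LinearMap.congr_fun hD ⟨X, X.2⟩⟩

/-- The differential of `σ`, extended to a real linear map of the algebra. -/
noncomputable def Dσ : 𝔸 →L[ℝ] 𝔸 :=
  (S.exists_extension S.dσ (map_add _) fun _ _ => map_smul _ _ _).choose

/-- The differential of `τ`, extended to a real linear map of the algebra. -/
noncomputable def Dτ : 𝔸 →L[ℝ] 𝔸 :=
  (S.exists_extension S.dτ (map_add _) fun _ _ => by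
    rw [map_smulₛₗ, Complex.conj_ofReal]).choose

lemma Dσ_apply (X : S.𝔤) : S.Dσ X = S.dσ X :=
  (S.exists_extension S.dσ (map_add _) fun _ _ => map_smul _ _ _).choose_spec X

lemma Dτ_apply (X : S.𝔤) : S.Dτ X = S.dτ X :=
  (S.exists_extension S.dτ (map_add _) fun _ _ => by
    rw [map_smulₛₗ, Complex.conj_ofReal]).choose_spec X

lemma Dσ_mem_𝔤 {X : 𝔸} (hX : X ∈ S.𝔤) : S.Dσ X ∈ S.𝔤 := by
  rw [S.Dσ_apply ⟨X, hX⟩]; exact (S.dσ ⟨X, hX⟩).2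

lemma Dτ_mem_𝔤 {X : 𝔸} (hX : X ∈ S.𝔤) : S.Dτ X ∈ S.𝔤 := by
  rw [S.Dτ_apply ⟨X, hX⟩]; exact (S.dτ ⟨X, hX⟩).2

lemma isDifferential_σ : S.IsDifferential S.σ S.Dσ := fun X hX =>
  ⟨S.Dσ_mem_𝔤 hX, fun g hg => by rw [S.Dσ_apply ⟨X, hX⟩]; exact S.σ_exp ⟨X, hX⟩ g hg⟩

lemma isDifferential_τ : S.IsDifferential S.τ S.Dτ := fun X hX =>
  ⟨S.Dτ_mem_𝔤 hX, fun g hg => by rw [S.Dτ_apply ⟨X, hX⟩]; exact S.τ_exp ⟨X, hX⟩ g hg⟩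

lemma Dτ_smul (c : ℂ) {X : 𝔸} (hX : X ∈ S.𝔤) :
    S.Dτ (c • X) = (starRingEnd ℂ c) • S.Dτ X := by
  have h1 := S.Dτ_apply (c • ⟨X, hX⟩)
  rw [map_smulₛₗ] at h1
  rw [S.Dτ_apply ⟨X, hX⟩]
  exact h1

lemma mem_𝔲_iff {X : 𝔸} : X ∈ S.𝔲 ↔ X ∈ S.𝔤 ∧ S.Dτ X = X := by
  constructor
  · rintro ⟨h, h'⟩
    exact ⟨h, by rw [S.Dτ_apply ⟨X, h⟩, h']⟩
  · rintro ⟨h, h'⟩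
    exact ⟨h, Subtype.ext (by rw [← S.Dτ_apply ⟨X, h⟩, h'])⟩

lemma mem_eig_iff {X : 𝔸} {ε : ℝ} : X ∈ S.eig ε ↔ X ∈ S.𝔲 ∧ S.Dσ X = ε • X := by
  constructor
  · rintro ⟨h, h𝔤, h'⟩
    exact ⟨h, by rw [S.Dσ_apply ⟨X, h𝔤⟩, h']⟩
  · rintro ⟨h, h'⟩
    have h𝔤 := (S.mem_𝔲_iff.1 h).1
    exact ⟨h, h𝔤, by rw [← S.Dσ_apply ⟨X, h𝔤⟩, h']⟩

lemma mem_𝔲₀_iff {X : 𝔸} : X ∈ S.𝔲₀ ↔ X ∈ S.𝔲 ∧ S.Dσ X = X := by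
  rw [𝔲₀, mem_eig_iff, one_smul]

lemma mem_𝔲₁_iff {X : 𝔸} : X ∈ S.𝔲₁ ↔ X ∈ S.𝔲 ∧ S.Dσ X = -X := by
  rw [𝔲₁, mem_eig_iff, neg_one_smul]

variable {S}

lemma mem_𝔤_of_mem_𝔲 {X : 𝔸} (h : X ∈ S.𝔲) : X ∈ S.𝔤 := (S.mem_𝔲_iff.1 h).1

lemma mem_𝔲_of_mem_𝔲₀ {X : 𝔸} (h : X ∈ S.𝔲₀) : X ∈ S.𝔲 := h.1

lemma mem_𝔲_of_mem_𝔲₁ {X : 𝔸} (h : X ∈ S.𝔲₁) : X ∈ S.𝔲 := h.1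

variable [CompleteSpace 𝔸]

lemma lie_mem_𝔲 {X Y : 𝔸} (hX : X ∈ S.𝔲) (hY : Y ∈ S.𝔲) : ⁅X, Y⁆ ∈ S.𝔲 := by
  rw [mem_𝔲_iff] at *
  exact ⟨S.lie_mem_𝔤 hX.1 hY.1, by rw [S.isDifferential_τ.apply_lie hX.1 hY.1, hX.2, hY.2]⟩

lemma Dσ_lie {X Y : 𝔸} (hX : X ∈ S.𝔲) (hY : Y ∈ S.𝔲) : S.Dσ ⁅X, Y⁆ = ⁅S.Dσ X, S.Dσ Y⁆ :=
  S.isDifferential_σ.apply_lie (mem_𝔤_of_mem_𝔲 hX) (mem_𝔤_of_mem_𝔲 hY)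

lemma lie_mem_𝔲₀_of_𝔲₀_𝔲₀ {X Y : 𝔸} (hX : X ∈ S.𝔲₀) (hY : Y ∈ S.𝔲₀) : ⁅X, Y⁆ ∈ S.𝔲₀ := by
  rw [mem_𝔲₀_iff] at *
  exact ⟨lie_mem_𝔲 hX.1 hY.1, by rw [Dσ_lie hX.1 hY.1, hX.2, hY.2]⟩

lemma lie_mem_𝔲₁_of_𝔲₀_𝔲₁ {X Y : 𝔸} (hX : X ∈ S.𝔲₀) (hY : Y ∈ S.𝔲₁) : ⁅X, Y⁆ ∈ S.𝔲₁ := by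
  rw [mem_𝔲₀_iff] at hX
  rw [mem_𝔲₁_iff] at *
  exact ⟨lie_mem_𝔲 hX.1 hY.1, by rw [Dσ_lie hX.1 hY.1, hX.2, hY.2, lie_neg]⟩

lemma lie_mem_𝔲₁_of_𝔲₁_𝔲₀ {X Y : 𝔸} (hX : X ∈ S.𝔲₁) (hY : Y ∈ S.𝔲₀) : ⁅X, Y⁆ ∈ S.𝔲₁ := by
  rw [← lie_skew]
  exact neg_mem (lie_mem_𝔲₁_of_𝔲₀_𝔲₁ hY hX)

lemma lie_mem_𝔲₀_of_𝔲₁_𝔲₁ {X Y : 𝔸} (hX : X ∈ S.𝔲₁) (hY : Y ∈ S.𝔲₁) : ⁅X, Y⁆ ∈ S.𝔲₀ := by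
  rw [mem_𝔲₁_iff] at hX hY
  rw [mem_𝔲₀_iff]
  exact ⟨lie_mem_𝔲 hX.1 hY.1, by rw [Dσ_lie hX.1 hY.1, hX.2, hY.2, lie_neg, neg_lie, neg_neg]⟩

lemma Dσ_Dσ {X : 𝔸} (hX : X ∈ S.𝔤) : S.Dσ (S.Dσ X) = X := by
  refine eq_of_forall_exp_smul_eq fun t => ?_
  have hX' := S.smul_mem_𝔤 hX t
  obtain ⟨g, hg⟩ := S.exists_val_eq_exp hX'
  rw [← map_smul, ← map_smul, ← (S.isDifferential_σ _ (S.Dσ_mem_𝔤 hX')).2 (S.σ g)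
    ((S.isDifferential_σ _ hX').2 g hg), S.σ_σ, hg]

lemma Dσ_Dτ {X : 𝔸} (hX : X ∈ S.𝔤) : S.Dσ (S.Dτ X) = S.Dτ (S.Dσ X) := by
  refine eq_of_forall_exp_smul_eq fun t => ?_
  have hX' := S.smul_mem_𝔤 hX t
  obtain ⟨g, hg⟩ := S.exists_val_eq_exp hX'
  rw [← map_smul, ← map_smul, ← (S.isDifferential_σ _ (S.Dτ_mem_𝔤 hX')).2 (S.τ g)
    ((S.isDifferential_τ _ hX').2 g hg), S.σ_τ, ← map_smul, ← map_smul,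
    ← (S.isDifferential_τ _ (S.Dσ_mem_𝔤 hX')).2 (S.σ g) ((S.isDifferential_σ _ hX').2 g hg)]

lemma Dτ_Dτ {X : 𝔸} (hX : X ∈ S.𝔤) : S.Dτ (S.Dτ X) = X := by
  refine eq_of_forall_exp_smul_eq fun t => ?_
  have hX' := S.smul_mem_𝔤 hX t
  obtain ⟨g, hg⟩ := S.exists_val_eq_exp hX'
  rw [← map_smul, ← map_smul, ← (S.isDifferential_τ _ (S.Dτ_mem_𝔤 hX')).2 (S.τ g)
    ((S.isDifferential_τ _ hX').2 g hg), S.τ_τ, hg]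

lemma Dσ_mem_𝔲 {X : 𝔸} (hX : X ∈ S.𝔲) : S.Dσ X ∈ S.𝔲 := by
  rw [mem_𝔲_iff] at *
  exact ⟨S.Dσ_mem_𝔤 hX.1, by rw [← Dσ_Dτ hX.1, hX.2]⟩

lemma add_Dσ_mem_𝔲₀ {X : 𝔸} (hX : X ∈ S.𝔲) : X + S.Dσ X ∈ S.𝔲₀ := by
  rw [mem_𝔲₀_iff]
  exact ⟨add_mem hX (Dσ_mem_𝔲 hX), by rw [map_add, Dσ_Dσ (mem_𝔤_of_mem_𝔲 hX), add_comm]⟩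

lemma sub_Dσ_mem_𝔲₁ {X : 𝔸} (hX : X ∈ S.𝔲) : X - S.Dσ X ∈ S.𝔲₁ := by
  rw [mem_𝔲₁_iff]
  exact ⟨sub_mem hX (Dσ_mem_𝔲 hX), by rw [map_sub, Dσ_Dσ (mem_𝔤_of_mem_𝔲 hX), neg_sub]⟩

/-- The decomposition `𝔲 = 𝔲₀ + 𝔲₁`. -/
lemma exists_add_of_mem_𝔲 {X : 𝔸} (hX : X ∈ S.𝔲) : ∃ Y ∈ S.𝔲₀, ∃ Z ∈ S.𝔲₁, X = Y + Z := by
  refine ⟨(1 / 2 : ℝ) • (X + S.Dσ X), S.𝔲₀.smul_mem _ (add_Dσ_mem_𝔲₀ hX),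
    (1 / 2 : ℝ) • (X - S.Dσ X), S.𝔲₁.smul_mem _ (sub_Dσ_mem_𝔲₁ hX), ?_⟩
  module

lemma eq_zero_of_mem_𝔲₀_of_mem_𝔲₁ {X : 𝔸} (h0 : X ∈ S.𝔲₀) (h1 : X ∈ S.𝔲₁) : X = 0 := by
  rw [mem_𝔲₀_iff] at h0
  rw [mem_𝔲₁_iff, h0.2] at h1
  have h2 : (2 : ℝ) • X = 0 := by
    rw [two_smul]
    nth_rewrite 2 [h1.2]
    exact add_neg_cancel X
  exact (smul_eq_zero.1 h2).resolve_left two_ne_zero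

lemma σ_mem_U {g : S.G} (hg : g ∈ S.U) : S.σ g ∈ S.U := by
  change S.τ (S.σ g) = S.σ g
  rw [← S.σ_τ, show S.τ g = g from hg]

lemma mem_U_iff {g : S.G} : g ∈ S.U ↔ S.τ g = g := Iff.rfl

lemma mem_U₀_iff {g : S.G} : g ∈ S.U₀ ↔ g ∈ S.U ∧ S.σ g = g := Iff.rfl

lemma AdL_mem_𝔲 {g : S.G} (hg : g ∈ S.U) {X : 𝔸} (hX : X ∈ S.𝔲) : S.AdL g X ∈ S.𝔲 := by
  rw [mem_𝔲_iff] at *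
  rw [mem_U_iff] at hg
  exact ⟨S.AdL_mem_𝔤 g hX.1, by rw [S.isDifferential_τ.apply_AdL g hX.1, hg, hX.2]⟩

lemma AdL_mem_𝔲₁ {g : S.G} (hg : g ∈ S.U₀) {X : 𝔸} (hX : X ∈ S.𝔲₁) : S.AdL g X ∈ S.𝔲₁ := by
  rw [mem_𝔲₁_iff] at *
  rw [mem_U₀_iff] at hg
  exact ⟨AdL_mem_𝔲 hg.1 hX.1, by
    rw [S.isDifferential_σ.apply_AdL g (mem_𝔤_of_mem_𝔲 hX.1), hg.2, hX.2, map_neg]⟩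

lemma mem_U_of_val_eq_exp {g : S.G} {X : 𝔸} (hX : X ∈ S.𝔲) (hg : S.val g = exp X) :
    g ∈ S.U := by
  rw [mem_𝔲_iff] at hX
  refine S.val_injective ?_
  rw [(S.isDifferential_τ X hX.1).2 g hg, hX.2, hg]

lemma mem_U₀_of_val_eq_exp {g : S.G} {X : 𝔸} (hX : X ∈ S.𝔲₀) (hg : S.val g = exp X) :
    g ∈ S.U₀ := by
  rw [mem_𝔲₀_iff] at hX
  refine ⟨mem_U_of_val_eq_exp hX.1 hg, S.val_injective ?_⟩
  rw [(S.isDifferential_σ X (mem_𝔤_of_mem_𝔲 hX.1)).2 g hg, hX.2, hg]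

/-- Logarithmic derivatives of maps into `U` take values in `𝔲`. -/
lemma HasLogDerivAt.mem_𝔲 {E : Type*} [NormedAddCommGroup E] [NormedSpace ℝ E] {f : E → S.G}
    {α : E →L[ℝ] 𝔸} {x : E} (hf : S.HasLogDerivAt f α x) (hU : ∀ᶠ y in 𝓝 x, f y ∈ S.U) (w : E) :
    α w ∈ S.𝔲 := by
  rw [mem_𝔲_iff]
  refine ⟨hf.mem_𝔤 w, ?_⟩
  have h1 := (S.isDifferential_τ.hasLogDerivAt hf).congr (g := f)
    (hU.mono fun y hy => (mem_U_iff.1 hy).symm)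
  exact (DFunLike.congr_fun (hf.unique h1) w).symm

/-! ### The invariant form -/

namespace IsRiemannian

variable {B : LinearMap.BilinForm ℝ 𝔸} (hB : S.IsRiemannian B)

lemma AdL_invariant (hB : S.IsRiemannian B) {g : S.G} (hg : g ∈ S.U) {X Y : 𝔸} (hX : X ∈ S.𝔲)
    (hY : Y ∈ S.𝔲) : B (S.AdL g X) (S.AdL g Y) = B X Y := by
  rw [← Ad_eq, ← Ad_eq, hB.Ad_invariant g hg X hX Y hY]

/-- `ad 𝔲` is skew for the invariant form. -/
lemma lie_left (hB : S.IsRiemannian B) {X Y Z : 𝔸} (hZ : Z ∈ S.𝔲) (hX : X ∈ S.𝔲)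
    (hY : Y ∈ S.𝔲) : B ⁅Z, X⁆ Y = -B X ⁅Z, Y⁆ := by
  let b : 𝔸 →L[ℝ] 𝔸 →L[ℝ] ℝ := LinearMap.toContinuousLinearMap
    ((LinearMap.toContinuousLinearMap : (𝔸 →ₗ[ℝ] ℝ) ≃ₗ[ℝ] 𝔸 →L[ℝ] ℝ).toLinearMap ∘ₗ B)
  have hb : ∀ V W, b V W = B V W := fun V W => rfl
  have hd := (b.hasFDerivAt.comp_hasDerivAt (0 : ℝ) (hasDerivAt_exp_conj Z X 0)).clm_apply
    (hasDerivAt_exp_conj Z Y 0)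
  have hconst : (fun t : ℝ => (b ∘ fun t : ℝ => exp (t • Z) * X * exp (-(t • Z))) t
      (exp (t • Z) * Y * exp (-(t • Z)))) = fun _ => B X Y := by
    funext t
    obtain ⟨g, hg⟩ := S.exists_val_eq_exp (mem_𝔤_of_mem_𝔲 (S.𝔲.smul_mem t hZ))
    simp only [Function.comp_apply]
    rw [hb, ← AdL_apply_of_val_eq_exp hg, ← AdL_apply_of_val_eq_exp hg,
      hB.AdL_invariant (mem_U_of_val_eq_exp (S.𝔲.smul_mem t hZ) hg) hX hY]
  rw [hconst] at hd
  have := hd.unique (hasDerivAt_const (0 : ℝ) (B X Y))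
  simp only [Function.comp_apply, zero_smul, NormedSpace.exp_zero, neg_zero, one_mul, mul_one,
    hb] at this
  linarith

lemma lie_right (hB : S.IsRiemannian B) {X Y Z : 𝔸} (hZ : Z ∈ S.𝔲) (hX : X ∈ S.𝔲)
    (hY : Y ∈ S.𝔲) : B X ⁅Z, Y⁆ = -B ⁅Z, X⁆ Y := by
  rw [hB.lie_left hZ hX hY, neg_neg]

lemma orthogonal (hB : S.IsRiemannian B) {X Y : 𝔸} (hX : X ∈ S.𝔲₀) (hY : Y ∈ S.𝔲₁) :
    B X Y = 0 := by
  rw [mem_𝔲₀_iff] at hX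
  rw [mem_𝔲₁_iff] at hY
  have h : B (S.Dσ X) (S.Dσ Y) = B X Y := by
    rw [S.Dσ_apply ⟨X, mem_𝔤_of_mem_𝔲 hX.1⟩, S.Dσ_apply ⟨Y, mem_𝔤_of_mem_𝔲 hY.1⟩]
    exact hB.σ_invariant _ _ hX.1 hY.1
  rw [hX.2, hY.2, map_neg] at h
  linarith

lemma eq_zero_of_mem_𝔲₁ (hB : S.IsRiemannian B) {X : 𝔸} (hX : X ∈ S.𝔲₁) (h : B X X = 0) :
    X = 0 := by
  by_contra hne
  exact (hB.pos X hX hne).ne' h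

/-- The form is nondegenerate on `𝔲₀`. -/
lemma eq_zero_of_mem_𝔲₀ (hB : S.IsRiemannian B) {X : 𝔸} (hX : X ∈ S.𝔲₀)
    (h : ∀ Y ∈ S.𝔲₀, B X Y = 0) : X = 0 := by
  refine hB.nondegenerate X hX.1 fun Y hY => ?_
  obtain ⟨V, hV, W, hW, rfl⟩ := exists_add_of_mem_𝔲 hY
  rw [map_add, h V hV, hB.orthogonal hX hW, add_zero]

end IsRiemannian

end SymmetricPair

/-! ### Semisimplicity and conjugacy of maximal abelian subspaces -/

/-- `ad H` as a continuous real linear map. -/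
noncomputable def adL {𝔸 : Type*} [NormedRing 𝔸] [NormedAlgebra ℂ 𝔸] (H : 𝔸) : 𝔸 →L[ℝ] 𝔸 :=
  ContinuousLinearMap.mul ℝ 𝔸 H - (ContinuousLinearMap.mul ℝ 𝔸).flip H

@[simp] lemma adL_apply {𝔸 : Type*} [NormedRing 𝔸] [NormedAlgebra ℂ 𝔸] (H X : 𝔸) :
    adL H X = ⁅H, X⁆ := by
  simp [adL, Ring.lie_def]

namespace SymmetricPair

variable {𝔸 : Type*} [NormedRing 𝔸] [NormedAlgebra ℂ 𝔸] [FiniteDimensional ℂ 𝔸]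
variable {S : SymmetricPair 𝔸} [CompleteSpace 𝔸] {B : LinearMap.BilinForm ℝ 𝔸}

/-- `𝔤 = 𝔲 + i 𝔲`. -/
lemma exists_add_I_smul {X : 𝔸} (hX : X ∈ S.𝔤) :
    ∃ V ∈ S.𝔲, ∃ W ∈ S.𝔲, X = V + Complex.I • W := by
  have hτ := S.Dτ_mem_𝔤 hX
  refine ⟨(2⁻¹ : ℂ) • (X + S.Dτ X), ?_, (-(2⁻¹ * Complex.I)) • (X - S.Dτ X), ?_, ?_⟩
  · have h := S.𝔤.add_mem hX hτ
    refine S.mem_𝔲_iff.2 ⟨S.𝔤.smul_mem _ h, ?_⟩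
    rw [S.Dτ_smul _ h, map_add, Dτ_Dτ hX, add_comm]
    simp [Complex.conj_ofNat]
  · have h := S.𝔤.sub_mem hX hτ
    refine S.mem_𝔲_iff.2 ⟨S.𝔤.smul_mem _ h, ?_⟩
    rw [S.Dτ_smul _ h, map_sub, Dτ_Dτ hX, ← neg_sub X, smul_neg, ← neg_smul]
    simp [Complex.conj_ofNat]
  · have : Complex.I * -(2⁻¹ * Complex.I) = 2⁻¹ := by
      linear_combination (-(2⁻¹ : ℂ)) * Complex.I_mul_I
    rw [smul_smul, this, ← smul_add, add_add_sub_cancel, ← two_smul ℂ, smul_smul]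
    norm_num

/-- In the reductive algebra `𝔤`, a commutator that is central vanishes. -/
lemma eq_zero_of_central {H X : 𝔸} (hH : H ∈ S.𝔤) (hX : X ∈ S.𝔤)
    (hc : ∀ Y ∈ S.𝔤, ⁅⁅H, X⁆, Y⁆ = 0) : ⁅H, X⁆ = 0 := by
  obtain ⟨J, hJ⟩ := S.reductive.exists_isCompl (LieAlgebra.center ℂ S.𝔤)
  let h : S.𝔤 := ⟨H, hH⟩
  let x : S.𝔤 := ⟨X, hX⟩
  have hdec : ∀ y : S.𝔤, ∃ c ∈ LieAlgebra.center ℂ S.𝔤, ∃ j ∈ J, c + j = y := fun y => by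
    have : y ∈ LieAlgebra.center ℂ S.𝔤 ⊔ J := by rw [hJ.sup_eq_top]; trivial
    exact (LieSubmodule.mem_sup _ _ _).1 this
  obtain ⟨c, hc1, j, hj, hcj⟩ := hdec h
  have hz1 : ⁅h, x⁆ ∈ LieAlgebra.center ℂ S.𝔤 := by
    rw [LieModule.mem_maxTrivSubmodule]
    intro y
    rw [← lie_skew, neg_eq_zero]
    exact Subtype.ext (hc y y.2)
  have hz2 : ⁅h, x⁆ ∈ J := by
    rw [← hcj, add_lie, ← lie_skew c x, (LieModule.mem_maxTrivSubmodule ℂ _ _ _).1 hc1 x, neg_zero,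
      zero_add, ← lie_skew]
    exact J.neg_mem (J.lie_mem hj)
  have : ⁅h, x⁆ ∈ LieAlgebra.center ℂ S.𝔤 ⊓ J := ⟨hz1, hz2⟩
  rw [hJ.inf_eq_bot, LieSubmodule.mem_bot] at this
  exact congrArg Subtype.val this

namespace IsRiemannian

/-- `Ad(U₀)` is bounded. -/
lemma exists_norm_AdL_le (hB : S.IsRiemannian B) :
    ∃ C : ℝ, ∀ k ∈ S.U₀, ∀ X ∈ S.𝔲, ‖S.AdL k X‖ ≤ C * ‖X‖ := by
  obtain ⟨C, hC⟩ := hB.isCompact_Ad.exists_bound_of_continuousOn (E := S.𝔲 →L[ℝ] 𝔸)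
    (f := fun L => L) continuous_id.continuousOn
  refine ⟨C, fun k hk X hX => ?_⟩
  have := hC ((S.AdL k).comp S.𝔲.subtypeL) ⟨k, hk, fun Y => (S.Ad_eq k Y).symm⟩
  exact ContinuousLinearMap.le_of_opNorm_le _ this (⟨X, hX⟩ : S.𝔲)

/-- Elements of `𝔲₀` act semisimply on `𝔲`, because `Ad(U₀)` is bounded. -/
lemma lie_eq_zero_of_lie_lie_eq_zero (hB : S.IsRiemannian B) {Z Y : 𝔸} (hZ : Z ∈ S.𝔲₀)
    (hY : Y ∈ S.𝔲) (h : ⁅Z, ⁅Z, Y⁆⁆ = 0) : ⁅Z, Y⁆ = 0 := by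
  obtain ⟨C, hC⟩ := hB.exists_norm_AdL_le
  by_contra hne
  have hpos : 0 < ‖⁅Z, Y⁆‖ := norm_pos_iff.2 hne
  have hb : ∀ t : ℝ, ‖Y + t • ⁅Z, Y⁆‖ ≤ C * ‖Y‖ := by
    intro t
    have htZ := S.𝔲₀.smul_mem t hZ
    obtain ⟨g, hg⟩ := S.exists_val_eq_exp (mem_𝔤_of_mem_𝔲 (mem_𝔲_of_mem_𝔲₀ htZ))
    rw [← exp_conj_eq_of_lie_lie_eq_zero h t, ← AdL_apply_of_val_eq_exp hg]
    exact hC g (mem_U₀_of_val_eq_exp htZ hg) Y hY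
  have h1 := hb ((C * ‖Y‖ + ‖Y‖ + 1) / ‖⁅Z, Y⁆‖)
  have h2 := hb 0
  rw [zero_smul, add_zero] at h2
  have h3 := norm_sub_le_norm_add (((C * ‖Y‖ + ‖Y‖ + 1) / ‖⁅Z, Y⁆‖) • ⁅Z, Y⁆) Y
  rw [add_comm _ Y, norm_smul, Real.norm_eq_abs, abs_of_nonneg (by
    have := norm_nonneg Y
    exact div_nonneg (by linarith) hpos.le), div_mul_cancel₀ _ hpos.ne'] at h3
  linarith

/-- `ad H` is semisimple on `𝔲₁` for `H ∈ 𝔲₁`: the commutator `Z = [H, X]` commutes with `H`, so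
`ad Z` is nilpotent; as it is semisimple, `Z` is central, hence zero by reductivity. -/
lemma lie_eq_zero_of_mem_𝔲₁ (hB : S.IsRiemannian B) {H X : 𝔸} (hH : H ∈ S.𝔲₁) (hX : X ∈ S.𝔲₁)
    (h : ⁅H, ⁅H, X⁆⁆ = 0) : ⁅H, X⁆ = 0 := by
  have hZ := lie_mem_𝔲₀_of_𝔲₁_𝔲₁ hH hX
  have hnil : IsNilpotent (LieAlgebra.ad ℂ 𝔸 ⁅H, X⁆) :=
    LieAlgebra.ad_nilpotent_of_nilpotent (isNilpotent_of_lie_eq rfl h)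
  obtain ⟨k, hk⟩ := hnil
  have hker : ∀ k : ℕ, ∀ Y ∈ S.𝔲, ((LieAlgebra.ad ℂ 𝔸 ⁅H, X⁆) ^ k) Y = 0 → ⁅⁅H, X⁆, Y⁆ = 0 := by
    intro k
    induction k with
    | zero => intro Y _ hY; rw [pow_zero, Module.End.one_apply] at hY; rw [hY, lie_zero]
    | succ k ih =>
      intro Y hY hk
      rw [pow_succ, Module.End.mul_apply, LieAlgebra.ad_apply] at hk
      exact hB.lie_eq_zero_of_lie_lie_eq_zero hZ hY
        (ih _ (lie_mem_𝔲 (mem_𝔲_of_mem_𝔲₀ hZ) hY) hk)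
  have hc : ∀ Y ∈ S.𝔲, ⁅⁅H, X⁆, Y⁆ = 0 := fun Y hY => hker k Y hY (by rw [hk]; rfl)
  refine eq_zero_of_central (mem_𝔤_of_mem_𝔲 (mem_𝔲_of_mem_𝔲₁ hH))
    (mem_𝔤_of_mem_𝔲 (mem_𝔲_of_mem_𝔲₁ hX)) fun Y hY => ?_
  obtain ⟨V, hV, W, hW, rfl⟩ := exists_add_I_smul hY
  rw [lie_add, hc V hV, zero_add, Ring.lie_def, mul_smul_comm, smul_mul_assoc, ← smul_sub,
    ← Ring.lie_def, hc W hW, smul_zero]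

end IsRiemannian

lemma lie_lie_comm_of_lie_eq_zero {H b X : 𝔸} (h : ⁅H, b⁆ = 0) : ⁅H, ⁅b, X⁆⁆ = ⁅b, ⁅H, X⁆⁆ := by
  rw [leibniz_lie H b X, h, zero_lie, zero_add]

namespace IsRiemannian

/-- For commuting `H, b ∈ 𝔲₁`, a small perturbation `H + t b` centralizes no more of `𝔲₁` than `H`
and `b` do together. -/
lemma exists_perturbation (hB : S.IsRiemannian B) {H b : 𝔸} (hH : H ∈ S.𝔲₁)
    (hHb : ⁅H, b⁆ = 0) :
    ∃ t : ℝ, ∀ X ∈ S.𝔲₁, ⁅H + t • b, X⁆ = 0 → ⁅H, X⁆ = 0 ∧ ⁅b, X⁆ = 0 := by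
  let W : Submodule ℝ 𝔸 := S.𝔲₁.map (adL H).toLinearMap
  let T : ℝ → W →L[ℝ] 𝔸 := fun t => (adL H + t • adL b).comp W.subtypeL
  have hT : Continuous T := by
    have h1 : Continuous fun t : ℝ => adL H + t • adL b := by fun_prop
    exact h1.clm_comp continuous_const
  have h0 : Function.Injective (T 0) := by
    rw [injective_iff_map_eq_zero]
    rintro ⟨_, Y, hY, rfl⟩ h
    have h' : ⁅H, ⁅H, Y⁆⁆ = 0 := by simpa [T] using h
    exact Subtype.ext (by simpa using hB.lie_eq_zero_of_mem_𝔲₁ hH hY h')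
  have hev : ∀ᶠ t in 𝓝 (0 : ℝ), Function.Injective (T t) :=
    hT.continuousAt.eventually (ContinuousLinearMap.isOpen_injective.mem_nhds h0)
  obtain ⟨t, ht, ht0⟩ := ((hev.filter_mono (nhdsWithin_le_nhds (s := {0}ᶜ))).and
    self_mem_nhdsWithin).exists
  refine ⟨t, fun X hX h => ?_⟩
  rw [add_lie, smul_lie] at h
  have hHX : ⁅H, X⁆ = 0 := by
    have hmem : ⁅H, X⁆ ∈ W := ⟨X, hX, by simp⟩
    have h1 : T t ⟨⁅H, X⁆, hmem⟩ = 0 := by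
      have : ⁅H, ⁅H, X⁆⁆ + t • ⁅b, ⁅H, X⁆⁆ = 0 := by
        rw [← lie_lie_comm_of_lie_eq_zero hHb, ← lie_smul, ← lie_add, h, lie_zero]
      simpa [T] using this
    exact congrArg Subtype.val ((injective_iff_map_eq_zero _).1 ht _ h1)
  rw [hHX, zero_add] at h
  exact ⟨hHX, (smul_eq_zero.1 h).resolve_left ht0⟩

end IsRiemannian

namespace IsMaxAbelian

variable {A : Submodule ℝ 𝔸}

lemma mem_of_lie_eq_zero (hA : S.IsMaxAbelian A) {X : 𝔸} (hX : X ∈ S.𝔲₁)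
    (h : ∀ b ∈ A, ⁅b, X⁆ = 0) : X ∈ A := by
  have hle : A ⊔ Submodule.span ℝ {X} ≤ S.𝔲₁ :=
    sup_le hA.le ((Submodule.span_singleton_le_iff_mem X S.𝔲₁).2 hX)
  have hab : ∀ V ∈ A ⊔ Submodule.span ℝ {X}, ∀ W ∈ A ⊔ Submodule.span ℝ {X}, ⁅V, W⁆ = 0 := by
    intro V hV W hW
    obtain ⟨v, hv, _, hv', rfl⟩ := Submodule.mem_sup.1 hV
    obtain ⟨w, hw, _, hw', rfl⟩ := Submodule.mem_sup.1 hW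
    obtain ⟨c, rfl⟩ := Submodule.mem_span_singleton.1 hv'
    obtain ⟨d, rfl⟩ := Submodule.mem_span_singleton.1 hw'
    have hXw : ⁅X, w⁆ = 0 := by rw [← lie_skew, h w hw, neg_zero]
    simp only [lie_add, add_lie, hA.abelian v hv w hw, smul_lie, lie_smul, h v hv, hXw, lie_self,
      smul_zero, add_zero]
  rw [← hA.maximal _ hle hab le_sup_left]
  exact Submodule.mem_sup_right (Submodule.mem_span_singleton_self X)

/-- A maximal abelian subspace contains a regular element, one that centralizes no further element
of `𝔲₁`. -/
lemma exists_regular (hB : S.IsRiemannian B) (hA : S.IsMaxAbelian A) :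
    ∃ H ∈ A, ∀ X ∈ S.𝔲₁, ⁅H, X⁆ = 0 → X ∈ A := by
  obtain ⟨s, hs⟩ := (IsNoetherian.noetherian A : A.FG)
  have hsA : ∀ b ∈ s, b ∈ A := fun b hb => hs ▸ Submodule.subset_span hb
  have key : ∀ t : Finset 𝔸, (∀ b ∈ t, b ∈ A) →
      ∃ H ∈ A, ∀ X ∈ S.𝔲₁, ⁅H, X⁆ = 0 → ∀ b ∈ t, ⁅b, X⁆ = 0 := by
    classical
    intro t
    induction t using Finset.induction_on with
    | empty => exact fun _ => ⟨0, A.zero_mem, fun X _ _ b hb => absurd hb (Finset.notMem_empty b)⟩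
    | insert c t _ ih =>
      intro ht
      obtain ⟨H, hH, hH'⟩ := ih fun b hb => ht b (Finset.mem_insert_of_mem hb)
      have hc := ht c (Finset.mem_insert_self c t)
      obtain ⟨r, hr⟩ := hB.exists_perturbation (hA.le hH) (hA.abelian H hH c hc)
      refine ⟨H + r • c, A.add_mem hH (A.smul_mem r hc), fun X hX h b hb => ?_⟩
      obtain ⟨h1, h2⟩ := hr X hX h
      rcases Finset.mem_insert.1 hb with rfl | hb
      · exact h2
      · exact hH' X hX h1 b hb
  obtain ⟨H, hH, hH'⟩ := key s hsA
  refine ⟨H, hH, fun X hX h => hA.mem_of_lie_eq_zero hX fun b hb => ?_⟩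
  rw [← hs] at hb
  induction hb using Submodule.span_induction with
  | mem b hb => exact hH' X hX h b hb
  | zero => exact zero_lie X
  | add b c _ _ h1 h2 => rw [add_lie, h1, h2, add_zero]
  | smul r b _ h1 => rw [smul_lie, h1, smul_zero]

/-- Maximal abelian subspaces are determined by a regular element. -/
lemma eq_of_regular (hA : S.IsMaxAbelian A) {A' : Submodule ℝ 𝔸} (hA' : S.IsMaxAbelian A')
    {H : 𝔸} (hH : H ∈ A') (hreg : ∀ X ∈ S.𝔲₁, ⁅H, X⁆ = 0 → X ∈ A) : A' = A := by
  refine (hA'.maximal A hA.le hA.abelian fun X hX => hreg X (hA'.le hX) ?_).symm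
  exact hA'.abelian H hH X hX

/-- The image of a maximal abelian subspace under `Ad(U₀)` is maximal abelian. -/
lemma map_AdL (hA : S.IsMaxAbelian A) {k : S.G} (hk : k ∈ S.U₀) :
    S.IsMaxAbelian (A.map (S.AdL k).toLinearMap) where
  le := by
    rintro _ ⟨X, hX, rfl⟩
    exact AdL_mem_𝔲₁ hk (hA.le hX)
  abelian := by
    rintro _ ⟨X, hX, rfl⟩ _ ⟨Y, hY, rfl⟩
    change ⁅S.AdL k X, S.AdL k Y⁆ = 0
    rw [← AdL_lie, hA.abelian X hX Y hY, map_zero]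
  maximal := by
    intro A' hle hab hsub
    have h := hA.maximal (A'.map (S.AdL k⁻¹).toLinearMap) (by
        rintro _ ⟨X, hX, rfl⟩
        exact AdL_mem_𝔲₁ (S.U₀.inv_mem hk) (hle hX)) (by
        rintro _ ⟨X, hX, rfl⟩ _ ⟨Y, hY, rfl⟩
        change ⁅S.AdL k⁻¹ X, S.AdL k⁻¹ Y⁆ = 0
        rw [← AdL_lie, hab X hX Y hY, map_zero]) fun X hX =>
        ⟨S.AdL k X, hsub ⟨X, hX, rfl⟩, S.AdL_inv_apply_AdL k X⟩
    refine le_antisymm (fun X hX => ⟨S.AdL k⁻¹ X, ?_, S.AdL_apply_AdL_inv k X⟩) hsub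
    rw [SetLike.mem_coe, ← h]
    exact ⟨X, hX, rfl⟩

/-- Maximal abelian subspaces of `𝔲₁` are conjugate under `U₀`: for regular `H ∈ A` and `H' ∈ A'`,
a maximum of `k ↦ B(Ad(k) H, H')` on the compact group `Ad(U₀)` makes `Ad(k) H` commute with
`H'`. -/
lemma exists_map_AdL_eq (hB : S.IsRiemannian B) (hA : S.IsMaxAbelian A) {A' : Submodule ℝ 𝔸}
    (hA' : S.IsMaxAbelian A') : ∃ k ∈ S.U₀, A' = A.map (S.AdL k).toLinearMap := by
  obtain ⟨H, hH, hreg⟩ := exists_regular hB hA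
  obtain ⟨H', hH', hreg'⟩ := exists_regular hB hA'
  let h : S.𝔲 := ⟨H, mem_𝔲_of_mem_𝔲₁ (hA.le hH)⟩
  let b : 𝔸 →L[ℝ] ℝ := LinearMap.toContinuousLinearMap (B.flip H')
  have hb : ∀ X, b X = B X H' := fun X => rfl
  have hcont : Continuous fun L : S.𝔲 →L[ℝ] 𝔸 => b (L h) :=
    b.continuous.comp (ContinuousLinearMap.apply ℝ 𝔸 h).continuous
  obtain ⟨L, ⟨k, hk, hL⟩, hmax⟩ := hB.isCompact_Ad.exists_isMaxOn
    ⟨_, 1, S.U₀.one_mem, fun X => (by rw [Ad_eq, AdL_one]; rfl : S.𝔲.subtypeL X = S.Ad 1 X)⟩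
    hcont.continuousOn
  have hLk : ∀ k' ∈ S.U₀, B (S.AdL k' H) H' ≤ B (S.AdL k H) H' := by
    intro k' hk'
    have h1 := hmax (a := (S.AdL k').comp S.𝔲.subtypeL) ⟨k', hk', fun X => (S.Ad_eq k' X).symm⟩
    have h2 : L h = S.AdL k H := by rw [hL, Ad_eq]
    simp only [Set.mem_ofPred_eq, hb, h2] at h1
    exact h1
  have hkH : S.AdL k H ∈ S.𝔲₁ := AdL_mem_𝔲₁ hk (hA.le hH)
  have hcomm : ⁅S.AdL k H, H'⁆ = 0 := by
    refine hB.eq_zero_of_mem_𝔲₀ (lie_mem_𝔲₀_of_𝔲₁_𝔲₁ hkH (hA'.le hH')) fun Z hZ => ?_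
    have hd := b.hasFDerivAt.comp_hasDerivAt (0 : ℝ) (hasDerivAt_exp_conj Z (S.AdL k H) 0)
    have hlm : IsLocalMax (b ∘ fun t : ℝ => exp (t • Z) * S.AdL k H * exp (-(t • Z))) 0 := by
      refine Filter.Eventually.of_forall fun t => ?_
      have htZ := S.𝔲₀.smul_mem t hZ
      obtain ⟨g, hg⟩ := S.exists_val_eq_exp (mem_𝔤_of_mem_𝔲 (mem_𝔲_of_mem_𝔲₀ htZ))
      simp only [Function.comp_apply, hb]
      rw [← AdL_apply_of_val_eq_exp hg, ← AdL_mul_apply]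
      simpa using hLk (g * k) (S.U₀.mul_mem (mem_U₀_of_val_eq_exp htZ hg) hk)
    have h0 := hlm.hasDerivAt_eq_zero hd
    simp only [zero_smul, NormedSpace.exp_zero, neg_zero, one_mul, mul_one, hb] at h0
    have hH'𝔲 : H' ∈ S.𝔲 := (hA'.le hH').1
    rw [hB.lie_left hkH.1 hH'𝔲 hZ.1, ← lie_skew, map_neg, neg_neg,
      hB.symm _ hH'𝔲 _ (lie_mem_𝔲 hZ.1 hkH.1), h0]
  refine ⟨k, hk, ?_⟩
  have hmem : S.AdL k H ∈ A' := hreg' _ hkH (by rw [← lie_skew, hcomm, neg_zero])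
  refine eq_of_regular (hA.map_AdL hk) hA' hmem fun X hX h => ⟨S.AdL k⁻¹ X, ?_,
    S.AdL_apply_AdL_inv k X⟩
  refine hreg _ (AdL_mem_𝔲₁ (S.U₀.inv_mem hk) hX) ?_
  rw [← S.AdL_inv_apply_AdL k H, ← AdL_lie, h, map_zero]

end IsMaxAbelian

end SymmetricPair

/-! ### Regular elements and polar coordinates in `𝔲₁` -/

namespace SymmetricPair

variable {𝔸 : Type*} [NormedRing 𝔸] [NormedAlgebra ℂ 𝔸] [FiniteDimensional ℂ 𝔸]
variable {S : SymmetricPair 𝔸} [CompleteSpace 𝔸] {B : LinearMap.BilinForm ℝ 𝔸}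

/-- The orthogonal complement `𝔲₁ ∩ A^⊥`. -/
def perp (S : SymmetricPair 𝔸) (B : LinearMap.BilinForm ℝ 𝔸) (A : Submodule ℝ 𝔸) :
    Submodule ℝ 𝔸 where
  carrier := {X | X ∈ S.𝔲₁ ∧ ∀ b ∈ A, B X b = 0}
  add_mem' := fun hX hY => ⟨add_mem hX.1 hY.1, fun b hb => by
    rw [map_add, LinearMap.add_apply, hX.2 b hb, hY.2 b hb, add_zero]⟩
  zero_mem' := ⟨zero_mem _, fun b _ => by rw [map_zero, LinearMap.zero_apply]⟩
  smul_mem' := fun c X hX => ⟨S.𝔲₁.smul_mem c hX.1, fun b hb => by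
    rw [map_smul, LinearMap.smul_apply, hX.2 b hb, smul_zero]⟩

/-- The centralizer of `A` in `𝔲₀`, the Lie algebra of the isotropy group of a generic point. -/
def cent (S : SymmetricPair 𝔸) (A : Submodule ℝ 𝔸) : Submodule ℝ 𝔸 where
  carrier := {W | W ∈ S.𝔲₀ ∧ ∀ b ∈ A, ⁅b, W⁆ = 0}
  add_mem' := fun hX hY => ⟨add_mem hX.1 hY.1, fun b hb => by
    rw [lie_add, hX.2 b hb, hY.2 b hb, add_zero]⟩
  zero_mem' := ⟨zero_mem _, fun b _ => lie_zero b⟩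
  smul_mem' := fun c X hX => ⟨S.𝔲₀.smul_mem c hX.1, fun b hb => by
    rw [lie_smul, hX.2 b hb, smul_zero]⟩

lemma lie_mem_cent {A : Submodule ℝ 𝔸} {V W : 𝔸} (hV : V ∈ S.cent A) (hW : W ∈ S.cent A) :
    ⁅V, W⁆ ∈ S.cent A := by
  refine ⟨lie_mem_𝔲₀_of_𝔲₀_𝔲₀ hV.1 hW.1, fun b hb => ?_⟩
  rw [leibniz_lie, hV.2 b hb, hW.2 b hb, zero_lie, lie_zero, add_zero]

namespace IsMaxAbelian

variable {A : Submodule ℝ 𝔸}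

lemma lie_mem_perp (hB : S.IsRiemannian B) (hA : S.IsMaxAbelian A) {b W : 𝔸} (hb : b ∈ A)
    (hW : W ∈ S.𝔲₀) : ⁅b, W⁆ ∈ S.perp B A := by
  refine ⟨lie_mem_𝔲₁_of_𝔲₁_𝔲₀ (hA.le hb) hW, fun c hc => ?_⟩
  rw [hB.lie_left (hA.le hb).1 hW.1 (hA.le hc).1, hA.abelian b hb c hc, map_zero, neg_zero]

lemma lie_lie_mem_perp (hB : S.IsRiemannian B) (hA : S.IsMaxAbelian A) {b c X : 𝔸} (hb : b ∈ A)
    (hc : c ∈ A) (hX : X ∈ S.𝔲₁) : ⁅b, ⁅c, X⁆⁆ ∈ S.perp B A :=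
  lie_mem_perp hB hA hb (lie_mem_𝔲₀_of_𝔲₁_𝔲₁ (hA.le hc) hX)

lemma lie_lie_comm (hA : S.IsMaxAbelian A) {b c : 𝔸} (hb : b ∈ A) (hc : c ∈ A) (X : 𝔸) :
    ⁅b, ⁅c, X⁆⁆ = ⁅c, ⁅b, X⁆⁆ :=
  lie_lie_comm_of_lie_eq_zero (hA.abelian b hb c hc)

end IsMaxAbelian

namespace IsRiemannian

variable {A : Submodule ℝ 𝔸}

lemma eq_zero_of_mem_perp (hB : S.IsRiemannian B) {X : 𝔸} (hX : X ∈ S.perp B A) (h : X ∈ A) :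
    X = 0 :=
  hB.eq_zero_of_mem_𝔲₁ hX.1 (hX.2 X h)

/-- An element of `𝔲₀` that commutes with a regular element of `A` commutes with all of `A`. -/
lemma mem_cent_of_lie_eq_zero (hB : S.IsRiemannian B) (hA : S.IsMaxAbelian A) {H : 𝔸}
    (hH : H ∈ A) (hreg : ∀ X ∈ S.𝔲₁, ⁅H, X⁆ = 0 → X ∈ A) {W : 𝔸} (hW : W ∈ S.𝔲₀)
    (h : ⁅H, W⁆ = 0) : W ∈ S.cent A := by
  refine ⟨hW, fun b hb => ?_⟩
  have hp := hA.lie_mem_perp hB hb hW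
  exact hB.eq_zero_of_mem_perp hp (hreg _ hp.1 (by rw [hA.lie_lie_comm hH hb, h, lie_zero]))

end IsRiemannian

section Basis

variable {n : ℕ} {A : Submodule ℝ 𝔸} {a : Fin n → 𝔸}

/-- The orthogonal projection `X ↦ ∑ i, B(X, a_i) a_i` onto the span of an orthonormal family. -/
noncomputable def proj (B : LinearMap.BilinForm ℝ 𝔸) (a : Fin n → 𝔸) : 𝔸 →L[ℝ] 𝔸 :=
  LinearMap.toContinuousLinearMap (∑ i, (B.flip (a i)).smulRight (a i))

lemma proj_apply (X : 𝔸) : proj B a X = ∑ i, B X (a i) • a i := by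
  simp [proj]

lemma mem_of_span_eq (ha : Submodule.span ℝ (Set.range a) = A) (i : Fin n) : a i ∈ A :=
  ha ▸ Submodule.subset_span ⟨i, rfl⟩

lemma proj_mem (ha : Submodule.span ℝ (Set.range a) = A) (X : 𝔸) : proj B a X ∈ A := by
  rw [proj_apply]
  exact sum_mem fun i _ => A.smul_mem _ (mem_of_span_eq ha i)

lemma proj_of_mem (ha : Submodule.span ℝ (Set.range a) = A)
    (ho : ∀ i j, B (a i) (a j) = if i = j then 1 else 0) {X : 𝔸} (hX : X ∈ A) :
    proj B a X = X := by
  rw [← ha] at hX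
  induction hX using Submodule.span_induction with
  | mem _ h => obtain ⟨i, rfl⟩ := h; simp [proj_apply, ho]
  | zero => exact map_zero _
  | add X Y _ _ h1 h2 => rw [map_add, h1, h2]
  | smul r X _ h1 => rw [map_smul, h1]

lemma sub_proj_mem_perp (hA : S.IsMaxAbelian A) (ha : Submodule.span ℝ (Set.range a) = A)
    (ho : ∀ i j, B (a i) (a j) = if i = j then 1 else 0) {X : 𝔸} (hX : X ∈ S.𝔲₁) :
    X - proj B a X ∈ S.perp B A := by
  refine ⟨sub_mem hX (hA.le (proj_mem ha X)), fun b hb => ?_⟩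
  rw [← ha] at hb
  induction hb using Submodule.span_induction with
  | mem _ h =>
    obtain ⟨j, rfl⟩ := h
    simp [proj_apply, ho]
  | zero => exact map_zero _
  | add X Y _ _ h1 h2 => rw [map_add, h1, h2, add_zero]
  | smul r X _ h1 => rw [map_smul, h1, smul_zero]

/-- For regular `H ∈ A`, the operator `-(ad H)²` on `𝔲₁ ∩ A^⊥`, extended by the identity to `A` and
to a complement of `𝔲₁`, is invertible. -/
lemma exists_equiv (hB : S.IsRiemannian B) (hA : S.IsMaxAbelian A)
    (ha : Submodule.span ℝ (Set.range a) = A)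
    (ho : ∀ i j, B (a i) (a j) = if i = j then 1 else 0) {H : 𝔸}
    (hH : H ∈ A) (hreg : ∀ X ∈ S.𝔲₁, ⁅H, X⁆ = 0 → X ∈ A) :
    ∃ (D : 𝔸 ≃L[ℝ] 𝔸) (π : 𝔸 →L[ℝ] 𝔸), (∀ X, π X ∈ S.𝔲₁) ∧ (∀ X ∈ S.𝔲₁, π X = X) ∧
      ∀ X, D X = -⁅H, ⁅H, π X⁆⁆ + proj B a (π X) + (X - π X) := by
  have : FiniteDimensional ℝ 𝔸 := FiniteDimensional.complexToReal 𝔸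
  obtain ⟨p, hp⟩ := S.𝔲₁.subtype.exists_leftInverse_of_injective
    (LinearMap.ker_eq_bot.2 S.𝔲₁.injective_subtype)
  let π : 𝔸 →L[ℝ] 𝔸 := LinearMap.toContinuousLinearMap (S.𝔲₁.subtype ∘ₗ p)
  have hπ : ∀ X, π X ∈ S.𝔲₁ := fun X => (p X).2
  have hπ' : ∀ X ∈ S.𝔲₁, π X = X := fun X hX =>
    congrArg Subtype.val (DFunLike.congr_fun hp (⟨X, hX⟩ : S.𝔲₁))
  let D₀ : 𝔸 →L[ℝ] 𝔸 := -(adL H).comp ((adL H).comp π) + (proj B a).comp π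
    + (ContinuousLinearMap.id ℝ 𝔸 - π)
  have hD₀ : ∀ X, D₀ X = -⁅H, ⁅H, π X⁆⁆ + proj B a (π X) + (X - π X) := fun X => by simp [D₀]
  have hinj : Function.Injective D₀.toLinearMap := by
    rw [injective_iff_map_eq_zero]
    intro X hX
    change D₀ X = 0 at hX
    rw [hD₀] at hX
    have hPp := hA.lie_lie_mem_perp hB hH hH (hπ X)
    have hm : -⁅H, ⁅H, π X⁆⁆ + proj B a (π X) ∈ S.𝔲₁ :=
      add_mem (neg_mem hPp.1) (hA.le (proj_mem ha _))
    have h1 : X - π X = 0 := by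
      have h2 : X - π X ∈ S.𝔲₁ := by
        rw [eq_neg_of_add_eq_zero_right hX]; exact neg_mem hm
      have h3 : π (X - π X) = 0 := by rw [map_sub, hπ' _ (hπ X), sub_self]
      rwa [hπ' _ h2] at h3
    rw [h1, add_zero] at hX
    have h4 : ⁅H, ⁅H, π X⁆⁆ = 0 := by
      refine hB.eq_zero_of_mem_perp hPp ?_
      rw [neg_add_eq_zero.1 hX]
      exact proj_mem ha _
    have h5 : π X ∈ A := hreg _ (hπ X) (hB.lie_eq_zero_of_mem_𝔲₁ (hA.le hH) (hπ X) h4)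
    rw [h4, neg_zero, zero_add, proj_of_mem ha ho h5] at hX
    rwa [hX, sub_zero] at h1
  refine ⟨(LinearEquiv.ofInjectiveEndo D₀.toLinearMap hinj).toContinuousLinearEquiv, π, hπ, hπ',
    fun X => ?_⟩
  rw [← hD₀]; rfl

/-- `(ad H)²` is invertible on `𝔲₁ ∩ A^⊥` for regular `H ∈ A`. -/
lemma exists_inverse_ad_sq (hB : S.IsRiemannian B) (hA : S.IsMaxAbelian A)
    (ha : Submodule.span ℝ (Set.range a) = A)
    (ho : ∀ i j, B (a i) (a j) = if i = j then 1 else 0) {H : 𝔸}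
    (hH : H ∈ A) (hreg : ∀ X ∈ S.𝔲₁, ⁅H, X⁆ = 0 → X ∈ A) :
    ∃ Γ : 𝔸 →L[ℝ] 𝔸, ∀ Y ∈ S.perp B A, Γ Y ∈ S.perp B A ∧ ⁅H, ⁅H, Γ Y⁆⁆ = Y := by
  obtain ⟨D, π, hπ, hπ', hD⟩ := exists_equiv hB hA ha ho hH hreg
  refine ⟨-(D.symm : 𝔸 →L[ℝ] 𝔸), fun Y hY => ?_⟩
  obtain ⟨X, rfl⟩ : ∃ X, D X = Y := ⟨D.symm Y, D.apply_symm_apply Y⟩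
  have hs : (-(D.symm : 𝔸 →L[ℝ] 𝔸)) (D X) = -X := by simp
  rw [hs]
  have h0 := hD X
  have hPp := hA.lie_lie_mem_perp hB hH hH (hπ X)
  have h1 : X - π X ∈ S.𝔲₁ := by
    rw [← sub_eq_iff_eq_add'.2 h0]
    exact sub_mem hY.1 (add_mem (neg_mem hPp.1) (hA.le (proj_mem ha _)))
  have h2 : X - π X = 0 := by
    have h3 : π (X - π X) = 0 := by rw [map_sub, hπ' _ (hπ X), sub_self]
    rwa [hπ' _ h1] at h3
  rw [h2, add_zero] at h0
  have h4 : proj B a (π X) = 0 := by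
    refine hB.eq_zero_of_mem_perp (A := A) ?_ (proj_mem ha _)
    rw [← sub_eq_iff_eq_add'.2 h0]
    exact sub_mem hY (neg_mem hPp)
  rw [h4, add_zero] at h0
  rw [← sub_eq_zero.1 h2] at h4 h0
  have h5 : X ∈ S.perp B A := by
    have := sub_proj_mem_perp hA ha ho (hπ X)
    rwa [← sub_eq_zero.1 h2, h4, sub_zero] at this
  exact ⟨neg_mem h5, by rw [h0, lie_neg, lie_neg]⟩

/-- Regularity is an open condition on `A`. -/
lemma eventually_regular (hB : S.IsRiemannian B) (hA : S.IsMaxAbelian A)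
    (ha : Submodule.span ℝ (Set.range a) = A)
    (ho : ∀ i j, B (a i) (a j) = if i = j then 1 else 0) {H : 𝔸}
    (hreg : ∀ X ∈ S.𝔲₁, ⁅H, X⁆ = 0 → X ∈ A) :
    ∀ᶠ Y in 𝓝 H, Y ∈ A → ∀ X ∈ S.𝔲₁, ⁅Y, X⁆ = 0 → X ∈ A := by
  let T : 𝔸 → S.perp B A →L[ℝ] 𝔸 := fun Y => (adL Y).comp (S.perp B A).subtypeL
  have hT : Continuous T := by
    have h1 : Continuous fun Y : 𝔸 => adL Y := by
      unfold adL; fun_prop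
    exact h1.clm_comp continuous_const
  have h0 : Function.Injective (T H) := by
    rw [injective_iff_map_eq_zero]
    rintro ⟨X, hX⟩ h
    have h' : ⁅H, X⁆ = 0 := by simpa [T] using h
    exact Subtype.ext (hB.eq_zero_of_mem_perp hX (hreg X hX.1 h'))
  have hev : ∀ᶠ Y in 𝓝 H, Function.Injective (T Y) :=
    hT.continuousAt.eventually (ContinuousLinearMap.isOpen_injective.mem_nhds h0)
  filter_upwards [hev] with Y hY hYA X hX h
  have hp := sub_proj_mem_perp hA ha ho hX
  have h1 : T Y ⟨_, hp⟩ = 0 := by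
    have : ⁅Y, X - proj B a X⁆ = 0 := by
      rw [lie_sub, h, hA.abelian Y hYA _ (proj_mem ha X), sub_zero]
    simpa [T] using this
  have h2 : X - proj B a X = 0 :=
    congrArg Subtype.val ((injective_iff_map_eq_zero _).1 hY _ h1)
  rw [sub_eq_zero.1 h2]
  exact proj_mem ha X

/-- Near a regular `H ∈ A`, every `X ∈ 𝔲₁` is of the form `Ad(exp Z) Y`, with `Z ∈ 𝔲₀` depending
analytically on `X` and `Y ∈ A` regular: the polar map `([H, X], Y) ↦ Ad(exp [H, X]) Y` is a local
diffeomorphism. -/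
lemma exists_polar (hB : S.IsRiemannian B) (hA : S.IsMaxAbelian A)
    (ha : Submodule.span ℝ (Set.range a) = A)
    (ho : ∀ i j, B (a i) (a j) = if i = j then 1 else 0) {H : 𝔸}
    (hH : H ∈ A) (hreg : ∀ X ∈ S.𝔲₁, ⁅H, X⁆ = 0 → X ∈ A) :
    ∃ Z Y : 𝔸 → 𝔸, ContDiffAt ℝ ω Z H ∧ Z H = 0 ∧ ∀ᶠ X in 𝓝 H, X ∈ S.𝔲₁ →
      Z X ∈ S.𝔲₀ ∧ Y X ∈ A ∧ exp (Z X) * Y X * exp (-Z X) = X ∧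
      ∀ V ∈ S.𝔲₁, ⁅Y X, V⁆ = 0 → V ∈ A := by
  obtain ⟨D, π, hπ, hπ', hD⟩ := exists_equiv hB hA ha ho hH hreg
  let ζ : 𝔸 →L[ℝ] 𝔸 := (adL H).comp π
  let η : 𝔸 →L[ℝ] 𝔸 := (proj B a).comp π
  have hζ : ∀ X, ζ X = ⁅H, π X⁆ := fun X => by simp [ζ]
  have hη : ∀ X, η X = proj B a (π X) := fun X => rfl
  let Φ : 𝔸 → 𝔸 := fun X => exp (ζ X) * (H + η X) * exp (-ζ X) + (X - π X)
  have hexp : ContDiff ℝ ω (exp : 𝔸 → 𝔸) := contDiff_exp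
  have hsm : ContDiff ℝ ω Φ :=
    (((hexp.comp ζ.contDiff).mul (contDiff_const.add η.contDiff)).mul
      (hexp.comp ζ.contDiff.neg)).add (contDiff_id.sub π.contDiff)
  have hexp0 : HasFDerivAt (exp : 𝔸 → 𝔸) (1 : 𝔸 →L[ℝ] 𝔸) (ζ 0) := by
    simpa using hasFDerivAt_exp_zero (𝕂 := ℝ) (𝔸 := 𝔸)
  have hexp0' : HasFDerivAt (exp : 𝔸 → 𝔸) (1 : 𝔸 →L[ℝ] 𝔸) (-ζ 0) := by
    simpa using hasFDerivAt_exp_zero (𝕂 := ℝ) (𝔸 := 𝔸)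
  have hd : HasFDerivAt Φ (D : 𝔸 →L[ℝ] 𝔸) 0 := by
    have h1 := (((hexp0.comp 0 ζ.hasFDerivAt).mul' (η.hasFDerivAt.const_add H)).mul'
      (hexp0'.comp 0 ζ.hasFDerivAt.neg)).add ((hasFDerivAt_id (𝕜 := ℝ) (0 : 𝔸)).sub π.hasFDerivAt)
    refine h1.congr_fderiv ?_
    ext X
    simp only [ContinuousLinearEquiv.coe_coe, hD]
    simp [hζ, hη, Ring.lie_def]
    abel
  have hΦ0 : Φ 0 = H := by simp [Φ]
  have hsm0 : ContDiffAt ℝ ω Φ 0 := hsm.contDiffAt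
  let Ψ := hsm0.localInverse hd (by simp)
  have hΨ : ContDiffAt ℝ ω Ψ H := by
    have := hsm0.to_localInverse hd (by simp)
    rwa [hΦ0] at this
  have hΨH : Ψ H = 0 := by
    have := hsm0.localInverse_apply_image hd (by simp)
    rwa [hΦ0] at this
  have hinv : ∀ᶠ X in 𝓝 H, Φ (Ψ X) = X := by
    have := (hsm0.hasStrictFDerivAt' hd (by simp)).eventually_right_inverse
    rw [hΦ0] at this
    exact this
  have hcont : Filter.Tendsto (fun X => H + η (Ψ X)) (𝓝 H) (𝓝 H) := by
    have h1 : ContinuousAt (fun X => H + η (Ψ X)) H :=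
      continuousAt_const.add (η.continuous.continuousAt.comp hΨ.continuousAt)
    simpa [ContinuousAt, hΨH] using h1
  refine ⟨fun X => ζ (Ψ X), fun X => H + η (Ψ X), ζ.contDiff.contDiffAt.comp H hΨ, by
    simp [hΨH], ?_⟩
  filter_upwards [hinv, hcont.eventually (eventually_regular hB hA ha ho hreg)] with X h1 h2 hX
  have hZ : ζ (Ψ X) ∈ S.𝔲₀ := by
    rw [hζ]; exact lie_mem_𝔲₀_of_𝔲₁_𝔲₁ (hA.le hH) (hπ _)
  have hY : H + η (Ψ X) ∈ A := add_mem hH (proj_mem ha _)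
  refine ⟨hZ, hY, ?_, h2 hY⟩
  obtain ⟨g, hg⟩ := S.exists_val_eq_exp (mem_𝔤_of_mem_𝔲 hZ.1)
  have hm : exp (ζ (Ψ X)) * (H + η (Ψ X)) * exp (-ζ (Ψ X)) ∈ S.𝔲₁ := by
    rw [← AdL_apply_of_val_eq_exp hg]
    exact AdL_mem_𝔲₁ (mem_U₀_of_val_eq_exp hZ hg) (hA.le hY)
  have h3 : Ψ X - π (Ψ X) ∈ S.𝔲₁ := by
    have : Ψ X - π (Ψ X) = X - exp (ζ (Ψ X)) * (H + η (Ψ X)) * exp (-ζ (Ψ X)) := by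
      rw [eq_sub_iff_add_eq']; exact h1
    rw [this]; exact sub_mem hX hm
  have h4 : Ψ X - π (Ψ X) = 0 := by
    have h3' : π (Ψ X - π (Ψ X)) = 0 := by rw [map_sub, hπ' _ (hπ _), sub_self]
    rwa [hπ' _ h3] at h3'
  have h5 : exp (ζ (Ψ X)) * (H + η (Ψ X)) * exp (-ζ (Ψ X)) + (Ψ X - π (Ψ X)) = X := h1
  rwa [h4, add_zero] at h5

end Basis

end SymmetricPair

/-! ### Coordinate forms and the map `ψ` -/

section OneForm

variable {𝔸 : Type*} [NormedRing 𝔸] [NormedAlgebra ℂ 𝔸] {n : ℕ}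

/-- The `1`-form `∑ i, α_i dx_i` at a point of `ℝⁿ`. -/
noncomputable def oneForm (α : Fin n → 𝔸) : EuclideanSpace ℝ (Fin n) →L[ℝ] 𝔸 :=
  ∑ i, (EuclideanSpace.proj i : EuclideanSpace ℝ (Fin n) →L[ℝ] ℝ).smulRight (α i)

lemma oneForm_apply (α : Fin n → 𝔸) (w : EuclideanSpace ℝ (Fin n)) :
    oneForm α w = ∑ i, w i • α i := by
  simp [oneForm]

@[simp] lemma oneForm_single (α : Fin n → 𝔸) (i : Fin n) :
    oneForm α (EuclideanSpace.single i 1) = α i := by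
  simp [oneForm_apply]

lemma clm_ext_single {F : Type*} [NormedAddCommGroup F] [NormedSpace ℝ F]
    {L M : EuclideanSpace ℝ (Fin n) →L[ℝ] F}
    (h : ∀ i, L (EuclideanSpace.single i 1) = M (EuclideanSpace.single i 1)) : L = M := by
  refine ContinuousLinearMap.coe_injective ?_
  refine (EuclideanSpace.basisFun (Fin n) ℝ).toBasis.ext fun i => ?_
  simpa using h i

lemma eq_oneForm (L : EuclideanSpace ℝ (Fin n) →L[ℝ] 𝔸) :
    L = oneForm fun i => L (EuclideanSpace.single i 1) :=
  clm_ext_single fun i => by simp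

lemma contDiffOn_oneForm {α : Fin n → EuclideanSpace ℝ (Fin n) → 𝔸}
    {s : Set (EuclideanSpace ℝ (Fin n))} (h : ∀ i, ContDiffOn ℝ ∞ (α i) s) :
    ContDiffOn ℝ ∞ (fun x => oneForm fun i => α i x) s := by
  refine ContDiffOn.sum fun i _ => ?_
  exact (ContinuousLinearMap.smulRightL ℝ (EuclideanSpace ℝ (Fin n)) 𝔸
    (EuclideanSpace.proj i)).contDiff.comp_contDiffOn (h i)

lemma fderiv_oneForm {α : Fin n → EuclideanSpace ℝ (Fin n) → 𝔸} {x : EuclideanSpace ℝ (Fin n)}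
    (h : ∀ i, DifferentiableAt ℝ (α i) x) (u w : EuclideanSpace ℝ (Fin n)) :
    fderiv ℝ (fun x => oneForm fun i => α i x) x u w = ∑ i, w i • fderiv ℝ (α i) x u := by
  have h1 : HasFDerivAt (fun x => oneForm fun i => α i x)
      (∑ i, (ContinuousLinearMap.smulRightL ℝ (EuclideanSpace ℝ (Fin n)) 𝔸
        (EuclideanSpace.proj i)).comp (fderiv ℝ (α i) x)) x :=
    HasFDerivAt.fun_sum fun i _ => (ContinuousLinearMap.smulRightL ℝ (EuclideanSpace ℝ (Fin n)) 𝔸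
      (EuclideanSpace.proj i)).hasFDerivAt.comp x (h i).hasFDerivAt
  rw [h1.fderiv]
  simp

lemma sum_smul_pd {F : EuclideanSpace ℝ (Fin n) → 𝔸} {x : EuclideanSpace ℝ (Fin n)}
    (u : EuclideanSpace ℝ (Fin n)) :
    fderiv ℝ F x u = ∑ j, u j • SymmetricPair.pd j F x := by
  conv_lhs => rw [eq_oneForm (fderiv ℝ F x), oneForm_apply]
  rfl

/-- The structure equation `dθ + θ ∧ θ = 0` for `θ = ∑ i, α_i dx_i`, from its components. -/
lemma flat_of_pd {α : Fin n → EuclideanSpace ℝ (Fin n) → 𝔸} {x : EuclideanSpace ℝ (Fin n)}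
    (h : ∀ i, DifferentiableAt ℝ (α i) x)
    (hflat : ∀ i j, SymmetricPair.pd j (α i) x - SymmetricPair.pd i (α j) x = ⁅α i x, α j x⁆)
    (u w : EuclideanSpace ℝ (Fin n)) :
    fderiv ℝ (fun x => oneForm fun i => α i x) x u w
      - fderiv ℝ (fun x => oneForm fun i => α i x) x w u
      = oneForm (fun i => α i x) w * oneForm (fun i => α i x) u
        - oneForm (fun i => α i x) u * oneForm (fun i => α i x) w := by
  rw [fderiv_oneForm h, fderiv_oneForm h, oneForm_apply, oneForm_apply]
  have h1 : ∑ i, w i • fderiv ℝ (α i) x u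
      = ∑ i, ∑ j, (w i * u j) • SymmetricPair.pd j (α i) x := by
    refine Finset.sum_congr rfl fun i _ => ?_
    rw [sum_smul_pd, Finset.smul_sum]
    exact Finset.sum_congr rfl fun j _ => smul_smul _ _ _
  have h2 : ∑ i, u i • fderiv ℝ (α i) x w
      = ∑ i, ∑ j, (w i * u j) • SymmetricPair.pd i (α j) x := by
    rw [Finset.sum_comm]
    refine Finset.sum_congr rfl fun i _ => ?_
    rw [sum_smul_pd, Finset.smul_sum]
    exact Finset.sum_congr rfl fun j _ => by rw [smul_smul, mul_comm]
  have h3 : (∑ i, w i • α i x) * ∑ i, u i • α i x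
      = ∑ i, ∑ j, (w i * u j) • (α i x * α j x) := by
    rw [Finset.sum_mul_sum]
    exact Finset.sum_congr rfl fun i _ => Finset.sum_congr rfl fun j _ => by
      rw [smul_mul_smul_comm]
  have h4 : (∑ i, u i • α i x) * ∑ i, w i • α i x
      = ∑ i, ∑ j, (w i * u j) • (α j x * α i x) := by
    rw [Finset.sum_mul_sum, Finset.sum_comm]
    exact Finset.sum_congr rfl fun i _ => Finset.sum_congr rfl fun j _ => by
      rw [smul_mul_smul_comm, mul_comm (u j)]
  rw [h1, h2, h3, h4, ← Finset.sum_sub_distrib, ← Finset.sum_sub_distrib]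
  refine Finset.sum_congr rfl fun i _ => ?_
  rw [← Finset.sum_sub_distrib, ← Finset.sum_sub_distrib]
  refine Finset.sum_congr rfl fun j _ => ?_
  rw [← smul_sub, ← smul_sub, hflat i j, Ring.lie_def]

end OneForm

namespace SymmetricPair

variable {𝔸 : Type*} [NormedRing 𝔸] [NormedAlgebra ℂ 𝔸] [FiniteDimensional ℂ 𝔸]
variable {S : SymmetricPair 𝔸} [CompleteSpace 𝔸] {B : LinearMap.BilinForm ℝ 𝔸}

section

variable {E : Type*} [NormedAddCommGroup E] [NormedSpace ℝ E]

lemma HasLogDerivAt.hasFDerivAt_AdL {f : E → S.G} {α : E →L[ℝ] 𝔸} {x : E}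
    (hf : S.HasLogDerivAt f α x) {w : E → 𝔸} {w' : E →L[ℝ] 𝔸} (hw : HasFDerivAt w w' x) :
    HasFDerivAt (fun y => S.AdL (f y) (w y))
      ((S.AdL (f x)).comp (w' - (adL (w x)).comp α)) x := by
  have h := (hf.hasFDerivAt.mul' hw).mul' hf.inv.hasFDerivAt
  have h1 : (fun y => S.AdL (f y) (w y)) = fun y => S.val (f y) * w y * S.val (f y)⁻¹ :=
    funext fun y => S.AdL_apply _ _
  rw [h1]
  refine h.congr_fderiv ?_
  ext u
  simp [AdL_apply, Ring.lie_def, mul_sub, sub_mul, mul_assoc]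
  abel

end

variable {n : ℕ} {A : Submodule ℝ 𝔸} {a : Fin n → 𝔸}

/-- Integration of a flat `𝔤`-valued `1`-form on a ball of `ℝⁿ`. -/
lemma exists_hasLogDerivAt_oneForm {r : ℝ} (hr : 0 < r)
    {α : Fin n → EuclideanSpace ℝ (Fin n) → 𝔸}
    (hα : ∀ i, ContDiffOn ℝ ∞ (α i) (Metric.ball 0 r))
    (h𝔤 : ∀ x ∈ Metric.ball (0 : EuclideanSpace ℝ (Fin n)) r, ∀ i, α i x ∈ S.𝔤)
    (hflat : ∀ x ∈ Metric.ball (0 : EuclideanSpace ℝ (Fin n)) r, ∀ i j,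
      pd j (α i) x - pd i (α j) x = ⁅α i x, α j x⁆) :
    ∃ F : EuclideanSpace ℝ (Fin n) → S.G, F 0 = 1 ∧
      ContDiffOn ℝ ∞ (fun x => S.val (F x)) (Metric.ball 0 r) ∧
      ∀ x ∈ Metric.ball (0 : EuclideanSpace ℝ (Fin n)) r,
        S.HasLogDerivAt F (oneForm fun i => α i x) x := by
  obtain ⟨F, h0, hF, hF'⟩ := exists_integral_of_flat S.isClosed_G hr (contDiffOn_oneForm hα)
    (fun x hx w h => by
      have : h • oneForm (fun i => α i x) w ∈ S.𝔤 := by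
        rw [oneForm_apply]
        exact S.𝔤ℝ.smul_mem h (S.𝔤ℝ.sum_mem fun i _ => S.𝔤ℝ.smul_mem _ (h𝔤 x hx i))
      obtain ⟨g, hg⟩ := S.exists_val_eq_exp this
      exact ⟨g, g.2, hg⟩)
    (fun x hx u w => flat_of_pd
      (fun i => ((hα i).contDiffAt (Metric.isOpen_ball.mem_nhds hx)).differentiableAt (by simp))
      (hflat x hx) u w)
  have hex : ∀ x, ∃ g : S.G, x ∈ Metric.ball (0 : EuclideanSpace ℝ (Fin n)) r →
      S.val g = F x := by
    intro x
    by_cases hx : x ∈ Metric.ball (0 : EuclideanSpace ℝ (Fin n)) r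
    · obtain ⟨g, hg, h⟩ := (hF' x hx).1
      exact ⟨⟨g, hg⟩, fun _ => h⟩
    · exact ⟨1, fun h => absurd h hx⟩
  choose f hf using hex
  refine ⟨f, S.val_injective ?_, hF.congr hf, fun x hx => ?_⟩
  · rw [hf 0 (Metric.mem_ball_self hr), h0, val_one]
  · have h1 := (hF' x hx).2.congr_of_eventuallyEq
      (Filter.eventually_of_mem (Metric.isOpen_ball.mem_nhds hx) hf)
    exact .of_hasFDerivAt h1 fun w => by rw [hf x hx]; rfl

lemma IsFrame.hasLogDerivAt {Ω : Set (EuclideanSpace ℝ (Fin n))} (hΩ : IsOpen Ω)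
    {v : EuclideanSpace ℝ (Fin n) → 𝔸} {E : EuclideanSpace ℝ (Fin n) → ℂ → S.G}
    (hE : S.IsFrame a Ω v E) (l : ℂ) {x : EuclideanSpace ℝ (Fin n)} (hx : x ∈ Ω) :
    S.HasLogDerivAt (fun y => E y l) (oneForm fun i => l • a i + ⁅a i, v x⁆) x := by
  obtain ⟨α, hα⟩ := exists_hasLogDerivAt (S := S) (f := fun y => E y l)
    (((hE.smooth l).contDiffAt (hΩ.mem_nhds hx)).differentiableAt (by simp))
  convert hα using 1
  refine clm_ext_single fun i => ?_
  rw [oneForm_single]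
  have := hE.eqn l x hx i
  rw [pd, hα.fderiv_apply] at this
  simpa using (congrArg (S.val (E x l)⁻¹ * ·) this).symm

lemma lie_basis_mem_𝔲₀ {Ω : Set (EuclideanSpace ℝ (Fin n))} (hA : S.IsMaxAbelian A)
    (ha : Submodule.span ℝ (Set.range a) = A) {v : EuclideanSpace ℝ (Fin n) → 𝔸}
    (hv : ∀ x ∈ Ω, v x ∈ S.𝔲₁) {x : EuclideanSpace ℝ (Fin n)} (hx : x ∈ Ω) (i : Fin n) :
    ⁅a i, v x⁆ ∈ S.𝔲₀ :=
  lie_mem_𝔲₀_of_𝔲₁_𝔲₁ (hA.le (mem_of_span_eq ha i)) (hv x hx)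

section Frame

variable {Ω : Set (EuclideanSpace ℝ (Fin n))} {v : EuclideanSpace ℝ (Fin n) → 𝔸}
  {E : EuclideanSpace ℝ (Fin n) → ℂ → S.G}

/-- Reality of the frame at `λ = 1`. -/
lemma IsFrame.mem_U (hE : S.IsFrame a Ω v E) (hΩ : IsOpen Ω)
    (hΩ' : IsPreconnected Ω) (h0 : 0 ∈ Ω) (hA : S.IsMaxAbelian A)
    (ha : Submodule.span ℝ (Set.range a) = A) (hv : ∀ x ∈ Ω, v x ∈ S.𝔲₁)
    {x : EuclideanSpace ℝ (Fin n)} (hx : x ∈ Ω) : E x 1 ∈ S.U := by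
  rw [mem_U_iff]
  have := eqOn_of_hasLogDerivAt hΩ hΩ' h0
    (fun x hx => S.isDifferential_τ.hasLogDerivAt (hE.hasLogDerivAt hΩ 1 hx))
    (g := fun y => E y 1) (fun x hx => ?_) x hx
  · simpa [hE.init] using this
  · convert hE.hasLogDerivAt hΩ 1 hx using 1
    refine clm_ext_single fun i => ?_
    rw [ContinuousLinearMap.comp_apply, oneForm_single, one_smul]
    exact (S.mem_𝔲_iff.1 (add_mem (hA.le (mem_of_span_eq ha i)).1
      (lie_basis_mem_𝔲₀ hA ha hv hx i).1)).2

/-- The involution `σ` exchanges the frames at `λ = 1` and `λ = -1`. -/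
lemma IsFrame.σ_apply (hE : S.IsFrame a Ω v E) (hΩ : IsOpen Ω)
    (hΩ' : IsPreconnected Ω) (h0 : 0 ∈ Ω) (hA : S.IsMaxAbelian A)
    (ha : Submodule.span ℝ (Set.range a) = A) (hv : ∀ x ∈ Ω, v x ∈ S.𝔲₁)
    {x : EuclideanSpace ℝ (Fin n)} (hx : x ∈ Ω) : S.σ (E x 1) = E x (-1) := by
  have := eqOn_of_hasLogDerivAt hΩ hΩ' h0
    (fun x hx => S.isDifferential_σ.hasLogDerivAt (hE.hasLogDerivAt hΩ 1 hx))
    (g := fun y => E y (-1)) (fun x hx => ?_) x hx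
  · simpa [hE.init] using this
  · convert hE.hasLogDerivAt hΩ (-1) hx using 1
    refine clm_ext_single fun i => ?_
    rw [ContinuousLinearMap.comp_apply, oneForm_single, oneForm_single, one_smul, map_add,
      (S.mem_𝔲₁_iff.1 (hA.le (mem_of_span_eq ha i))).2,
      (S.mem_𝔲₀_iff.1 (lie_basis_mem_𝔲₀ hA ha hv hx i)).2, neg_one_smul]

lemma IsFrame.psi_eq_act (hE : S.IsFrame a Ω v E) (hΩ : IsOpen Ω)
    (hΩ' : IsPreconnected Ω) (h0 : 0 ∈ Ω) (hA : S.IsMaxAbelian A)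
    (ha : Submodule.span ℝ (Set.range a) = A) (hv : ∀ x ∈ Ω, v x ∈ S.𝔲₁)
    {x : EuclideanSpace ℝ (Fin n)} (hx : x ∈ Ω) :
    S.psi E x = S.act (E x 1) 1 := by
  rw [psi, act, hE.σ_apply hΩ hΩ' h0 hA ha hv hx, mul_one]

lemma IsFrame.hasLogDerivAt_psi (hE : S.IsFrame a Ω v E) (hΩ : IsOpen Ω)
    {x : EuclideanSpace ℝ (Fin n)} (hx : x ∈ Ω) :
    S.HasLogDerivAt (S.psi E) ((S.AdL (E x (-1))).comp (oneForm fun i => (2 : ℝ) • a i)) x := by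
  have h := (hE.hasLogDerivAt hΩ 1 hx).mul (hE.hasLogDerivAt hΩ (-1) hx).inv
  have e : (S.AdL (E x (-1))).comp (oneForm fun i => (2 : ℝ) • a i)
      = (S.AdL (E x (-1))⁻¹⁻¹).comp (oneForm fun i => (1 : ℂ) • a i + ⁅a i, v x⁆)
        + -(S.AdL (E x (-1))).comp (oneForm fun i => (-1 : ℂ) • a i + ⁅a i, v x⁆) := by
    refine clm_ext_single fun i => ?_
    simp only [ContinuousLinearMap.comp_apply, oneForm_single, add_apply, neg_apply, inv_inv]
    rw [← map_neg (S.AdL _), ← map_add (S.AdL _)]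
    congr 1
    rw [one_smul, neg_one_smul, two_smul]
    abel
  rw [e]
  exact h

end Frame

lemma oneForm_mem (ha : Submodule.span ℝ (Set.range a) = A) (w : EuclideanSpace ℝ (Fin n)) :
    oneForm a w ∈ A := by
  rw [oneForm_apply]
  exact sum_mem fun i _ => A.smul_mem _ (mem_of_span_eq ha i)

lemma B_oneForm (ho : ∀ i j, B (a i) (a j) = if i = j then 1 else 0)
    (u w : EuclideanSpace ℝ (Fin n)) : B (oneForm a u) (oneForm a w) = inner ℝ u w := by
  simp [oneForm_apply, ho, PiLp.inner_apply, mul_comm]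

lemma oneForm_smul (c : ℝ) (w : EuclideanSpace ℝ (Fin n)) :
    oneForm (fun i => c • a i) w = c • oneForm a w := by
  simp [oneForm_apply, Finset.smul_sum, smul_smul, mul_comm]

lemma exists_oneForm_eq (ha : Submodule.span ℝ (Set.range a) = A) {X : 𝔸} (hX : X ∈ A) :
    ∃ w, oneForm a w = X := by
  rw [← ha] at hX
  obtain ⟨c, rfl⟩ := (Submodule.mem_span_range_iff_exists_fun ℝ).1 hX
  exact ⟨WithLp.toLp 2 c, by simp [oneForm_apply]⟩

lemma hasFDerivAt_flatMap_zero (g : S.G) :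
    HasFDerivAt (S.flatMap g) ((ContinuousLinearMap.mul ℝ 𝔸 (S.val g)).comp
      ((ContinuousLinearMap.mul ℝ 𝔸).flip (S.val (S.σ g)⁻¹))) 0 := by
  have h := ((hasFDerivAt_exp_zero (𝕂 := ℝ) (𝔸 := 𝔸)).const_mul (S.val g)).mul_const'
    (S.val (S.σ g)⁻¹)
  refine HasFDerivAt.congr_fderiv h ?_
  ext X
  simp [mul_assoc]

/-- The map `ψ = E(·, 1) E(·, -1)⁻¹` attached to a solution is a curved flat. -/
theorem isCurvedFlat_psi (hB : S.IsRiemannian B) (hA : S.IsMaxAbelian A)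
    (ha : Submodule.span ℝ (Set.range a) = A)
    (ho : ∀ i j, B (a i) (a j) = if i = j then 1 else 0) {Ω : Set (EuclideanSpace ℝ (Fin n))}
    (hΩ : IsOpen Ω) (hΩ' : IsPreconnected Ω) (h0 : 0 ∈ Ω)
    {v : EuclideanSpace ℝ (Fin n) → 𝔸} {E : EuclideanSpace ℝ (Fin n) → ℂ → S.G}
    (hv : ∀ x ∈ Ω, v x ∈ S.𝔲₁) (hE : S.IsFrame a Ω v E) :
    S.IsCurvedFlat B Ω (S.psi E) := by
  have hU : ∀ x ∈ Ω, E x 1 ∈ S.U := fun x hx => hE.mem_U hΩ hΩ' h0 hA ha hv hx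
  have hσ : ∀ x ∈ Ω, S.σ (E x 1) = E x (-1) := fun x hx => hE.σ_apply hΩ hΩ' h0 hA ha hv hx
  have hU' : ∀ x ∈ Ω, E x (-1) ∈ S.U := fun x hx => hσ x hx ▸ σ_mem_U (hU x hx)
  have hd : ∀ x ∈ Ω, ∀ w, fderiv ℝ (fun y => S.val (S.psi E y)) x w
      = S.val (S.psi E x) * S.AdL (E x (-1)) ((2 : ℝ) • oneForm a w) := fun x hx w => by
    rw [(hE.hasLogDerivAt_psi hΩ hx).fderiv_apply, ContinuousLinearMap.comp_apply, oneForm_smul]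
  have hd' : ∀ x ∈ Ω, ∀ w, S.val (S.psi E x)⁻¹ * fderiv ℝ (fun y => S.val (S.psi E y)) x w
      = S.AdL (E x (-1)) ((2 : ℝ) • oneForm a w) := fun x hx w => by
    rw [hd x hx, val_inv_mul_cancel_left]
  have h𝔲 : ∀ w, (2 : ℝ) • oneForm a w ∈ S.𝔲 := fun w =>
    (S.𝔲₁.smul_mem _ (hA.le (oneForm_mem ha w))).1
  have hmet : ∀ x ∈ Ω, ∀ u w, S.inducedMetric B (S.psi E) x u w = 4 * inner ℝ u w := by
    intro x hx u w
    rw [inducedMetric, hd' x hx, hd' x hx, hB.AdL_invariant (hU' x hx) (h𝔲 u) (h𝔲 w)]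
    simp only [map_smul, LinearMap.smul_apply, B_oneForm ho, smul_eq_mul]
    ring
  refine ⟨fun x hx => ⟨E x 1, hU x hx, hE.psi_eq_act hΩ hΩ' h0 hA ha hv hx⟩, ?_, ?_, ?_, ?_⟩
  · exact (hE.smooth 1).mul (contDiffOn_val_inv (hE.smooth (-1)))
  · intro x hx
    rw [injective_iff_map_eq_zero]
    intro w hw
    have h := hmet x hx w w
    rw [inducedMetric, hw, mul_zero, map_zero] at h
    have h2 : inner ℝ w w = (0 : ℝ) := by linarith
    exact inner_self_eq_zero.1 h2
  · intro x hx
    refine ⟨Ω, subset_rfl, hΩ, hx, fun y => (2 : ℝ) • y, contDiff_id.const_smul (2 : ℝ)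
      |>.contDiffOn, fun z hz u w => ?_⟩
    have h2 : HasFDerivAt (fun y : EuclideanSpace ℝ (Fin n) => (2 : ℝ) • y)
        ((2 : ℝ) • ContinuousLinearMap.id ℝ _) z := (hasFDerivAt_id z).const_smul (2 : ℝ)
    rw [hmet z hz, h2.fderiv]
    simp only [smul_apply, ContinuousLinearMap.id_apply, inner_smul_left,
      inner_smul_right]
    simp
    ring
  · intro x hx
    refine ⟨E x 1, hU x hx, A, hA, 0, A.zero_mem, ?_, ?_⟩
    · rw [flatMap, NormedSpace.exp_zero, mul_one, hσ x hx]; rfl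
    · rw [(hasFDerivAt_flatMap_zero (E x 1)).fderiv]
      have key : ∀ w, fderiv ℝ (fun y => S.val (S.psi E y)) x w
          = S.val (E x 1) * (((2 : ℝ) • oneForm a w) * S.val (S.σ (E x 1))⁻¹) := fun w => by
        rw [hd x hx, hσ x hx, AdL_apply, psi, val_mul]
        simp [mul_assoc]
      ext Y
      constructor
      · rintro ⟨w, rfl⟩
        exact ⟨_, A.smul_mem (2 : ℝ) (oneForm_mem ha w), (key w).symm⟩
      · rintro ⟨X, hX, rfl⟩
        obtain ⟨w, rfl⟩ := exists_oneForm_eq ha hX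
        refine ⟨(2⁻¹ : ℝ) • w, (key _).trans ?_⟩
        rw [map_smul, smul_smul, mul_inv_cancel₀ two_ne_zero, one_smul]
        rfl

end SymmetricPair

/-! ### Decoupling of the structure equations and existence of frames -/

namespace SymmetricPair

variable {𝔸 : Type*} [NormedRing 𝔸] [NormedAlgebra ℂ 𝔸] [FiniteDimensional ℂ 𝔸]
variable {S : SymmetricPair 𝔸} [CompleteSpace 𝔸] {B : LinearMap.BilinForm ℝ 𝔸}
variable {n : ℕ} {A : Submodule ℝ 𝔸} {a : Fin n → 𝔸}

section Algebra

/-- `[𝔲₁, A]` is orthogonal to the centralizer of `A`. -/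
lemma IsRiemannian.lie_orthogonal_cent (hB : S.IsRiemannian B) (hA : S.IsMaxAbelian A)
    {b X W : 𝔸} (hb : b ∈ A) (hX : X ∈ S.𝔲₁) (hW : W ∈ S.cent A) : B ⁅b, X⁆ W = 0 := by
  rw [hB.lie_left (hA.le hb).1 hX.1 hW.1.1, hW.2 b hb, map_zero, neg_zero]

/-- If `W` centralizes `A`, then `ad W` commutes with `ad b` for `b ∈ A`. -/
lemma lie_cent_comm {b W : 𝔸} (hW : W ∈ S.cent A) (hb : b ∈ A) (X : 𝔸) :
    ⁅W, ⁅b, X⁆⁆ = ⁅b, ⁅W, X⁆⁆ :=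
  lie_lie_comm_of_lie_eq_zero (by rw [← lie_skew, hW.2 b hb, neg_zero])

/-- `[[b, X], [c, X]]` is orthogonal to the centralizer of `A`: by invariance, its product with `W`
is `±B(ad W X, T X)` with `T = ad b ad c` symmetric and commuting with the skew map `ad W`. -/
lemma IsRiemannian.lie_lie_orthogonal_cent (hB : S.IsRiemannian B) (hA : S.IsMaxAbelian A)
    {b c X W : 𝔸} (hb : b ∈ A) (hc : c ∈ A) (hX : X ∈ S.𝔲₁) (hW : W ∈ S.cent A) :
    B ⁅⁅b, X⁆, ⁅c, X⁆⁆ W = 0 := by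
  have hb' := (hA.le hb).1
  have hc' := (hA.le hc).1
  have hW' := hW.1.1
  have hX' := hX.1
  have hWX := lie_mem_𝔲 hW' hX'
  have h1 : B ⁅⁅b, X⁆, ⁅c, X⁆⁆ W = -B X ⁅c, ⁅b, ⁅W, X⁆⁆⁆ := by
    rw [hB.lie_left (lie_mem_𝔲 hb' hX') (lie_mem_𝔲 hc' hX') hW', ← lie_skew ⁅b, X⁆ W,
      lie_cent_comm hW hb, map_neg, neg_neg, hB.lie_left hc' hX' (lie_mem_𝔲 hb' hWX)]
  have h2 : B X ⁅c, ⁅b, ⁅W, X⁆⁆⁆ = -B X ⁅c, ⁅b, ⁅W, X⁆⁆⁆ := by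
    have e1 : B X ⁅c, ⁅b, ⁅W, X⁆⁆⁆ = -B ⁅W, X⁆ ⁅c, ⁅b, X⁆⁆ := by
      rw [← lie_cent_comm hW hb, ← lie_cent_comm hW hc,
        hB.lie_right hW' hX' (lie_mem_𝔲 hc' (lie_mem_𝔲 hb' hX'))]
    have e2 : B ⁅W, X⁆ ⁅c, ⁅b, X⁆⁆ = B X ⁅c, ⁅b, ⁅W, X⁆⁆⁆ := by
      rw [hB.lie_right hc' hWX (lie_mem_𝔲 hb' hX'), hB.lie_right hb' (lie_mem_𝔲 hc' hWX) hX',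
        neg_neg, hA.lie_lie_comm hb hc,
        hB.symm _ (lie_mem_𝔲 hc' (lie_mem_𝔲 hb' hWX)) _ hX']
    rw [← e2, ← e1, e2]
  rw [h1]
  linarith

/-- The form is non-degenerate on the centralizer of `A` in `𝔲₀`. -/
lemma IsRiemannian.eq_zero_of_mem_cent (hB : S.IsRiemannian B) (hA : S.IsMaxAbelian A) {H : 𝔸}
    (hH : H ∈ A) (hreg : ∀ X ∈ S.𝔲₁, ⁅H, X⁆ = 0 → X ∈ A) {Γ : 𝔸 →L[ℝ] 𝔸}
    (hΓ : ∀ Y ∈ S.perp B A, Γ Y ∈ S.perp B A ∧ ⁅H, ⁅H, Γ Y⁆⁆ = Y) {Q : 𝔸} (hQ : Q ∈ S.cent A)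
    (h : ∀ W ∈ S.cent A, B Q W = 0) : Q = 0 := by
  refine hB.eq_zero_of_mem_𝔲₀ hQ.1 fun W hW => ?_
  obtain ⟨h1, h2⟩ := hΓ _ (hA.lie_mem_perp hB hH hW)
  have hm : W - ⁅H, Γ ⁅H, W⁆⁆ ∈ S.cent A := by
    refine hB.mem_cent_of_lie_eq_zero hA hH hreg
      (sub_mem hW (lie_mem_𝔲₀_of_𝔲₁_𝔲₁ (hA.le hH) h1.1)) ?_
    rw [lie_sub, h2, sub_self]
  have h3 := h _ hm
  rw [map_sub, hB.lie_right (hA.le hH).1 hQ.1.1 h1.1.1, hQ.2 H hH, map_zero, LinearMap.zero_apply,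
    neg_zero, sub_zero] at h3
  exact h3

/-- If `[u_i, a_j] = [u_j, a_i]`, then `u_i = m_i + [a_i, v]` with `m_i` centralizing `A`. -/
lemma IsRiemannian.sub_lie_mem_cent (hB : S.IsRiemannian B) (hA : S.IsMaxAbelian A)
    (ha : Submodule.span ℝ (Set.range a) = A) {H : 𝔸}
    (hH : H ∈ A) (hreg : ∀ X ∈ S.𝔲₁, ⁅H, X⁆ = 0 → X ∈ A) {Γ : 𝔸 →L[ℝ] 𝔸}
    (hΓ : ∀ Y ∈ S.perp B A, Γ Y ∈ S.perp B A ∧ ⁅H, ⁅H, Γ Y⁆⁆ = Y)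
    {c : EuclideanSpace ℝ (Fin n)} (hc : oneForm a c = H) {u : Fin n → 𝔸}
    (hu : ∀ i, u i ∈ S.𝔲₀) (hsymm : ∀ i j, ⁅a i, u j⁆ = ⁅a j, u i⁆) :
    Γ ⁅H, oneForm u c⁆ ∈ S.perp B A ∧
      ∀ i, u i - ⁅a i, Γ ⁅H, oneForm u c⁆⁆ ∈ S.cent A := by
  have huc : oneForm u c ∈ S.𝔲₀ := by
    rw [oneForm_apply]
    exact sum_mem fun i _ => S.𝔲₀.smul_mem _ (hu i)
  obtain ⟨h1, h2⟩ := hΓ _ (hA.lie_mem_perp hB hH huc)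
  refine ⟨h1, fun i => ?_⟩
  have hi := mem_of_span_eq ha i
  have hW : oneForm u c - ⁅H, Γ ⁅H, oneForm u c⁆⁆ ∈ S.cent A := by
    refine hB.mem_cent_of_lie_eq_zero hA hH hreg
      (sub_mem huc (lie_mem_𝔲₀_of_𝔲₁_𝔲₁ (hA.le hH) h1.1)) ?_
    rw [lie_sub, h2, sub_self]
  refine hB.mem_cent_of_lie_eq_zero hA hH hreg
    (sub_mem (hu i) (lie_mem_𝔲₀_of_𝔲₁_𝔲₁ (hA.le hi) h1.1)) ?_
  have h3 : ⁅H, u i⁆ = ⁅a i, oneForm u c⁆ := by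
    rw [← hc, oneForm_apply, oneForm_apply, sum_lie, lie_sum]
    exact Finset.sum_congr rfl fun j _ => by rw [smul_lie, lie_smul, hsymm j i]
  rw [lie_sub, h3, hA.lie_lie_comm hH hi, ← lie_sub, hW.2 _ hi]

/-- Decoupling of the structure equation of `m_i + [a_i, v]` into that of `m` and the equation of
the `U/U₀`-system for `v`, twisted by `m`. Here `M i j` and `N j` stand for `∂m_i/∂x_j` and
`∂v/∂x_j`. -/
lemma IsRiemannian.decouple (hB : S.IsRiemannian B) (hA : S.IsMaxAbelian A)
    (ha : Submodule.span ℝ (Set.range a) = A) {H : 𝔸}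
    (hH : H ∈ A) (hreg : ∀ X ∈ S.𝔲₁, ⁅H, X⁆ = 0 → X ∈ A) {Γ : 𝔸 →L[ℝ] 𝔸}
    (hΓ : ∀ Y ∈ S.perp B A, Γ Y ∈ S.perp B A ∧ ⁅H, ⁅H, Γ Y⁆⁆ = Y)
    {m N : Fin n → 𝔸} {M : Fin n → Fin n → 𝔸} {v : 𝔸} (hm : ∀ i, m i ∈ S.cent A)
    (hM : ∀ i j, M i j ∈ S.cent A) (hv : v ∈ S.𝔲₁) (hN : ∀ j, N j ∈ S.𝔲₁) (i j : Fin n)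
    (h : M i j + ⁅a i, N j⁆ - (M j i + ⁅a j, N i⁆) = ⁅m i + ⁅a i, v⁆, m j + ⁅a j, v⁆⁆) :
    M i j - M j i = ⁅m i, m j⁆ ∧
      ⁅a i, N j + ⁅m j, v⁆⁆ - ⁅a j, N i + ⁅m i, v⁆⁆ = ⁅⁅a i, v⁆, ⁅a j, v⁆⁆ := by
  have hi := mem_of_span_eq ha i
  have hj := mem_of_span_eq ha j
  have hni : N i + ⁅m i, v⁆ ∈ S.𝔲₁ := add_mem (hN i) (lie_mem_𝔲₁_of_𝔲₀_𝔲₁ (hm i).1 hv)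
  have hnj : N j + ⁅m j, v⁆ ∈ S.𝔲₁ := add_mem (hN j) (lie_mem_𝔲₁_of_𝔲₀_𝔲₁ (hm j).1 hv)
  have hQ : M i j - M j i - ⁅m i, m j⁆ = ⁅a j, N i + ⁅m i, v⁆⁆ - ⁅a i, N j + ⁅m j, v⁆⁆
      + ⁅⁅a i, v⁆, ⁅a j, v⁆⁆ := by
    have e1 : ⁅m i, ⁅a j, v⁆⁆ = ⁅a j, ⁅m i, v⁆⁆ := lie_cent_comm (hm i) hj v
    have e2 : ⁅⁅a i, v⁆, m j⁆ = -⁅a i, ⁅m j, v⁆⁆ := by rw [← lie_skew, lie_cent_comm (hm j) hi v]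
    rw [add_lie, lie_add, lie_add, e1, e2] at h
    rw [lie_add, lie_add]
    rw [sub_eq_iff_eq_add] at h
    rw [sub_sub, sub_eq_iff_eq_add, eq_sub_of_add_eq h]
    abel
  have h0 : M i j - M j i - ⁅m i, m j⁆ = 0 := by
    refine hB.eq_zero_of_mem_cent hA hH hreg hΓ
      (sub_mem (sub_mem (hM i j) (hM j i)) (lie_mem_cent (hm i) (hm j))) fun W hW => ?_
    rw [hQ, map_add, map_sub, LinearMap.add_apply, LinearMap.sub_apply,
      hB.lie_orthogonal_cent hA hj hni hW, hB.lie_orthogonal_cent hA hi hnj hW,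
      hB.lie_lie_orthogonal_cent hA hi hj hv hW, sub_zero, add_zero]
  refine ⟨sub_eq_zero.1 h0, ?_⟩
  rw [h0] at hQ
  rw [sub_eq_iff_eq_add]
  have := congrArg (⁅a i, N j + ⁅m j, v⁆⁆ + ·) hQ
  simp only [add_zero] at this
  rw [this]
  abel

end Algebra

section Calculus

lemma fderiv_mem_submodule {E : Type*} [NormedAddCommGroup E] [NormedSpace ℝ E]
    (W : Submodule ℝ 𝔸) {F : E → 𝔸} {x : E} (h : ∀ᶠ y in 𝓝 x, F y ∈ W) (w : E) :
    fderiv ℝ F x w ∈ W := by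
  have : FiniteDimensional ℝ 𝔸 := FiniteDimensional.complexToReal 𝔸
  by_cases hF : DifferentiableAt ℝ F x
  · have hcl : IsClosed (W : Set 𝔸) := W.closed_of_finiteDimensional
    have h1 : HasDerivAt (fun t : ℝ => x + t • w) w 0 := by
      simpa using ((hasDerivAt_id (0 : ℝ)).smul_const w).const_add x
    have hd : HasFDerivAt F (fderiv ℝ F x) (x + (0 : ℝ) • w) := by
      simpa using hF.hasFDerivAt
    have h2 := (hd.comp_hasDerivAt (0 : ℝ) h1).tendsto_slope
    have hc : Filter.Tendsto (fun t : ℝ => x + t • w) (𝓝[≠] 0) (𝓝 x) := by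
      have := h1.continuousAt.tendsto
      simp only [zero_smul, add_zero] at this
      exact this.mono_left nhdsWithin_le_nhds
    refine hcl.mem_of_tendsto h2 ?_
    filter_upwards [hc.eventually h] with t ht
    simp only [slope, vsub_eq_sub, Function.comp_apply, zero_smul, add_zero]
    exact W.smul_mem _ (sub_mem ht h.self_of_nhds)
  · rw [fderiv_zero_of_not_differentiableAt hF]
    exact W.zero_mem

lemma pd_clm {F : EuclideanSpace ℝ (Fin n) → 𝔸} {x : EuclideanSpace ℝ (Fin n)} (L : 𝔸 →L[ℝ] 𝔸)
    (hF : DifferentiableAt ℝ F x) (i : Fin n) : pd i (fun y => L (F y)) x = L (pd i F x) := by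
  have h : HasFDerivAt (fun y => L (F y)) (L.comp (fderiv ℝ F x)) x :=
    L.hasFDerivAt.comp x hF.hasFDerivAt
  rw [pd, h.fderiv]; rfl

lemma pd_lie {F : EuclideanSpace ℝ (Fin n) → 𝔸} {x : EuclideanSpace ℝ (Fin n)} (b : 𝔸)
    (hF : DifferentiableAt ℝ F x) (i : Fin n) : pd i (fun y => ⁅b, F y⁆) x = ⁅b, pd i F x⁆ := by
  have := pd_clm (adL b) hF i
  simpa only [adL_apply] using this

lemma IsDifferential.apply_eq_self {E : Type*} [NormedAddCommGroup E] [NormedSpace ℝ E]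
    {ρ : S.G →* S.G} {D : 𝔸 →L[ℝ] 𝔸} (hD : S.IsDifferential ρ D) {s : Set E} (hs : IsOpen s)
    (hs' : IsPreconnected s) {x₀ : E} (hx₀ : x₀ ∈ s) {f : E → S.G} {θ : E → E →L[ℝ] 𝔸}
    (hf : ∀ x ∈ s, S.HasLogDerivAt f (θ x) x) (hfix : ∀ x ∈ s, ∀ w, D (θ x w) = θ x w)
    (h0 : f x₀ = 1) {x : E} (hx : x ∈ s) : ρ (f x) = f x := by
  have := eqOn_of_hasLogDerivAt hs hs' hx₀ (fun x hx => hD.hasLogDerivAt (hf x hx)) (g := f)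
    (fun x hx => by
      have e : D.comp (θ x) = θ x := ContinuousLinearMap.ext (hfix x hx)
      rw [e]; exact hf x hx) x hx
  simpa [h0] using this

/-- The Lax `n`-tuple of a solution is flat for every `λ`, hence has a frame. -/
lemma IsSolution.exists_isFrame (hA : S.IsMaxAbelian A) (ha : Submodule.span ℝ (Set.range a) = A)
    {r : ℝ} (hr : 0 < r) {v : EuclideanSpace ℝ (Fin n) → 𝔸}
    (hv : S.IsSolution B A a (Metric.ball 0 r) v) :
    ∃ E : EuclideanSpace ℝ (Fin n) → ℂ → S.G, S.IsFrame a (Metric.ball 0 r) v E := by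
  have hlie : ∀ i, ContDiffOn ℝ ∞ (fun x => ⁅a i, v x⁆) (Metric.ball 0 r) := fun i => by
    simpa only [adL_apply, Function.comp_def] using (adL (a i)).contDiff.comp_contDiffOn hv.smooth
  have hdv : ∀ x ∈ Metric.ball (0 : EuclideanSpace ℝ (Fin n)) r, DifferentiableAt ℝ v x :=
    fun x hx => (hv.smooth.contDiffAt (Metric.isOpen_ball.mem_nhds hx)).differentiableAt (by simp)
  have hpd : ∀ (l : ℂ), ∀ x ∈ Metric.ball (0 : EuclideanSpace ℝ (Fin n)) r, ∀ i j,
      pd j (fun x => l • a i + ⁅a i, v x⁆) x = ⁅a i, pd j v x⁆ := fun l x hx i j => by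
    rw [← pd_lie (a i) (hdv x hx) j, pd, fderiv_const_add]; rfl
  have hex : ∀ l : ℂ, _ := fun l => exists_hasLogDerivAt_oneForm (S := S) hr
    (α := fun i x => l • a i + ⁅a i, v x⁆) (fun i => contDiffOn_const.add (hlie i))
    (fun x hx i => add_mem (S.𝔤.smul_mem l (mem_𝔤_of_mem_𝔲 (hA.le (mem_of_span_eq ha i)).1))
      (mem_𝔤_of_mem_𝔲 (lie_basis_mem_𝔲₀ hA ha hv.mem hx i).1))
    (fun x hx i j => by
      rw [hpd l x hx, hpd l x hx]
      have hij := hA.abelian _ (mem_of_span_eq ha i) _ (mem_of_span_eq ha j)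
      have e : ⁅l • a i + ⁅a i, v x⁆, l • a j + ⁅a j, v x⁆⁆ = ⁅⁅a i, v x⁆, ⁅a j, v x⁆⁆ := by
        simp only [add_lie, lie_add, smul_lie, lie_smul, hij, smul_zero, zero_add]
        rw [← lie_skew ⁅a i, v x⁆ (a j),
          hA.lie_lie_comm (mem_of_span_eq ha i) (mem_of_span_eq ha j), smul_neg]
        abel
      rw [e]
      rcases eq_or_ne i j with rfl | hne
      · rw [sub_self, lie_self]
      · exact hv.eqn x hx i j hne)
  choose F h0 hsm hF using hex
  exact ⟨fun x l => F l x, h0, hsm, fun l x hx i => by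
    rw [pd, (hF l x hx).fderiv_apply, oneForm_single]⟩

end Calculus

end SymmetricPair

/-! ### From lifts to solutions -/

namespace SymmetricPair

variable {𝔸 : Type*} [NormedRing 𝔸] [NormedAlgebra ℂ 𝔸] [FiniteDimensional ℂ 𝔸]
variable {S : SymmetricPair 𝔸} [CompleteSpace 𝔸] {B : LinearMap.BilinForm ℝ 𝔸}
variable {n : ℕ} {A : Submodule ℝ 𝔸} {a : Fin n → 𝔸}

/-- The logarithmic derivative of a smooth map is smooth. -/
lemma contDiffOn_of_hasLogDerivAt {s : Set (EuclideanSpace ℝ (Fin n))} (hs : IsOpen s)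
    {g : EuclideanSpace ℝ (Fin n) → S.G} (hg : ContDiffOn ℝ ∞ (fun x => S.val (g x)) s)
    {α : EuclideanSpace ℝ (Fin n) → EuclideanSpace ℝ (Fin n) →L[ℝ] 𝔸}
    (hd : ∀ x ∈ s, S.HasLogDerivAt g (α x) x) : ContDiffOn ℝ ∞ α s := by
  have h1 : ContDiffOn ℝ ∞ (fun x => (ContinuousLinearMap.mul ℝ 𝔸 (S.val (g x)⁻¹)).comp
      (fderiv ℝ (fun y => S.val (g y)) x)) s :=
    ((ContinuousLinearMap.mul ℝ 𝔸).contDiff.comp_contDiffOn (contDiffOn_val_inv hg)).clm_comp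
      (hg.fderiv_of_isOpen hs (by simp))
  refine h1.congr fun x hx => ?_
  ext w
  simp [(hd x hx).fderiv_apply]

/-- The structure equation of a map into `U` whose logarithmic derivative has `𝔲₁`-part
`∑ i, a_i dx_i`, split into its components in `𝔲₁` and `𝔲₀`. -/
lemma structure_equations (hA : S.IsMaxAbelian A) (ha : Submodule.span ℝ (Set.range a) = A)
    {s : Set (EuclideanSpace ℝ (Fin n))} (hs : IsOpen s)
    {g : EuclideanSpace ℝ (Fin n) → S.G}
    {u : Fin n → EuclideanSpace ℝ (Fin n) → 𝔸} (hu : ∀ x ∈ s, ∀ i, u i x ∈ S.𝔲₀)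
    (hus : ∀ i, ContDiffOn ℝ ∞ (u i) s)
    (hd : ∀ x ∈ s, S.HasLogDerivAt g (oneForm fun i => a i + u i x) x)
    {x : EuclideanSpace ℝ (Fin n)} (hx : x ∈ s) (i j : Fin n) :
    ⁅a i, u j x⁆ = ⁅a j, u i x⁆ ∧ pd j (u i) x - pd i (u j) x = ⁅u i x, u j x⁆ := by
  have hdu : ∀ i, DifferentiableAt ℝ (fun x => a i + u i x) x := fun i =>
    (contDiffOn_const.add (hus i)).contDiffAt (hs.mem_nhds hx) |>.differentiableAt (by simp)
  have hdθ : DifferentiableAt ℝ (fun x => oneForm fun i => a i + u i x) x :=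
    (contDiffOn_oneForm fun i => contDiffOn_const.add (hus i)).contDiffAt (hs.mem_nhds hx)
      |>.differentiableAt (by simp)
  have h := HasLogDerivAt.maurerCartan hs hd hx hdθ (EuclideanSpace.single j 1)
    (EuclideanSpace.single i 1)
  rw [fderiv_oneForm hdu, fderiv_oneForm hdu, ← oneForm_apply, ← oneForm_apply,
    oneForm_single, oneForm_single, oneForm_single, oneForm_single, fderiv_const_add,
    fderiv_const_add, ← Ring.lie_def] at h
  change pd j (u i) x - pd i (u j) x = _ at h
  have hmem : pd j (u i) x - pd i (u j) x ∈ S.𝔲₀ :=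
    sub_mem (fderiv_mem_submodule _ (Filter.eventually_of_mem (hs.mem_nhds hx)
      fun y hy => hu y hy i) _)
      (fderiv_mem_submodule _ (Filter.eventually_of_mem (hs.mem_nhds hx) fun y hy => hu y hy j) _)
  have hi := hA.le (mem_of_span_eq ha i)
  have hj := hA.le (mem_of_span_eq ha j)
  have e : ⁅a i + u i x, a j + u j x⁆ = (⁅a i, u j x⁆ - ⁅a j, u i x⁆) + ⁅u i x, u j x⁆ := by
    simp only [add_lie, lie_add, hA.abelian _ (mem_of_span_eq ha i) _ (mem_of_span_eq ha j)]
    rw [← lie_skew (u i x) (a j)]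
    abel
  rw [e] at h
  have h0 : ⁅a i, u j x⁆ - ⁅a j, u i x⁆ = 0 := by
    refine eq_zero_of_mem_𝔲₀_of_mem_𝔲₁ (S := S) ?_
      (sub_mem (lie_mem_𝔲₁_of_𝔲₁_𝔲₀ hi (hu x hx j)) (lie_mem_𝔲₁_of_𝔲₁_𝔲₀ hj (hu x hx i)))
    rw [eq_sub_of_add_eq h.symm]
    exact sub_mem hmem (lie_mem_𝔲₀_of_𝔲₀_𝔲₀ (hu x hx i) (hu x hx j))
  rw [h0, zero_add] at h
  exact ⟨sub_eq_zero.1 h0, h⟩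

/-- A lift `g : D → U` of a map to `U/U₀` with `g⁻¹ ∂_i g = a_i + u_i`, `u_i ∈ 𝔲₀`, is, up to a
gauge transformation with values in the centralizer of `A` in `U₀`, a left translate of the frame
at `λ = 1` of a solution of the `U/U₀`-system. -/
theorem exists_solution_of_lift (hB : S.IsRiemannian B) (hA : S.IsMaxAbelian A)
    (ha : Submodule.span ℝ (Set.range a) = A)
    (ho : ∀ i j, B (a i) (a j) = if i = j then 1 else 0) {r : ℝ} (hr : 0 < r)
    {g : EuclideanSpace ℝ (Fin n) → S.G}
    (hg : ContDiffOn ℝ ∞ (fun x => S.val (g x)) (Metric.ball 0 r))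
    (hgU : ∀ x ∈ Metric.ball (0 : EuclideanSpace ℝ (Fin n)) r, g x ∈ S.U)
    {u : Fin n → EuclideanSpace ℝ (Fin n) → 𝔸}
    (hu : ∀ x ∈ Metric.ball (0 : EuclideanSpace ℝ (Fin n)) r, ∀ i, u i x ∈ S.𝔲₀)
    (hd : ∀ x ∈ Metric.ball (0 : EuclideanSpace ℝ (Fin n)) r,
      S.HasLogDerivAt g (oneForm fun i => a i + u i x) x) :
    ∃ (v : EuclideanSpace ℝ (Fin n) → 𝔸) (E : EuclideanSpace ℝ (Fin n) → ℂ → S.G) (h : S.G),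
      S.IsSolution B A a (Metric.ball 0 r) v ∧ S.IsFrame a (Metric.ball 0 r) v E ∧ h ∈ S.U ∧
      ∀ x ∈ Metric.ball (0 : EuclideanSpace ℝ (Fin n)) r, S.act (g x) 1 = S.act h (S.psi E x) := by
  set D := Metric.ball (0 : EuclideanSpace ℝ (Fin n)) r with hD
  have hDo : IsOpen D := Metric.isOpen_ball
  have hDc : IsPreconnected D := (convex_ball _ _).isPreconnected
  have hD0 : (0 : EuclideanSpace ℝ (Fin n)) ∈ D := Metric.mem_ball_self hr
  have hdiff : ∀ {F : EuclideanSpace ℝ (Fin n) → 𝔸}, ContDiffOn ℝ ∞ F D → ∀ x ∈ D,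
      DifferentiableAt ℝ F x := fun hF x hx =>
    (hF.contDiffAt (hDo.mem_nhds hx)).differentiableAt (by simp)
  have hai := fun i => mem_of_span_eq ha i
  have hus : ∀ i, ContDiffOn ℝ ∞ (u i) D := fun i => by
    have h1 := (contDiffOn_of_hasLogDerivAt hDo hg hd).clm_apply
      (contDiffOn_const (c := EuclideanSpace.single i (1 : ℝ)))
    refine (h1.sub (contDiffOn_const (c := a i))).congr fun x _ => ?_
    rw [oneForm_single, add_sub_cancel_left]
  have hstr := fun x (hx : x ∈ D) => structure_equations hA ha hDo hu hus hd hx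
  obtain ⟨H, hH, hreg⟩ := hA.exists_regular hB
  obtain ⟨Γ, hΓ⟩ := exists_inverse_ad_sq hB hA ha ho hH hreg
  obtain ⟨c, hc⟩ := exists_oneForm_eq ha hH
  let v : EuclideanSpace ℝ (Fin n) → 𝔸 := fun x => Γ ⁅H, oneForm (fun i => u i x) c⁆
  let m : Fin n → EuclideanSpace ℝ (Fin n) → 𝔸 := fun i x => u i x - ⁅a i, v x⁆
  have hvm := fun x (hx : x ∈ D) => hB.sub_lie_mem_cent hA ha hH hreg hΓ hc (hu x hx)
    fun i j => (hstr x hx i j).1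
  have hv : ∀ x ∈ D, v x ∈ S.perp B A := fun x hx => (hvm x hx).1
  have hm : ∀ x ∈ D, ∀ i, m i x ∈ S.cent A := fun x hx => (hvm x hx).2
  have hvs : ContDiffOn ℝ ∞ v D := by
    have h1 := (Γ.comp (adL H)).contDiff.comp_contDiffOn
      ((contDiffOn_oneForm hus).clm_apply (contDiffOn_const (c := c)))
    refine h1.congr fun x _ => ?_
    simp [v]
  have hlie : ∀ i, ContDiffOn ℝ ∞ (fun x => ⁅a i, v x⁆) D := fun i => by
    simpa only [adL_apply, Function.comp_def] using (adL (a i)).contDiff.comp_contDiffOn hvs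
  have hms : ∀ i, ContDiffOn ℝ ∞ (m i) D := fun i => (hus i).sub (hlie i)
  have hpdu : ∀ x ∈ D, ∀ i j, pd j (u i) x = pd j (m i) x + ⁅a i, pd j v x⁆ := fun x hx i j => by
    rw [← pd_lie (a i) (hdiff hvs x hx) j]
    have : HasFDerivAt (u i) (fderiv ℝ (m i) x + fderiv ℝ (fun y => ⁅a i, v y⁆) x) x := by
      refine ((hdiff (hms i) x hx).hasFDerivAt.add
        (hdiff (hlie i) x hx).hasFDerivAt).congr_of_eventuallyEq (.of_forall fun y => ?_)
      simp [m]
    rw [pd, this.fderiv]; rfl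
  have hdec := fun x (hx : x ∈ D) i j => hB.decouple hA ha hH hreg hΓ (m := fun i => m i x)
    (N := fun j => pd j v x) (M := fun i j => pd j (m i) x) (v := v x) (hm x hx)
    (fun i j => fderiv_mem_submodule _
      (Filter.eventually_of_mem (hDo.mem_nhds hx) fun y hy => hm y hy i) _) (hv x hx).1
    (fun j => fderiv_mem_submodule _
      (Filter.eventually_of_mem (hDo.mem_nhds hx) fun y hy => (hv y hy).1) _) i j
    (by
      have hu' : ∀ i, m i x + ⁅a i, v x⁆ = u i x := fun i => sub_add_cancel _ _
      simp only [hu', ← hpdu x hx]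
      exact (hstr x hx i j).2)
  -- The gauge transformation `q` lies in the centralizer of `A` in `U₀`, since `m` is tangent to
  -- that centralizer.
  obtain ⟨q, hq0, hqs, hq⟩ := exists_hasLogDerivAt_oneForm (S := S) hr hms
    (fun x hx i => mem_𝔤_of_mem_𝔲 (hm x hx i).1.1) (fun x hx i j => (hdec x hx i j).1)
  have hmw : ∀ x ∈ D, ∀ w, oneForm (fun i => m i x) w ∈ S.cent A := fun x hx w => by
    rw [oneForm_apply]
    exact sum_mem fun i _ => (S.cent A).smul_mem _ (hm x hx i)
  have hqσ : ∀ x ∈ D, S.σ (q x) = q x := fun x hx =>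
    S.isDifferential_σ.apply_eq_self hDo hDc hD0 hq
      (fun x hx w => (S.mem_𝔲₀_iff.1 (hmw x hx w).1).2) hq0 hx
  have hqU : ∀ x ∈ D, q x ∈ S.U₀ := fun x hx => ⟨S.isDifferential_τ.apply_eq_self hDo hDc hD0 hq
      (fun x hx w => (S.mem_𝔲_iff.1 (hmw x hx w).1.1).2) hq0 hx, hqσ x hx⟩
  have hqA : ∀ x ∈ D, ∀ b ∈ A, S.AdL (q x) b = b := by
    intro x hx b hb
    have h1 : ∀ y ∈ D, HasFDerivAt (fun y => S.AdL (q y) b) 0 y := fun y hy => by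
      refine ((hq y hy).hasFDerivAt_AdL (hasFDerivAt_const b y)).congr_fderiv ?_
      ext w
      simp [(hmw y hy w).2 b hb]
    have h2 := hDo.is_const_of_fderiv_eq_zero hDc
      (fun y hy => (h1 y hy).differentiableAt.differentiableWithinAt)
      (fun y hy => (h1 y hy).fderiv) hx hD0
    rw [h2, hq0, AdL_one]
  let v' : EuclideanSpace ℝ (Fin n) → 𝔸 := fun x => S.AdL (q x) (v x)
  have hv' : ∀ x ∈ D, v' x ∈ S.𝔲₁ := fun x hx => AdL_mem_𝔲₁ (hqU x hx) (hv x hx).1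
  have hpd' : ∀ x ∈ D, ∀ j, pd j v' x = S.AdL (q x) (pd j v x + ⁅m j x, v x⁆) := by
    intro x hx j
    rw [pd, ((hq x hx).hasFDerivAt_AdL (hdiff hvs x hx).hasFDerivAt).fderiv]
    simp only [ContinuousLinearMap.comp_apply, sub_apply, oneForm_single, adL_apply]
    rw [← lie_skew (m j x), sub_eq_add_neg]
    rfl
  have hsol : S.IsSolution B A a D v' := by
    refine ⟨?_, hv', fun x hx b hb => ?_, fun x hx i j _ => ?_⟩
    · refine ((hqs.mul hvs).mul (contDiffOn_val_inv hqs)).congr fun x _ => ?_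
      simp [v', AdL_apply]
    · rw [← hqA x hx b hb, hB.AdL_invariant (hqU x hx).1 (hv x hx).1.1 (hA.le hb).1]
      exact (hv x hx).2 b hb
    · rw [hpd' x hx, hpd' x hx]
      conv_lhs => rw [← hqA x hx _ (hai i), ← hqA x hx _ (hai j)]
      conv_rhs => rw [← hqA x hx _ (hai i), ← hqA x hx _ (hai j)]
      simp only [v', ← AdL_lie]
      rw [← map_sub, (hdec x hx i j).2]
  obtain ⟨E, hE⟩ := hsol.exists_isFrame hA ha hr
  have hg' : ∀ x ∈ D, S.HasLogDerivAt (fun y => g y * (q y)⁻¹)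
      (oneForm fun i => (1 : ℂ) • a i + ⁅a i, v' x⁆) x := by
    intro x hx
    have h1 := (hd x hx).mul (hq x hx).inv
    have e : (oneForm fun i => (1 : ℂ) • a i + ⁅a i, v' x⁆)
        = (S.AdL (q x)⁻¹⁻¹).comp (oneForm fun i => a i + u i x)
          + -(S.AdL (q x)).comp (oneForm fun i => m i x) := by
      refine clm_ext_single fun i => ?_
      simp only [ContinuousLinearMap.comp_apply, oneForm_single, add_apply, neg_apply, inv_inv]
      conv_lhs => rw [one_smul, ← hqA x hx _ (hai i), ← AdL_lie]
      rw [← map_neg (S.AdL _), ← map_add (S.AdL _), ← map_add (S.AdL _)]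
      congr 1
      simp only [m]
      abel
    rw [e]
    exact h1
  have hfin := eqOn_of_hasLogDerivAt hDo hDc hD0 hg' (g := fun y => E y 1)
    (fun x hx => hE.hasLogDerivAt hDo 1 hx)
  refine ⟨v', E, g 0, hsol, hE, hgU 0 hD0, fun x hx => ?_⟩
  have h1 := hfin x hx
  rw [hq0, hE.init, inv_one, mul_one, mul_one] at h1
  rw [hE.psi_eq_act hDo hDc hD0 hA ha hv' hx, eq_mul_of_mul_inv_eq h1]
  simp only [act, map_mul, hqσ x hx, mul_one]
  group

end SymmetricPair

/-! ### Lifting maps into `U/U₀` -/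

namespace SymmetricPair

variable {𝔸 : Type*} [NormedRing 𝔸] [NormedAlgebra ℂ 𝔸] [FiniteDimensional ℂ 𝔸]
variable {S : SymmetricPair 𝔸} [CompleteSpace 𝔸] {B : LinearMap.BilinForm ℝ 𝔸}

/-- The projection of `𝔲` onto `𝔲₁` along `𝔲₀`. -/
noncomputable def projOdd (S : SymmetricPair 𝔸) : 𝔸 →L[ℝ] 𝔸 :=
  (1 / 2 : ℝ) • (ContinuousLinearMap.id ℝ 𝔸 - S.Dσ)

lemma projOdd_apply (X : 𝔸) : S.projOdd X = (1 / 2 : ℝ) • (X - S.Dσ X) := rfl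

lemma projOdd_mem {X : 𝔸} (hX : X ∈ S.𝔲) : S.projOdd X ∈ S.𝔲₁ :=
  S.𝔲₁.smul_mem _ (sub_Dσ_mem_𝔲₁ hX)

lemma sub_projOdd_mem {X : 𝔸} (hX : X ∈ S.𝔲) : X - S.projOdd X ∈ S.𝔲₀ := by
  have : X - S.projOdd X = (1 / 2 : ℝ) • (X + S.Dσ X) := by rw [projOdd_apply]; module
  rw [this]
  exact S.𝔲₀.smul_mem _ (add_Dσ_mem_𝔲₀ hX)

lemma projOdd_of_mem_𝔲₀ {X : 𝔸} (hX : X ∈ S.𝔲₀) : S.projOdd X = 0 := by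
  rw [projOdd_apply, (S.mem_𝔲₀_iff.1 hX).2, sub_self, smul_zero]

lemma projOdd_of_mem_𝔲₁ {X : 𝔸} (hX : X ∈ S.𝔲₁) : S.projOdd X = X := by
  rw [projOdd_apply, (S.mem_𝔲₁_iff.1 hX).2]
  module

lemma projOdd_AdL {k : S.G} (hk : k ∈ S.U₀) {X : 𝔸} (hX : X ∈ S.𝔤) :
    S.projOdd (S.AdL k X) = S.AdL k (S.projOdd X) := by
  rw [projOdd_apply, projOdd_apply, S.isDifferential_σ.apply_AdL k hX, hk.2, map_smul, map_sub]

section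

variable {E : Type*} [NormedAddCommGroup E] [NormedSpace ℝ E] {f g : E → S.G} {p x : E}

lemma act_one (g : S.G) : S.act g 1 = g * (S.σ g)⁻¹ := by rw [act, mul_one]

/-- The differential of `f = g σ(g)⁻¹` is given by the `𝔲₁`-part of `g⁻¹ dg`. -/
lemma HasLogDerivAt.fderiv_act_one {α : E →L[ℝ] 𝔸} (hg : S.HasLogDerivAt g α x)
    (hf : f =ᶠ[𝓝 x] fun y => S.act (g y) 1) (w : E) :
    fderiv ℝ (fun y => S.val (f y)) x w
      = S.val (g x) * ((2 : ℝ) • S.projOdd (α w)) * S.val (S.σ (g x))⁻¹ := by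
  have h1 := (hg.mul (S.isDifferential_σ.hasLogDerivAt hg).inv).congr
    (hf.trans (.of_forall fun y => act_one (g y)))
  rw [h1.fderiv_apply, hf.eq_of_nhds, act_one]
  simp only [add_apply, neg_apply, ContinuousLinearMap.comp_apply, inv_inv, AdL_apply,
    projOdd_apply, smul_smul, val_mul, mul_add, mul_neg, mul_assoc, val_inv_mul_cancel_left]
  norm_num
  rw [sub_mul, mul_sub, sub_eq_add_neg]

variable (S) in
/-- `g` is a smooth lift of `f : E → U/U₀` to `U` near `p`. -/
def IsLift (f g : E → S.G) (p : E) : Prop :=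
  ∀ᶠ x in 𝓝 p, g x ∈ S.U ∧ f x = S.act (g x) 1 ∧ ContDiffAt ℝ ∞ (fun y => S.val (g y)) x

lemma IsLift.mul (hg : S.IsLift f g p) {k : E → S.G}
    (hk : ∀ᶠ x in 𝓝 p, k x ∈ S.U₀ ∧ ContDiffAt ℝ ∞ (fun y => S.val (k y)) x) :
    S.IsLift f (fun x => g x * k x) p := by
  filter_upwards [hg, hk] with x ⟨h1, h2, h3⟩ ⟨h4, h5⟩
  refine ⟨S.U.mul_mem h1 h4.1, ?_, h3.mul h5⟩
  rw [h2, act_one, act_one, map_mul, h4.2]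
  group

/-- Maps into `U/U₀` lift locally to `U`: near the base point, `f = exp X` with `X ∈ 𝔲₁`, and
`exp (X / 2)` is a lift. -/
lemma exists_isLift (hf : ∀ᶠ x in 𝓝 p, f x ∈ S.symmSpace ∧
    ContDiffAt ℝ ∞ (fun y => S.val (f y)) x) : ∃ g : E → S.G, S.IsLift f g p := by
  let _ : NormedAlgebra ℚ 𝔸 := NormedAlgebra.restrictScalars ℚ ℝ 𝔸
  obtain ⟨b, hb, hbp⟩ := hf.self_of_nhds.1
  let F : E → S.G := fun x => b⁻¹ * f x * S.σ b
  have hFp : F p = 1 := by simp only [F, hbp, act_one]; group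
  have hFs : ∀ᶠ x in 𝓝 p, ContDiffAt ℝ ∞ (fun y => S.val (F y)) x := by
    filter_upwards [hf] with x hx
    have : (fun y => S.val (F y)) = fun y => S.val b⁻¹ * S.val (f y) * S.val (S.σ b) :=
      funext fun y => by simp only [F, val_mul]
    rw [this]
    exact (contDiffAt_const.mul hx.2).mul contDiffAt_const
  have hFσ : ∀ᶠ x in 𝓝 p, S.σ (F x) = (F x)⁻¹ ∧ S.τ (F x) = F x := by
    filter_upwards [hf] with x hx
    obtain ⟨h, hh, hhx⟩ := hx.1
    constructor
    · simp only [F, hhx, act_one, map_mul, map_inv, S.σ_σ]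
      group
    · exact S.U.mul_mem (S.U.mul_mem (S.U.inv_mem hb) (hhx ▸ by
        rw [act_one]; exact S.U.mul_mem hh (S.U.inv_mem (σ_mem_U hh)))) (σ_mem_U hb)
  have hFc : ContinuousAt (fun y => S.val (F y)) p := hFs.self_of_nhds.continuousAt
  have hF1 : Filter.Tendsto (fun y => S.val (F y)) (𝓝 p) (𝓝 1) := by
    simpa [ContinuousAt, hFp] using hFc
  let X : E → 𝔸 := fun x => expLog 𝔸 (S.val (F x))
  have hX0 : Filter.Tendsto X (𝓝 p) (𝓝 0) := tendsto_expLog.comp hF1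
  have hXexp : ∀ᶠ x in 𝓝 p, exp (X x) = S.val (F x) := hF1.eventually eventually_exp_expLog
  have hX𝔤 : ∀ᶠ x in 𝓝 p, X x ∈ S.𝔤 :=
    (hF1.eventually S.eventually_expLog_mem).mono fun x hx => hx _ rfl
  have hXs : ∀ᶠ x in 𝓝 p, ContDiffAt ℝ ∞ X x := by
    filter_upwards [hFs, hF1.eventually eventually_contDiffAt_expLog] with x h1 h2
    exact ContDiffAt.comp x h2 h1
  have hlim : ∀ D : 𝔸 →L[ℝ] 𝔸, ∀ᶠ x in 𝓝 p, expLog 𝔸 (exp (D (X x))) = D (X x) := fun D => by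
    have : Filter.Tendsto (fun x => D (X x)) (𝓝 p) (𝓝 0) := by
      have h := (D.continuous.tendsto 0).comp hX0
      rwa [map_zero] at h
    exact this.eventually eventually_expLog_exp
  have hX𝔲₁ : ∀ᶠ x in 𝓝 p, X x ∈ S.𝔲₁ := by
    filter_upwards [hXexp, hX𝔤, hFσ, hlim S.Dσ, hlim S.Dτ,
      hlim (-ContinuousLinearMap.id ℝ 𝔸)] with x h1 h2 h3 h4 h5 h6
    rw [mem_𝔲₁_iff, mem_𝔲_iff]
    refine ⟨⟨h2, ?_⟩, ?_⟩
    · rw [← h5, ← (S.isDifferential_τ _ h2).2 _ h1.symm, h3.2]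
    · have h7 : exp (-X x) = S.val (F x)⁻¹ := (S.val_inv_eq_exp_neg h1.symm).symm
      have h8 : expLog 𝔸 (exp (-X x)) = -X x := h6
      rw [← h4, ← (S.isDifferential_σ _ h2).2 _ h1.symm, h3.1, ← h7, h8]
  have hex : ∀ x, ∃ k : S.G, X x ∈ S.𝔤 → S.val k = exp ((1 / 2 : ℝ) • X x) := fun x => by
    by_cases h : X x ∈ S.𝔤
    · obtain ⟨k, hk⟩ := S.exists_val_eq_exp (S.smul_mem_𝔤 h (1 / 2))
      exact ⟨k, fun _ => hk⟩
    · exact ⟨1, fun h' => absurd h' h⟩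
  choose k hk using hex
  refine ⟨fun x => b * k x, ?_⟩
  filter_upwards [hXexp, hX𝔤.eventually_nhds, hX𝔲₁, hXs] with x h1 h2 h3 h4
  have hkx := hk x h2.self_of_nhds
  have hm : (1 / 2 : ℝ) • X x ∈ S.𝔲₁ := S.𝔲₁.smul_mem _ h3
  have hkU : k x ∈ S.U := mem_U_of_val_eq_exp hm.1 hkx
  have hkσ : (S.σ (k x))⁻¹ = k x := by
    rw [inv_eq_iff_eq_inv]
    refine S.val_injective ?_
    rw [(S.isDifferential_σ _ (mem_𝔤_of_mem_𝔲 hm.1)).2 _ hkx, (S.mem_𝔲₁_iff.1 hm).2,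
      S.val_inv_eq_exp_neg hkx]
  have hkk : k x * k x = F x := by
    refine S.val_injective ?_
    rw [val_mul, hkx, ← NormedSpace.exp_add_of_commute (Commute.refl _), ← h1, ← add_smul]
    norm_num
  refine ⟨S.U.mul_mem hb hkU, ?_, ?_⟩
  · rw [act_one, map_mul, mul_inv_rev, hkσ]
    have : f x = b * F x * (S.σ b)⁻¹ := by simp only [F]; group
    rw [this, ← hkk]
    group
  · have h5 : ContDiffAt ℝ ∞ (fun y => S.val b * exp ((1 / 2 : ℝ) • X y)) x :=
      contDiffAt_const.mul (((contDiff_exp (𝔸 := 𝔸)).of_le le_top).contDiffAt.comp x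
        (h4.const_smul (1 / 2 : ℝ)))
    refine h5.congr_of_eventuallyEq (h2.mono fun y hy => ?_)
    simp only [val_mul]
    rw [hk y hy]

end

section

variable {n : ℕ} {f g : EuclideanSpace ℝ (Fin n) → S.G} {p x : EuclideanSpace ℝ (Fin n)}

/-- If `f = g σ(g)⁻¹` is tangent to a flat, then the `𝔲₁`-part of `g⁻¹ dg` has a maximal abelian
range. -/
lemma TangentToFlat.isMaxAbelian_range (hT : S.TangentToFlat f x)
    (hf : f =ᶠ[𝓝 x] fun y => S.act (g y) 1) (hgU : g x ∈ S.U)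
    {α : EuclideanSpace ℝ (Fin n) →L[ℝ] 𝔸} (hg : S.HasLogDerivAt g α x) :
    S.IsMaxAbelian (LinearMap.range (S.projOdd.comp α).toLinearMap) := by
  let _ : NormedAlgebra ℚ 𝔸 := NormedAlgebra.restrictScalars ℚ ℝ 𝔸
  obtain ⟨b', hb', A', hA', ξ, hξ, hfx, hrange⟩ := hT
  -- `b = b' exp(ξ / 2)` moves the base point to the point of tangency
  have hm : (1 / 2 : ℝ) • ξ ∈ S.𝔲₁ := S.𝔲₁.smul_mem _ (hA'.le hξ)
  obtain ⟨e, he⟩ := S.exists_val_eq_exp (mem_𝔤_of_mem_𝔲 hm.1)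
  have hσe : S.σ e = e⁻¹ := by
    refine S.val_injective ?_
    rw [(S.isDifferential_σ _ (mem_𝔤_of_mem_𝔲 hm.1)).2 _ he, (S.mem_𝔲₁_iff.1 hm).2,
      S.val_inv_eq_exp_neg he]
  have hee : S.val e * S.val e = exp ξ := by
    rw [he, ← NormedSpace.exp_add_of_commute (Commute.refl _), ← add_smul]
    norm_num
  have heU : e ∈ S.U := mem_U_of_val_eq_exp hm.1 he
  have hfb : f x = b' * e * e * (S.σ b')⁻¹ := by
    refine S.val_injective ?_
    rw [hfx, flatMap, val_mul, val_mul, val_mul, ← hee]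
    simp only [mul_assoc]
  let k : S.G := (b' * e)⁻¹ * g x
  have hk : k ∈ S.U₀ := by
    refine ⟨S.U.mul_mem (S.U.inv_mem (S.U.mul_mem hb' heU)) hgU, ?_⟩
    have h1 : g x * (S.σ (g x))⁻¹ = b' * e * e * (S.σ b')⁻¹ := by
      rw [← hfb, hf.eq_of_nhds, act_one]
    have h2 : S.σ (g x) = S.σ b' * e⁻¹ * e⁻¹ * b'⁻¹ * g x := by
      rw [mul_inv_eq_iff_eq_mul] at h1
      rw [eq_inv_mul_of_mul_eq h1.symm]
      group
    simp only [k, map_mul, map_inv, hσe, h2]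
    group
  have hgk : g x = b' * e * k := by simp only [k]; group
  have hσg : (S.σ (g x))⁻¹ = k⁻¹ * e * (S.σ b')⁻¹ := by
    rw [hgk, map_mul, map_mul, hk.2, hσe]
    group
  have hfl : ∀ X ∈ A', fderiv ℝ (S.flatMap b') ξ X
      = S.val b' * (S.val e * X * S.val e) * S.val (S.σ b')⁻¹ := by
    intro X hX
    have hcomm : Commute ξ X := by
      have := hA'.abelian ξ hξ X hX
      rwa [Ring.lie_def, sub_eq_zero] at this
    have hce : Commute (S.val e) X := by
      rw [he]
      exact (hcomm.smul_left (1 / 2 : ℝ)).exp_left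
    have hd : DifferentiableAt ℝ (exp : 𝔸 → 𝔸) ξ :=
      (contDiff_exp (𝔸 := 𝔸)).differentiable (by simp) ξ
    have h1 : HasFDerivAt (S.flatMap b') _ ξ :=
      (hd.hasFDerivAt.const_mul (S.val b')).mul_const' (S.val (S.σ b')⁻¹)
    rw [h1.fderiv]
    simp only [smul_apply, smul_eq_mul, MulOpposite.smul_eq_mul_unop, MulOpposite.unop_op]
    rw [fderiv_exp_apply_of_commute hcomm, ← hee, mul_assoc (S.val e) X, ← hce.eq,
      ← mul_assoc (S.val e)]
  have hff : ∀ w, fderiv ℝ (fun y => S.val (f y)) x w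
      = S.val b' * (S.val e * S.AdL k ((2 : ℝ) • S.projOdd (α w)) * S.val e)
        * S.val (S.σ b')⁻¹ := by
    intro w
    rw [hg.fderiv_act_one hf w, hσg, hgk, AdL_apply]
    simp only [val_mul, mul_assoc]
  have hcancel : ∀ X Y : 𝔸, S.val b' * (S.val e * X * S.val e) * S.val (S.σ b')⁻¹
      = S.val b' * (S.val e * Y * S.val e) * S.val (S.σ b')⁻¹ → X = Y := by
    intro X Y h
    have h1 := (S.isUnit_val b').mul_left_cancel ((S.isUnit_val _).mul_right_cancel h)
    exact (S.isUnit_val e).mul_left_cancel ((S.isUnit_val e).mul_right_cancel h1)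
  have hR : LinearMap.range (S.projOdd.comp α).toLinearMap
      = A'.map (S.AdL k⁻¹).toLinearMap := by
    ext Y
    constructor
    · rintro ⟨w, rfl⟩
      have h1 : fderiv ℝ (fun y => S.val (f y)) x ((1 / 2 : ℝ) • w) ∈
          A'.map (fderiv ℝ (S.flatMap b') ξ).toLinearMap := hrange ▸ ⟨_, rfl⟩
      obtain ⟨X, hX, hXw⟩ := h1
      have h2 := hcancel _ _ ((hfl X hX).symm.trans (hXw.trans (hff _)))
      refine ⟨X, hX, ?_⟩
      change S.AdL k⁻¹ X = S.projOdd (α w)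
      rw [h2, AdL_inv_apply_AdL, map_smul, map_smul, smul_smul]
      norm_num
    · rintro ⟨X, hX, rfl⟩
      have h1 : fderiv ℝ (S.flatMap b') ξ X ∈
          LinearMap.range (fderiv ℝ (fun y => S.val (f y)) x).toLinearMap :=
        hrange ▸ ⟨X, hX, rfl⟩
      obtain ⟨w, hw⟩ := h1
      have h2 := hcancel _ _ ((hff w).symm.trans (hw.trans (hfl X hX)))
      refine ⟨(2 : ℝ) • w, ?_⟩
      change S.projOdd (α ((2 : ℝ) • w)) = S.AdL k⁻¹ X
      rw [← h2, AdL_inv_apply_AdL, map_smul, map_smul]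
  rw [hR]
  exact hA'.map_AdL (S.U₀.inv_mem hk)

end

end SymmetricPair

/-! ### Adapted lifts and curved flats -/

namespace SymmetricPair

variable {𝔸 : Type*} [NormedRing 𝔸] [NormedAlgebra ℂ 𝔸]
variable {S : SymmetricPair 𝔸} {B : LinearMap.BilinForm ℝ 𝔸}

section

variable {E : Type*} [NormedAddCommGroup E] [NormedSpace ℝ E]

/-- The logarithmic derivative `g⁻¹ dg`. -/
noncomputable def logDeriv (S : SymmetricPair 𝔸) (g : E → S.G) (x : E) : E →L[ℝ] 𝔸 :=
  (ContinuousLinearMap.mul ℝ 𝔸 (S.val (g x)⁻¹)).comp (fderiv ℝ (fun y => S.val (g y)) x)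

lemma hasLogDerivAt_logDeriv {g : E → S.G} {x : E}
    (h : DifferentiableAt ℝ (fun y => S.val (g y)) x) : S.HasLogDerivAt g (S.logDeriv g x) x :=
  .of_hasFDerivAt h.hasFDerivAt fun w => by simp [logDeriv]

lemma contDiffAt_logDeriv [CompleteSpace 𝔸] {g : E → S.G} {x : E}
    (h : ContDiffAt ℝ ∞ (fun y => S.val (g y)) x) : ContDiffAt ℝ ∞ (S.logDeriv g) x :=
  ((ContinuousLinearMap.mul ℝ 𝔸).contDiff.contDiffAt.comp x (contDiffAt_val_inv h)).clm_comp
    (h.fderiv_right (m := ∞) (by simp))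

lemma HasLogDerivAt.mem_𝔲₀ [FiniteDimensional ℂ 𝔸] [CompleteSpace 𝔸] {k : E → S.G} {x : E}
    {α : E →L[ℝ] 𝔸} (hk : S.HasLogDerivAt k α x) (hU : ∀ᶠ y in 𝓝 x, k y ∈ S.U₀) (w : E) :
    α w ∈ S.𝔲₀ := by
  rw [mem_𝔲₀_iff]
  refine ⟨hk.mem_𝔲 (hU.mono fun y hy => hy.1) w, ?_⟩
  have h := (S.isDifferential_σ.hasLogDerivAt hk).congr (hU.mono fun y hy => hy.2.symm)
  exact DFunLike.congr_fun (h.unique hk) w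

end

variable [FiniteDimensional ℂ 𝔸] [CompleteSpace 𝔸]
variable {n : ℕ} {A : Submodule ℝ 𝔸} {a : Fin n → 𝔸}

/-- A map that is tangent to flats has a lift `g` whose `𝔲₁`-part of `g⁻¹ dg` takes values in the
fixed maximal abelian subspace `A`. -/
lemma exists_adapted_lift (hB : S.IsRiemannian B) (hA : S.IsMaxAbelian A)
    (ha : Submodule.span ℝ (Set.range a) = A)
    (ho : ∀ i j, B (a i) (a j) = if i = j then 1 else 0)
    {f : EuclideanSpace ℝ (Fin n) → S.G} {p : EuclideanSpace ℝ (Fin n)}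
    (hf : ∀ᶠ x in 𝓝 p, f x ∈ S.symmSpace ∧ ContDiffAt ℝ ∞ (fun y => S.val (f y)) x)
    (hT : ∀ᶠ x in 𝓝 p, S.TangentToFlat f x) :
    ∃ g, S.IsLift f g p ∧ ∀ᶠ x in 𝓝 p, ∀ w, S.projOdd (S.logDeriv g x w) ∈ A := by
  obtain ⟨g₀, hg₀⟩ := exists_isLift hf
  have hlog : ∀ {g : EuclideanSpace ℝ (Fin n) → S.G} {x},
      ContDiffAt ℝ ∞ (fun y => S.val (g y)) x → S.HasLogDerivAt g (S.logDeriv g x) x :=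
    fun h => hasLogDerivAt_logDeriv (h.differentiableAt (by simp))
  have hrange : ∀ {g : EuclideanSpace ℝ (Fin n) → S.G}, S.IsLift f g p → ∀ᶠ x in 𝓝 p,
      S.IsMaxAbelian (LinearMap.range (S.projOdd.comp (S.logDeriv g x)).toLinearMap) := by
    intro g hg
    filter_upwards [hT, hg.eventually_nhds] with x h1 h2
    exact h1.isMaxAbelian_range (h2.mono fun y hy => hy.2.1) h2.self_of_nhds.1
      (hlog h2.self_of_nhds.2.2)
  obtain ⟨H, hH, hreg⟩ := hA.exists_regular hB
  -- a constant rotation makes the range equal to `A` at `p`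
  obtain ⟨k₀, hk₀, hk₀A⟩ := hA.exists_map_AdL_eq hB (hrange hg₀).self_of_nhds
  let g₁ : EuclideanSpace ℝ (Fin n) → S.G := fun x => g₀ x * k₀
  have hg₁ : S.IsLift f g₁ p :=
    hg₀.mul (k := fun _ => k₀) (.of_forall fun x => ⟨hk₀, contDiffAt_const⟩)
  obtain ⟨w₀, hw₀⟩ : ∃ w₀, S.projOdd (S.logDeriv g₁ p w₀) = H := by
    have h1 : S.AdL k₀ H ∈ LinearMap.range (S.projOdd.comp (S.logDeriv g₀ p)).toLinearMap :=
      hk₀A ▸ ⟨H, hH, rfl⟩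
    obtain ⟨w₀, hw₀⟩ := h1
    have h2 := hlog hg₀.self_of_nhds.2.2
    refine ⟨w₀, ?_⟩
    rw [(hlog hg₁.self_of_nhds.2.2).unique (h2.mul_const k₀), ContinuousLinearMap.comp_apply,
      projOdd_AdL (S.U₀.inv_mem hk₀) (h2.mem_𝔤 w₀)]
    exact (congrArg (S.AdL k₀⁻¹) hw₀).trans (S.AdL_inv_apply_AdL k₀ H)
  let h : EuclideanSpace ℝ (Fin n) → 𝔸 := fun x => S.projOdd (S.logDeriv g₁ x w₀)
  have hhs : ∀ᶠ x in 𝓝 p, ContDiffAt ℝ ∞ h x := hg₁.mono fun x hx =>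
    S.projOdd.contDiff.contDiffAt.comp x ((contDiffAt_logDeriv hx.2.2).clm_apply contDiffAt_const)
  have hhc : Filter.Tendsto h (𝓝 p) (𝓝 H) := by
    have := hhs.self_of_nhds.continuousAt.tendsto
    rwa [show h p = H from hw₀] at this
  have hh𝔲 : ∀ᶠ x in 𝓝 p, h x ∈ S.𝔲₁ := hg₁.eventually_nhds.mono fun x hx =>
    projOdd_mem ((hlog hx.self_of_nhds.2.2).mem_𝔲 (hx.mono fun y hy => hy.1) w₀)
  -- a smooth rotation keeps the direction `w₀` in `A`, hence, by regularity, all directions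
  obtain ⟨Z, Y, hZs, -, hZY⟩ := exists_polar hB hA ha ho hH hreg
  have hZs' : ∀ᶠ x in 𝓝 p, ContDiffAt ℝ ∞ (fun x => exp (Z (h x))) x := by
    filter_upwards [hhs, hhc.eventually (hZs.eventually (by simp))] with x h1 h2
    exact ((contDiff_exp (𝔸 := 𝔸)).of_le le_top).contDiffAt.comp x
      ((h2.of_le le_top).comp x h1)
  have hZ𝔲 : ∀ᶠ x in 𝓝 p, Z (h x) ∈ S.𝔲₀ := by
    filter_upwards [hh𝔲, hhc.eventually hZY] with x h1 h2 using (h2 h1).1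
  have hex : ∀ x, ∃ k : S.G, Z (h x) ∈ S.𝔲₀ → S.val k = exp (Z (h x)) := fun x => by
    by_cases hx : Z (h x) ∈ S.𝔲₀
    · obtain ⟨k, hk⟩ := S.exists_val_eq_exp (mem_𝔤_of_mem_𝔲 hx.1)
      exact ⟨k, fun _ => hk⟩
    · exact ⟨1, fun h' => absurd h' hx⟩
  choose k hk using hex
  have hkU : ∀ᶠ x in 𝓝 p, k x ∈ S.U₀ ∧ ContDiffAt ℝ ∞ (fun y => S.val (k y)) x := by
    filter_upwards [hZ𝔲.eventually_nhds, hZs'] with x h1 h2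
    exact ⟨mem_U₀_of_val_eq_exp h1.self_of_nhds (hk x h1.self_of_nhds),
      h2.congr_of_eventuallyEq (h1.mono hk)⟩
  have hg := hg₁.mul hkU
  refine ⟨_, hg, ?_⟩
  filter_upwards [hrange hg, hg, hg₁, hkU.eventually_nhds, hZ𝔲, hh𝔲, hhc.eventually hZY]
    with x h1 h2 h3 h4 h5 h6 h7 w
  obtain ⟨-, hYA, hZYx, hYreg⟩ := h7 h6
  have hkx := h4.self_of_nhds.1
  have hdk := hlog h4.self_of_nhds.2
  have hY : S.projOdd (S.logDeriv (fun x => g₁ x * k x) x w₀) = Y (h x) := by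
    rw [(hlog h2.2.2).unique ((hlog h3.2.2).mul hdk), add_apply, map_add,
      projOdd_of_mem_𝔲₀ (hdk.mem_𝔲₀ (h4.mono fun y hy => hy.1) w₀), add_zero,
      ContinuousLinearMap.comp_apply,
      projOdd_AdL (S.U₀.inv_mem hkx) ((hlog h3.2.2).mem_𝔤 w₀)]
    change S.AdL (k x)⁻¹ (h x) = Y (h x)
    conv_lhs => rw [← hZYx, ← AdL_apply_of_val_eq_exp (hk x h5)]
    exact S.AdL_inv_apply_AdL _ _
  have hAA := hA.eq_of_regular h1 (H := Y (h x)) ⟨w₀, hY⟩ hYreg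
  rw [← hAA]
  exact ⟨w, rfl⟩

/-- The coordinates `X ↦ (B(X, a_i))_i` with respect to an orthonormal family. -/
noncomputable def coord (B : LinearMap.BilinForm ℝ 𝔸) (a : Fin n → 𝔸) :
    𝔸 →L[ℝ] EuclideanSpace ℝ (Fin n) :=
  LinearMap.toContinuousLinearMap
    ((WithLp.linearEquiv 2 ℝ (Fin n → ℝ)).symm.toLinearMap ∘ₗ LinearMap.pi fun i => B.flip (a i))

lemma coord_apply (X : 𝔸) (i : Fin n) : coord B a X i = B X (a i) := rfl

lemma oneForm_coord (ha : Submodule.span ℝ (Set.range a) = A)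
    (ho : ∀ i j, B (a i) (a j) = if i = j then 1 else 0) {X : 𝔸} (hX : X ∈ A) :
    oneForm a (coord B a X) = X := by
  conv_rhs => rw [← proj_of_mem ha ho hX, proj_apply]
  rw [oneForm_apply]
  rfl

/-- If the `𝔲₁`-parts of `X` and `Y` lie in `A`, then that of `[X, Y]` is orthogonal to `A`. -/
lemma coord_projOdd_lie (hB : S.IsRiemannian B) (hA : S.IsMaxAbelian A)
    (ha : Submodule.span ℝ (Set.range a) = A) {X Y : 𝔸} (hX : X ∈ S.𝔲) (hY : Y ∈ S.𝔲)
    (hXA : S.projOdd X ∈ A) (hYA : S.projOdd Y ∈ A) : coord B a (S.projOdd ⁅X, Y⁆) = 0 := by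
  have hX0 := sub_projOdd_mem hX
  have hY0 := sub_projOdd_mem hY
  set X₁ := S.projOdd X
  set Y₁ := S.projOdd Y
  set X₀ := X - X₁ with hX₀
  set Y₀ := Y - Y₁ with hY₀
  have hX' : X = X₀ + X₁ := by rw [hX₀, sub_add_cancel]
  have hY' : Y = Y₀ + Y₁ := by rw [hY₀, sub_add_cancel]
  have h1 := hA.lie_mem_perp hB hXA hY0
  have h2 := hA.lie_mem_perp hB hYA hX0
  have e : ⁅X, Y⁆ = ⁅X₀, Y₀⁆ + (⁅X₁, Y₀⁆ - ⁅Y₁, X₀⁆) := by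
    rw [hX', hY']
    simp only [add_lie, lie_add, hA.abelian _ hXA _ hYA]
    rw [← lie_skew X₀ Y₁]
    abel
  rw [e, map_add, projOdd_of_mem_𝔲₀ (lie_mem_𝔲₀_of_𝔲₀_𝔲₀ hX0 hY0), zero_add,
    projOdd_of_mem_𝔲₁ (sub_mem h1.1 h2.1)]
  ext i
  rw [coord_apply]
  exact (sub_mem h1 h2).2 _ (mem_of_span_eq ha i)

/-- Locally, a curved flat is a translate of the map `ψ` of a solution, up to a change of
coordinates. -/
theorem exists_solution_of_isCurvedFlat (hB : S.IsRiemannian B) (hA : S.IsMaxAbelian A)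
    (ha : Submodule.span ℝ (Set.range a) = A)
    (ho : ∀ i j, B (a i) (a j) = if i = j then 1 else 0) {O : Set (EuclideanSpace ℝ (Fin n))}
    (hO : IsOpen O) {f : EuclideanSpace ℝ (Fin n) → S.G} (hf : S.IsCurvedFlat B O f)
    {p : EuclideanSpace ℝ (Fin n)} (hp : p ∈ O) :
    ∃ r > 0, ∃ (v : EuclideanSpace ℝ (Fin n) → 𝔸)
      (E : EuclideanSpace ℝ (Fin n) → ℂ → S.G)
      (φ : OpenPartialHomeomorph (EuclideanSpace ℝ (Fin n)) (EuclideanSpace ℝ (Fin n)))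
      (h : S.G),
      S.IsSolution B A a (Metric.ball 0 r) v ∧ S.IsFrame a (Metric.ball 0 r) v E ∧
      φ.source = Metric.ball 0 r ∧ φ.target ⊆ O ∧ φ 0 = p ∧
      ContDiffOn ℝ ∞ φ φ.source ∧ ContDiffOn ℝ ∞ φ.symm φ.target ∧
      h ∈ S.U ∧ ∀ x ∈ Metric.ball 0 r, f (φ x) = S.act h (S.psi E x) := by
  have hOp := hO.mem_nhds hp
  obtain ⟨g, hg, hgA⟩ := exists_adapted_lift hB hA ha ho
    (Filter.eventually_of_mem hOp fun x hx =>
      ⟨hf.mem x hx, hf.smooth.contDiffAt (hO.mem_nhds hx)⟩)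
    (Filter.eventually_of_mem hOp hf.tangent)
  obtain ⟨ρ, hρ, hball⟩ := Metric.eventually_nhds_iff_ball.1 ((hg.and hgA).and
    (Filter.eventually_of_mem hOp fun x hx => hx : ∀ᶠ x in 𝓝 p, x ∈ O))
  set N := Metric.ball p ρ with hN
  have hNo : IsOpen N := Metric.isOpen_ball
  have hpN : p ∈ N := Metric.mem_ball_self hρ
  have hgU : ∀ x ∈ N, g x ∈ S.U := fun x hx => (hball x hx).1.1.1
  have hfg : ∀ x ∈ N, f x = S.act (g x) 1 := fun x hx => (hball x hx).1.1.2.1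
  have hgs : ∀ x ∈ N, ContDiffAt ℝ ∞ (fun y => S.val (g y)) x := fun x hx =>
    (hball x hx).1.1.2.2
  have hNO : N ⊆ O := fun x hx => (hball x hx).2
  let α := S.logDeriv g
  have hα : ∀ x ∈ N, S.HasLogDerivAt g (α x) x := fun x hx =>
    hasLogDerivAt_logDeriv ((hgs x hx).differentiableAt (by simp))
  have hαs : ∀ x ∈ N, ContDiffAt ℝ ∞ α x := fun x hx => contDiffAt_logDeriv (hgs x hx)
  have hα𝔲 : ∀ x ∈ N, ∀ w, α x w ∈ S.𝔲 := fun x hx =>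
    (hα x hx).mem_𝔲 (Filter.eventually_of_mem (hNo.mem_nhds hx) hgU)
  have hαA : ∀ x ∈ N, ∀ w, S.projOdd (α x w) ∈ A := fun x hx => (hball x hx).1.2
  -- the coordinates `y` are the primitives of the components of the `𝔲₁`-part of `g⁻¹ dg`
  let L := (coord B a).comp S.projOdd
  let Θ : EuclideanSpace ℝ (Fin n) → EuclideanSpace ℝ (Fin n) →L[ℝ] EuclideanSpace ℝ (Fin n) :=
    fun x => L.comp (α x)
  have hΘ : ∀ x ∈ N, ∀ w, oneForm a (Θ x w) = S.projOdd (α x w) := fun x hx w =>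
    oneForm_coord ha ho (hαA x hx w)
  let C := ContinuousLinearMap.compL ℝ (EuclideanSpace ℝ (Fin n)) 𝔸 (EuclideanSpace ℝ (Fin n)) L
  have hΘC : Θ = fun x => C (α x) := rfl
  have hΘd : ∀ x ∈ N, HasFDerivAt Θ (C.comp (fderiv ℝ α x)) x := fun x hx =>
    HasFDerivAt.comp x (C.hasFDerivAt (x := α x))
      ((hαs x hx).differentiableAt (by simp)).hasFDerivAt
  have hΘs : ContDiffOn ℝ ∞ Θ N := fun x hx => by
    rw [hΘC]
    exact (C.contDiff.contDiffAt.comp x (hαs x hx)).contDiffWithinAt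
  have hΘdiff : DifferentiableOn ℝ Θ N := fun x hx =>
    (hΘd x hx).differentiableAt.differentiableWithinAt
  obtain ⟨y₀, hy₀⟩ := (convex_ball p ρ).exists_forall_hasFDerivAt_of_fderiv_symmetric hNo
    hΘdiff (fun x hx u w => by
      rw [(hΘd x hx).fderiv]
      have hmc := HasLogDerivAt.maurerCartan hNo hα hx ((hαs x hx).differentiableAt (by simp)) u w
      have h1 : L (fderiv ℝ α x u w - fderiv ℝ α x w u) = 0 := by
        rw [hmc, ← Ring.lie_def]
        exact coord_projOdd_lie hB hA ha (hα𝔲 x hx w) (hα𝔲 x hx u) (hαA x hx w) (hαA x hx u)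
      rw [map_sub, sub_eq_zero] at h1
      exact h1)
  let y : EuclideanSpace ℝ (Fin n) → EuclideanSpace ℝ (Fin n) := fun x => y₀ x - y₀ p
  have hy : ∀ x ∈ N, HasFDerivAt y (Θ x) x := fun x hx => (hy₀ x hx).sub_const _
  have hys : ContDiffOn ℝ ∞ y N := by
    rw [contDiffOn_infty_iff_fderiv_of_isOpen hNo]
    exact ⟨fun x hx => (hy x hx).differentiableAt.differentiableWithinAt,
      hΘs.congr fun x hx => (hy x hx).fderiv⟩
  have hinj : ∀ x ∈ N, ∃ e : EuclideanSpace ℝ (Fin n) ≃L[ℝ] EuclideanSpace ℝ (Fin n),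
      (e : EuclideanSpace ℝ (Fin n) →L[ℝ] EuclideanSpace ℝ (Fin n)) = Θ x := by
    intro x hx
    have h1 : Function.Injective (Θ x).toLinearMap := by
      rw [injective_iff_map_eq_zero]
      intro w hw
      have h2 : S.projOdd (α x w) = 0 := by
        rw [← hΘ x hx w, show Θ x w = 0 from hw, map_zero]
      refine (injective_iff_map_eq_zero _).1 (hf.immersion x (hNO hx)) w ?_
      rw [(hα x hx).fderiv_act_one (Filter.eventually_of_mem (hNo.mem_nhds hx) hfg), h2, smul_zero,
        mul_zero, zero_mul]
    exact ⟨(LinearEquiv.ofInjectiveEndo _ h1).toContinuousLinearEquiv, by ext w; rfl⟩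
  choose! Θe hΘe using hinj
  have hye : ∀ x ∈ N, HasFDerivAt y
      (Θe x : EuclideanSpace ℝ (Fin n) →L[ℝ] EuclideanSpace ℝ (Fin n)) x := fun x hx => by
    rw [hΘe x hx]; exact hy x hx
  have hyat : ∀ x ∈ N, ContDiffAt ℝ ∞ y x := fun x hx => hys.contDiffAt (hNo.mem_nhds hx)
  let e := ((hyat p hpN).toOpenPartialHomeomorph y (hye p hpN) (by simp)).restrOpen N hNo
  have heN : e.source ⊆ N := fun x hx => hx.2
  have hpe : p ∈ e.source :=
    ⟨(hyat p hpN).mem_toOpenPartialHomeomorph_source (hye p hpN) (by simp), hpN⟩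
  have hey : ∀ x, e x = y x := fun x => rfl
  have hep : e p = 0 := sub_self _
  have h0t : (0 : EuclideanSpace ℝ (Fin n)) ∈ e.target := hep ▸ e.map_source hpe
  obtain ⟨r, hr, hrt⟩ := Metric.isOpen_iff.1 e.open_target 0 h0t
  let φ := e.symm.restrOpen (Metric.ball 0 r) Metric.isOpen_ball
  have hφs : φ.source = Metric.ball 0 r := Set.inter_eq_right.2 hrt
  have hφN : ∀ x ∈ Metric.ball (0 : EuclideanSpace ℝ (Fin n)) r, φ x ∈ N := fun x hx =>
    heN (e.map_target (hrt hx))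
  have hφt : φ.target ⊆ N := fun x hx => heN hx.1
  have hφsm : ContDiffOn ℝ ∞ φ (Metric.ball 0 r) := fun x hx =>
    (e.contDiffAt_symm (hrt hx) (hye _ (hφN x hx)) (hyat _ (hφN x hx))).contDiffWithinAt
  have hφd : ∀ x ∈ Metric.ball (0 : EuclideanSpace ℝ (Fin n)) r, HasFDerivAt φ
      ((Θe (φ x)).symm : EuclideanSpace ℝ (Fin n) →L[ℝ] EuclideanSpace ℝ (Fin n)) x :=
    fun x hx => e.hasFDerivAt_symm (hrt hx) (hye _ (hφN x hx))
  have hφ0 : φ 0 = p := by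
    change e.symm 0 = p
    rw [← hep, e.left_inv hpe]
  have hgφ : ∀ x ∈ Metric.ball (0 : EuclideanSpace ℝ (Fin n)) r, S.HasLogDerivAt
      (fun x => g (φ x)) ((α (φ x)).comp
        ((Θe (φ x)).symm : EuclideanSpace ℝ (Fin n) →L[ℝ] EuclideanSpace ℝ (Fin n))) x :=
    fun x hx => (hα _ (hφN x hx)).comp (hφd x hx)
  let u : Fin n → EuclideanSpace ℝ (Fin n) → 𝔸 := fun i x =>
    α (φ x) ((Θe (φ x)).symm (EuclideanSpace.single i 1)) - a i
  obtain ⟨v, E, h, hv, hE, hh, hact⟩ := exists_solution_of_lift hB hA ha ho hr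
    (g := fun x => g (φ x)) (u := u)
    (fun x hx => ((hgs _ (hφN x hx)).comp x
      (hφsm.contDiffAt (Metric.isOpen_ball.mem_nhds hx))).contDiffWithinAt)
    (fun x hx => hgU _ (hφN x hx))
    (fun x hx i => by
      have h1 := sub_projOdd_mem
        (hα𝔲 _ (hφN x hx) ((Θe (φ x)).symm (EuclideanSpace.single i 1)))
      rw [← hΘ _ (hφN x hx), ← hΘe _ (hφN x hx), ContinuousLinearEquiv.coe_coe,
        ContinuousLinearEquiv.apply_symm_apply, oneForm_single] at h1
      exact h1)
    (fun x hx => by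
      have e1 : (oneForm fun i => a i + u i x) = (α (φ x)).comp
          ((Θe (φ x)).symm : EuclideanSpace ℝ (Fin n) →L[ℝ] EuclideanSpace ℝ (Fin n)) :=
        clm_ext_single fun i => by
          rw [oneForm_single]
          exact add_sub_cancel _ _
      rw [e1]
      exact hgφ x hx)
  refine ⟨r, hr, v, E, φ, h, hv, hE, hφs, hφt.trans hNO, hφ0, hφs ▸ hφsm, ?_, hh, fun x hx => ?_⟩
  · exact hys.mono hφt
  · rw [hfg _ (hφN x hx), hact x hx]

end SymmetricPair

end CurvedFlats

end

theorem theorem3p14 {𝔸 : Type*} [NormedRing 𝔸] [NormedAlgebra ℂ 𝔸] [FiniteDimensional ℂ 𝔸]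
    (S : CurvedFlats.SymmetricPair 𝔸) (B : LinearMap.BilinForm ℝ 𝔸) (hB : S.IsRiemannian B)
    {n : ℕ} (A : Submodule ℝ 𝔸) (hA : S.IsMaxAbelian A)
    (a : Fin n → 𝔸) (ha_span : Submodule.span ℝ (Set.range a) = A)
    (ha_orth : ∀ i j, B (a i) (a j) = if i = j then 1 else 0) :
    (∀ (Ω : Set (EuclideanSpace ℝ (Fin n))), IsOpen Ω → IsPreconnected Ω → 0 ∈ Ω →
      ∀ (v : EuclideanSpace ℝ (Fin n) → 𝔸) (E : EuclideanSpace ℝ (Fin n) → ℂ → S.G),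
        S.IsSolution B A a Ω v → S.IsFrame a Ω v E → S.IsCurvedFlat B Ω (S.psi E)) ∧
    (∀ (O : Set (EuclideanSpace ℝ (Fin n))), IsOpen O →
      ∀ f : EuclideanSpace ℝ (Fin n) → S.G, S.IsCurvedFlat B O f →
        (∀ x ∈ O, S.IsRegularPoint (f x)) →
        ∀ p ∈ O, ∃ r > 0, ∃ (v : EuclideanSpace ℝ (Fin n) → 𝔸)
          (E : EuclideanSpace ℝ (Fin n) → ℂ → S.G)
          (φ : OpenPartialHomeomorph (EuclideanSpace ℝ (Fin n)) (EuclideanSpace ℝ (Fin n)))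
          (h : S.G),
          S.IsSolution B A a (Metric.ball 0 r) v ∧ S.IsFrame a (Metric.ball 0 r) v E ∧
          φ.source = Metric.ball 0 r ∧ φ.target ⊆ O ∧ φ 0 = p ∧
          ContDiffOn ℝ ∞ φ φ.source ∧ ContDiffOn ℝ ∞ φ.symm φ.target ∧
          h ∈ S.U ∧ ∀ x ∈ Metric.ball 0 r, f (φ x) = S.act h (S.psi E x)) := by
  have : CompleteSpace 𝔸 := FiniteDimensional.complete ℂ 𝔸
  exact ⟨fun Ω hΩ hΩ' h0 v E hv hE =>
      CurvedFlats.SymmetricPair.isCurvedFlat_psi hB hA ha_span ha_orth hΩ hΩ' h0 hv.mem hE,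
    fun O hO f hf _ p hp =>
      CurvedFlats.SymmetricPair.exists_solution_of_isCurvedFlat hB hA ha_span ha_orth hO hf hp⟩
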